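/- Let $n,d\ge 1$ and let $\mathcal A=\mathbb Z[v^{\pm1},t^{\pm1}]$. For a field $F$ let $\mathscr X(F)$ be the set of $n$-step flags $0=V_0\subseteq V_1\subseteq\dots\subseteq V_n=F^d$, and let $G=\mathrm{GL}_d(F)$ act diagonally on $\mathscr X(F)\times\mathscr X(F)$. Let $\Theta_d$ be the set of $n\times n$ matrices over $\mathbb N$ whose entries add up to $d$. The $G$-orbits are parametrised by $\Theta_d$: the orbit $\mathcal O_A$ of $A=(a_{ij})$ consists of the pairs $(V,V')$ with $a_{ij}=\dim\frac{V_{i-1}+V_i\cap V'_j}{V_{i-1}+V_i\cap V'_{j-1}}$ for all $i,j$. Let $\mathcal S$ be the convolution algebra: the free $\mathcal A$-module of $\mathcal A$-valued $G$-invariant functions on pairs of flags, with basis the characteristic functions $e_A$ of the orbits $\mathcal O_A$, $A\in\Theta_d$, and with the $\mathcal A$-bilinear product $*$ which, for every power $q$ of an odd prime, becomes $(f*g)(V,V')=\sum_{V''\in\mathscr X(\mathbb F_q)}f(V,V'')\,g(V'',V')$ when $v$ is specialized to $\sqrt q$. For $A\in\Theta_d$ let $d(A)=\dim\mathcal O_A$,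 the dimension of the orbit over an algebraically closed field, let $r(A)=d(B)$ with $B$ the diagonal matrix with entries $b_{ii}=\sum_k a_{ik}$, and put $$\{A\}=v^{-(d(A)-r(A))}\,t^{\,d(A)-r(A)}\,e_A .$$ For $A,B\in\Theta_d$ write $A\preceq B$ if $\sum_{r\le i,\,s\ge j}a_{rs}\le\sum_{r\le i,\,s\ge j}b_{rs}$ for all $i<j$ and $\sum_{r\ge i,\,s\le j}a_{rs}\le\sum_{r\ge i,\,s\le j}b_{rs}$ for all $i>j$, and $A\prec B$ if moreover at least one of these inequalities is strict. Let $E_{kl}$ denote the matrix units. **Theorem.** For every $A=(a_{ij})\in\Theta_d$ there are uniquely determined diagonal matrices $D_{i,h,j}$ with entries in $\mathbb N$ (one for each triple with $1\le i\le h<j\le n$ and one for each triple with $1\le j\le h<i\le n$), such that all the matrices $D_{i,h,j}+a_{ij}E_{h,h+1}$ (for $i\le h<j$) and $D_{i,h,j}+a_{ij}E_{h+1,h}$ (for $j\le h<i$) lie in $\Theta_d$ and $$m_A:=\prod_{1\le i\le h<j\le n}\{D_{i,h,j}+a_{ij}E_{h,h+1}\}\;*\prod_{1\le j\le h<i\le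 n}\{D_{i,h,j}+a_{ij}E_{h+1,h}\}=\{A\}+\text{lower terms in }\mathcal S,$$ where "lower terms" is an $\mathcal A$-linear combination of elements $\{A'\}$ with $A'\in\Theta_d$, $A'\prec A$. The factors are multiplied from left to right in the following order. In the first product $(i,h,j)$ comes before $(i',h',j')$ if $j>j'$, or $j=j'$ and $h-i<h'-i'$, or $j=j'$, $h-i=h'-i'$ and $i>i'$. In the second product $(i,h,j)$ comes before $(i',h',j')$ if $i<i'$, or $i=i'$ and $h-j>h'-j'$, or $i=i'$, $h-j=h'-j'$ and $j<j'$. Consequently the elements $m_A$, $A\in\Theta_d$, form a basis of the $\mathcal A$-module $\mathcal S$. -/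

import Mathlib

open scoped LaurentPolynomial

/-! ## Flags, relative position, orbits -/

/-- The set `𝒳` of `n`-step flags `0 = V_0 ⊆ V_1 ⊆ ⋯ ⊆ V_n = F^d`. -/
def StepFlag (F : Type*) [Field F] (n d : ℕ) : Type _ :=
  {V : Fin (n + 1) → Submodule F (Fin d → F) //
    V 0 = ⊥ ∧ V (Fin.last n) = ⊤ ∧ ∀ i : Fin n, V i.castSucc ≤ V i.succ}

instance StepFlag.finite (F : Type*) [Field F] [Finite F] (n d : ℕ) : Finite (StepFlag F n d) := by
  have : Finite (Submodule F (Fin d → F)) :=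
    Finite.of_injective (fun W => (W : Set (Fin d → F))) SetLike.coe_injective
  exact Subtype.finite

noncomputable instance StepFlag.fintype (F : Type*) [Field F] [Finite F] (n d : ℕ) :
    Fintype (StepFlag F n d) := Fintype.ofFinite _

noncomputable instance StepFlag.decidableEq (F : Type*) [Field F] (n d : ℕ) :
    DecidableEq (StepFlag F n d) := Classical.decEq _

/-- The `n × n` matrix attached to a pair of flags; with `i, j` numbered from `1` its `(i, j)` entry
is `dim (V_{i-1} + V_i ∩ V'_j) / (V_{i-1} + V_i ∩ V'_{j-1})`. Two pairs of flags lie in the same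
`GL_d(F)`-orbit if and only if they have the same matrix, so that the orbit `𝒪_A` is the
set of pairs `(V, V')` with `relPos V V' = A`. -/
noncomputable def relPos {F : Type*} [Field F] {n d : ℕ} (V V' : StepFlag F n d) :
    Matrix (Fin n) (Fin n) ℕ :=
  Matrix.of fun i j =>
    let P := V.1 i.castSucc ⊔ (V.1 i.succ ⊓ V'.1 j.succ)
    let Q := V.1 i.castSucc ⊔ (V.1 i.succ ⊓ V'.1 j.castSucc)
    Module.finrank F (P ⧸ Q.submoduleOf P)

/-- `Θ_d`: the `n × n` matrices over `ℕ` whose entries add up to `d`. -/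
def Theta (n d : ℕ) : Set (Matrix (Fin n) (Fin n) ℕ) :=
  {A | ∑ i, ∑ j, A i j = d}

/-! ## Dimensions of orbits -/

/-- The algebra of endomorphisms of `K^d` that preserve all members of both flags. The stabilizer
`C_G(V, V')` is its group of units, a Zariski open subset of this linear space. -/
def stabAlg {K : Type*} [Field K] {n d : ℕ} (V V' : StepFlag K n d) :
    Submodule K (Module.End K (Fin d → K)) where
  carrier := {T | ∀ i, (∀ x ∈ V.1 i, T x ∈ V.1 i) ∧ (∀ x ∈ V'.1 i, T x ∈ V'.1 i)}
  add_mem' := fun hS hT i =>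
    ⟨fun x hx => add_mem ((hS i).1 x hx) ((hT i).1 x hx),
      fun x hx => add_mem ((hS i).2 x hx) ((hT i).2 x hx)⟩
  zero_mem' := fun _ => ⟨fun _ _ => zero_mem _, fun _ _ => zero_mem _⟩
  smul_mem' := fun c _ hT i =>
    ⟨fun x hx => Submodule.smul_mem _ c ((hT i).1 x hx),
      fun x hx => Submodule.smul_mem _ c ((hT i).2 x hx)⟩

/-- The dimension `dim G - dim C_G(V, V')` of the orbit `G · (V, V') ≃ G / C_G(V, V')`, for
`G = GL_d(K)` with `K` algebraically closed. -/
noncomputable def pairOrbitDim {K : Type*} [Field K] {n d : ℕ} (V V' : StepFlag K n d) : ℕ :=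
  Module.finrank K (Module.End K (Fin d → K) ⧸ stabAlg V V')

/-- `d(A) = dim 𝒪_A`. All pairs in `𝒪_A` give the same dimension, and there is such a pair when
`A ∈ Θ_d`, so that the supremum is over a one-element set. -/
noncomputable def orbitDim (K : Type*) [Field K] {n : ℕ} (d : ℕ)
    (A : Matrix (Fin n) (Fin n) ℕ) : ℕ :=
  sSup {m : ℕ | ∃ V V' : StepFlag K n d, relPos V V' = A ∧ m = pairOrbitDim V V'}

/-- `d(A) - r(A)`, where `r(A) = d(B)` for the diagonal matrix `B` of the row sums of `A`. -/
noncomputable def codimExp (K : Type*) [Field K] {n : ℕ} (d : ℕ)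
    (A : Matrix (Fin n) (Fin n) ℕ) : ℤ :=
  (orbitDim K d A : ℤ) - (orbitDim K d (Matrix.diagonal fun i => ∑ k, A i k) : ℤ)

/-! ## The generic convolution algebra -/

/-- `𝒜 = ℤ[v^{±1}, t^{±1}]`, as Laurent polynomials in `t` over Laurent polynomials in `v`. -/
abbrev CoeffRing : Type := ℤ[T;T⁻¹][T;T⁻¹]

/-- `v ^ k` in `𝒜`. -/
noncomputable def vPow (k : ℤ) : CoeffRing := LaurentPolynomial.C (LaurentPolynomial.T k)

/-- `t ^ k` in `𝒜`. -/
noncomputable def tPow (k : ℤ) : CoeffRing := LaurentPolynomial.T k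

/-- Prime powers `q = p ^ k` with `p` an odd prime and `k ≥ 1`. -/
structure OddPrimePower where
  p : ℕ
  k : ℕ
  prime : p.Prime
  odd : p ≠ 2
  pos : 0 < k

instance OddPrimePower.fact (q : OddPrimePower) : Fact q.p.Prime := ⟨q.prime⟩

/-- The number `q`. -/
def OddPrimePower.card (q : OddPrimePower) : ℕ := q.p ^ q.k

/-- The finite field `𝔽_q`. -/
abbrev OddPrimePower.field (q : OddPrimePower) : Type := GaloisField q.p q.k

/-- The square root of `q` as a unit of `ℝ`. -/
noncomputable def OddPrimePower.sqrtUnit (q : OddPrimePower) : ℝˣ :=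
  Units.mk0 (Real.sqrt (q.card : ℝ)) (by
    have h : 0 < q.card := pow_pos q.prime.pos _
    exact (Real.sqrt_pos.2 (by exact_mod_cast h)).ne')

/-- `t` as a unit of `ℝ[t^{±1}]`. -/
noncomputable def tUnit : (ℝ[T;T⁻¹])ˣ :=
  ⟨LaurentPolynomial.T 1, LaurentPolynomial.T (-1),
    by rw [← LaurentPolynomial.T_add]; simp, by rw [← LaurentPolynomial.T_add]; simp⟩

/-- The specialization `v ↦ √q`, `t ↦ t`, from `𝒜` to `ℝ[t^{±1}]`. -/
noncomputable def specialize (q : OddPrimePower) : CoeffRing →+* ℝ[T;T⁻¹] :=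
  LaurentPolynomial.eval₂
    ((LaurentPolynomial.C : ℝ →+* ℝ[T;T⁻¹]).comp
      (LaurentPolynomial.eval₂ (Int.castRingHom ℝ) q.sqrtUnit)) tUnit

/-- Families, indexed by all odd prime powers `q`, of functions on `𝒳(𝔽_q) × 𝒳(𝔽_q)` with values in
`ℝ[t^{±1}]`. The product of each member is the convolution
`(f * g)(V, V') = ∑_{V''} f(V, V'') g(V'', V')`, that is, the product of matrices indexed by flags;
families are multiplied member by member. -/
def ConvFamily (n d : ℕ) : Type :=
  ∀ q : OddPrimePower, Matrix (StepFlag q.field n d) (StepFlag q.field n d) ℝ[T;T⁻¹]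

noncomputable instance ConvFamily.ring (n d : ℕ) : Ring (ConvFamily n d) :=
  inferInstanceAs (Ring (∀ q : OddPrimePower,
    Matrix (StepFlag q.field n d) (StepFlag q.field n d) ℝ[T;T⁻¹]))

/-- The scalars: `a ∈ 𝒜` acts on the member at `q` through its specialization at `v = √q`. -/
noncomputable def ConvFamily.scalar (n d : ℕ) : CoeffRing →+* ConvFamily n d :=
  RingHom.pi fun q => (Matrix.scalar (StepFlag q.field n d)).comp (specialize q)

noncomputable instance ConvFamily.algebra (n d : ℕ) : Algebra CoeffRing (ConvFamily n d) :=
  (ConvFamily.scalar n d).toAlgebra' fun a f => by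
    funext q
    exact (Matrix.scalar_commute (specialize q a) (fun r => mul_comm _ r) (f q)).eq

/-- The generic `G`-invariant function with the value `c A ∈ 𝒜` on the orbit `𝒪_A`, for all `A`. -/
noncomputable def invariantFun {n : ℕ} (d : ℕ) (c : Matrix (Fin n) (Fin n) ℕ → CoeffRing) :
    ConvFamily n d :=
  fun q => Matrix.of fun V V' => specialize q (c (relPos V V'))

/-- The convolution algebra `𝒮` over `𝒜`, whose elements are the `𝒜`-valued `G`-invariant functions,
with the product that becomes the convolution over `𝔽_q` when `v` is specialized to `√q`. (The
numbers of flags that occur as structure constants are polynomials in `q = v ^ 2`, so that the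
generating set below is closed under multiplication.) -/
noncomputable def convAlg (n d : ℕ) : Subalgebra CoeffRing (ConvFamily n d) :=
  Algebra.adjoin CoeffRing (Set.range (invariantFun (n := n) d))

open Classical in
/-- `e_A`, the characteristic function of the orbit `𝒪_A`. -/
noncomputable def orbitFun {n : ℕ} (d : ℕ) (A : Matrix (Fin n) (Fin n) ℕ) : convAlg n d :=
  ⟨invariantFun d (fun M => if M = A then 1 else 0), Algebra.subset_adjoin ⟨_, rfl⟩⟩

/-- `{A} = v^{-(d(A) - r(A))} t^{d(A) - r(A)} e_A`. -/
noncomputable def stdElt (K : Type*) [Field K] {n : ℕ} (d : ℕ)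
    (A : Matrix (Fin n) (Fin n) ℕ) : convAlg n d :=
  (vPow (-codimExp K d A) * tPow (codimExp K d A)) • orbitFun d A

/-! ## The order on matrices -/

/-- The relation `A ⪯ B`. -/
def MatPreceq {n : ℕ} (A B : Matrix (Fin n) (Fin n) ℕ) : Prop :=
  (∀ i j : Fin n, i < j →
    ∑ r ∈ Finset.Iic i, ∑ s ∈ Finset.Ici j, A r s
      ≤ ∑ r ∈ Finset.Iic i, ∑ s ∈ Finset.Ici j, B r s) ∧
  (∀ i j : Fin n, j < i →
    ∑ r ∈ Finset.Ici i, ∑ s ∈ Finset.Iic j, A r s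
      ≤ ∑ r ∈ Finset.Ici i, ∑ s ∈ Finset.Iic j, B r s)

/-- The relation `A ≺ B`: `A ⪯ B` and at least one of the inequalities is strict. -/
def MatPrec {n : ℕ} (A B : Matrix (Fin n) (Fin n) ℕ) : Prop :=
  MatPreceq A B ∧
  ((∃ i j : Fin n, i < j ∧
    ∑ r ∈ Finset.Iic i, ∑ s ∈ Finset.Ici j, A r s
      < ∑ r ∈ Finset.Iic i, ∑ s ∈ Finset.Ici j, B r s) ∨
  (∃ i j : Fin n, j < i ∧
    ∑ r ∈ Finset.Ici i, ∑ s ∈ Finset.Iic j, A r s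
      < ∑ r ∈ Finset.Ici i, ∑ s ∈ Finset.Iic j, B r s))

/-- The `𝒜`-linear combinations of the `{A'}` with `A' ∈ Θ_d` and `A' ≺ A`. -/
noncomputable def lowerTerms (K : Type*) [Field K] {n : ℕ} (d : ℕ)
    (A : Matrix (Fin n) (Fin n) ℕ) : Submodule CoeffRing (convAlg n d) :=
  Submodule.span CoeffRing {x | ∃ A' ∈ Theta n d, MatPrec A' A ∧ x = stdElt K d A'}

/-! ## The ordered products -/

/-- Triples `(i, h, j)` with `i ≤ h < j`. -/
abbrev UpperTriple (n : ℕ) : Type :=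
  {x : Fin n × Fin n × Fin n // x.1 ≤ x.2.1 ∧ x.2.1 < x.2.2}

/-- Triples `(i, h, j)` with `j ≤ h < i`. -/
abbrev LowerTriple (n : ℕ) : Type :=
  {x : Fin n × Fin n × Fin n // x.2.2 ≤ x.2.1 ∧ x.2.1 < x.1}

/-- `(i, h, j)` comes before `(i', h', j')` in the first product. -/
def UpperBefore {n : ℕ} : UpperTriple n → UpperTriple n → Prop
  | ⟨(i, h, j), _⟩, ⟨(i', h', j'), _⟩ =>
    j' < j ∨
    (j = j' ∧ (h : ℤ) - (i : ℤ) < (h' : ℤ) - (i' : ℤ)) ∨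
    (j = j' ∧ (h : ℤ) - (i : ℤ) = (h' : ℤ) - (i' : ℤ) ∧ i' < i)

/-- `(i, h, j)` comes before `(i', h', j')` in the second product. -/
def LowerBefore {n : ℕ} : LowerTriple n → LowerTriple n → Prop
  | ⟨(i, h, j), _⟩, ⟨(i', h', j'), _⟩ =>
    i < i' ∨
    (i = i' ∧ (h' : ℤ) - (j' : ℤ) < (h : ℤ) - (j : ℤ)) ∨
    (i = i' ∧ (h : ℤ) - (j : ℤ) = (h' : ℤ) - (j' : ℤ) ∧ j < j')

/-- The reflexive closure of `UpperBefore`, a total order. -/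
def UpperLE {n : ℕ} (x y : UpperTriple n) : Prop := x = y ∨ UpperBefore x y

/-- The reflexive closure of `LowerBefore`, a total order. -/
def LowerLE {n : ℕ} (x y : LowerTriple n) : Prop := x = y ∨ LowerBefore x y

noncomputable instance UpperLE.decidable {n : ℕ} :
    DecidableRel (UpperLE : UpperTriple n → UpperTriple n → Prop) := Classical.decRel _

noncomputable instance LowerLE.decidable {n : ℕ} :
    DecidableRel (LowerLE : LowerTriple n → LowerTriple n → Prop) := Classical.decRel _

instance UpperLE.trans {n : ℕ} :
    IsTrans (UpperTriple n) (UpperLE : UpperTriple n → UpperTriple n → Prop) where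
  trans := by
    rintro ⟨⟨i, h, j⟩, _⟩ ⟨⟨i', h', j'⟩, _⟩ ⟨⟨i'', h'', j''⟩, _⟩
    simp only [UpperLE, UpperBefore, Subtype.mk.injEq, Prod.mk.injEq, Fin.ext_iff, Fin.lt_def]
    omega

instance UpperLE.antisymm {n : ℕ} :
    Std.Antisymm (UpperLE : UpperTriple n → UpperTriple n → Prop) where
  antisymm := by
    rintro ⟨⟨i, h, j⟩, _⟩ ⟨⟨i', h', j'⟩, _⟩
    simp only [UpperLE, UpperBefore, Subtype.mk.injEq, Prod.mk.injEq, Fin.ext_iff, Fin.lt_def]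
    omega

instance UpperLE.total {n : ℕ} :
    Std.Total (UpperLE : UpperTriple n → UpperTriple n → Prop) where
  total := by
    rintro ⟨⟨i, h, j⟩, _⟩ ⟨⟨i', h', j'⟩, _⟩
    simp only [UpperLE, UpperBefore, Subtype.mk.injEq, Prod.mk.injEq, Fin.ext_iff, Fin.lt_def]
    omega

instance LowerLE.trans {n : ℕ} :
    IsTrans (LowerTriple n) (LowerLE : LowerTriple n → LowerTriple n → Prop) where
  trans := by
    rintro ⟨⟨i, h, j⟩, _⟩ ⟨⟨i', h', j'⟩, _⟩ ⟨⟨i'', h'', j''⟩, _⟩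
    simp only [LowerLE, LowerBefore, Subtype.mk.injEq, Prod.mk.injEq, Fin.ext_iff, Fin.lt_def]
    omega

instance LowerLE.antisymm {n : ℕ} :
    Std.Antisymm (LowerLE : LowerTriple n → LowerTriple n → Prop) where
  antisymm := by
    rintro ⟨⟨i, h, j⟩, _⟩ ⟨⟨i', h', j'⟩, _⟩
    simp only [LowerLE, LowerBefore, Subtype.mk.injEq, Prod.mk.injEq, Fin.ext_iff, Fin.lt_def]
    omega

instance LowerLE.total {n : ℕ} :
    Std.Total (LowerLE : LowerTriple n → LowerTriple n → Prop) where
  total := by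
    rintro ⟨⟨i, h, j⟩, _⟩ ⟨⟨i', h', j'⟩, _⟩
    simp only [LowerLE, LowerBefore, Subtype.mk.injEq, Prod.mk.injEq, Fin.ext_iff, Fin.lt_def]
    omega

/-- A choice of a diagonal matrix `D_{i,h,j}` over `ℕ`, given by its diagonal, for each triple of
the first and for each triple of the second product. -/
abbrev DiagData (n : ℕ) : Type :=
  (UpperTriple n → Fin n → ℕ) × (LowerTriple n → Fin n → ℕ)

/-- The matrix `D_{i,h,j} + a_{ij} E_{h,h+1}`. -/
def upperFactor {n : ℕ} (A : Matrix (Fin n) (Fin n) ℕ) (D : DiagData n) (x : UpperTriple n) :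
    Matrix (Fin n) (Fin n) ℕ :=
  Matrix.diagonal (D.1 x) + Matrix.of fun r s : Fin n =>
    if r = x.1.2.1 ∧ (s : ℕ) = (x.1.2.1 : ℕ) + 1 then A x.1.1 x.1.2.2 else 0

/-- The matrix `D_{i,h,j} + a_{ij} E_{h+1,h}`. -/
def lowerFactor {n : ℕ} (A : Matrix (Fin n) (Fin n) ℕ) (D : DiagData n) (x : LowerTriple n) :
    Matrix (Fin n) (Fin n) ℕ :=
  Matrix.diagonal (D.2 x) + Matrix.of fun r s : Fin n =>
    if (r : ℕ) = (x.1.2.1 : ℕ) + 1 ∧ s = x.1.2.1 then A x.1.1 x.1.2.2 else 0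

/-- The element `m_A`: the product, in the first order, of the `{D_{i,h,j} + a_{ij} E_{h,h+1}}`
over `i ≤ h < j`, times the product, in the second order, of the `{D_{i,h,j} + a_{ij} E_{h+1,h}}`
over `j ≤ h < i`. -/
noncomputable def monomialElt (K : Type*) [Field K] {n : ℕ} (d : ℕ)
    (A : Matrix (Fin n) (Fin n) ℕ) (D : DiagData n) : convAlg n d :=
  (((Finset.univ : Finset (UpperTriple n)).sort UpperLE).map
      fun x => stdElt K d (upperFactor A D x)).prod *
  (((Finset.univ : Finset (LowerTriple n)).sort LowerLE).map
      fun x => stdElt K d (lowerFactor A D x)).prod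

/-- All factors of `m_A` are indexed by matrices in `Θ_d`, and `m_A = {A} + lower terms`. -/
def IsTriangular (K : Type*) [Field K] {n : ℕ} (d : ℕ)
    (A : Matrix (Fin n) (Fin n) ℕ) (D : DiagData n) : Prop :=
  (∀ x, upperFactor A D x ∈ Theta n d) ∧ (∀ x, lowerFactor A D x ∈ Theta n d) ∧
    ∃ L ∈ lowerTerms K d A, monomialElt K d A D = stdElt K d A + L

/-! Indices count from 0, as in the code. At a pair `(V, W)` a product of orbit functions counts
chains of flags. A factor `D + c E_{h,h+1}` says that member `h + 1` loses `c` dimensions while all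
others stay, and `D` records step dimensions; the factors of the second product are transposes of
such matrices. So, up to a power of `t / v`, `m_A` counts pairs of descending chains from `V` to `U`
and from `W` to `U`, the first ruled by the entries of `A` above the diagonal, the second in the
same way by those of the transpose.

The heart is the analysis of one descending chain in the prescribed order. Phase `j`, made of the
triples with last index `j`, shrinks the members `m ≤ j`, and afterwards the member `j` no longer
moves. Hence a chain from `X` to `U` forces `dim X_i - dim (X_i ∩ U_m)` to be at most the sum of the
entries in the rows `< i` and columns `≥ m` (`tripleList_necessary`), and if equality holds for all
`i ≤ m` there is exactly one chain (`tripleList_sufficient`). Since `U` lies in `W`, the inequality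
bounds the corner sums of `relPos V W` by those of `A`. If `relPos V W = A`, dimensions force `U = V
∩ W` member by member, with a single chain on each side. So the count is 1 on the orbit of `A` and
vanishes off the orbits of `A` and of matrices `≺ A`.

A product of orbit functions is nonzero only if the row sums of each factor are the column sums of
the preceding one. Starting from the row sums of `A` this determines every `D`; a chain over any
finite field shows that a solution exists.

The powers of `v` and `t` match because `d(A) - r(A)`, computed from the stabilizers, is the sum of
`a_ij a_kl` over `k ≤ i`, `j < l`. The terms with `i < l` come from the first product and those with
`l ≤ i` from the second (`sum_codimExp`).

It remains to see that the coefficients lie in `𝒜`. Convolution by an elementary orbit function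
changes one member of a flag, and the number of choices is a polynomial in `q`
(`exists_polynomial_card_submodule`), so monomials preserve generic invariant functions. By
triangularity every `e_A` is a combination of monomials; hence the whole algebra consists of generic
invariant functions and is spanned by the monomials. They are as many as the independent `e_A`,
hence independent. -/

/-! ## Flags with natural number indices -/

section Flags

variable {F : Type*} [Field F] {n d : ℕ}

/-- The `m`-th member of a flag, equal to the whole space for `m ≥ n`. -/
def StepFlag.sub (V : StepFlag F n d) (m : ℕ) : Submodule F (Fin d → F) :=
  V.1 ⟨min m n, by omega⟩

theorem StepFlag.sub_zero (V : StepFlag F n d) : V.sub 0 = ⊥ :=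
  (congrArg V.1 (Fin.ext (by simp))).trans V.2.1

theorem StepFlag.sub_of_le (V : StepFlag F n d) {m : ℕ} (h : n ≤ m) : V.sub m = ⊤ :=
  (congrArg V.1 (Fin.ext (by simp [h]))).trans V.2.2.1

theorem StepFlag.coe_monotone (V : StepFlag F n d) : Monotone V.1 :=
  Fin.monotone_iff_le_succ.2 V.2.2.2

theorem StepFlag.sub_mono (V : StepFlag F n d) : Monotone V.sub := fun a b h =>
  V.coe_monotone (by simp only [Fin.le_def]; omega)

theorem StepFlag.sub_val (V : StepFlag F n d) (i : Fin (n + 1)) : V.1 i = V.sub i :=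
  congrArg V.1 (Fin.ext (by simp only; omega))

theorem StepFlag.ext_sub {V W : StepFlag F n d} (h : ∀ m, 0 < m → m < n → V.sub m = W.sub m) :
    V = W := by
  apply Subtype.ext
  funext i
  rw [V.sub_val, W.sub_val]
  rcases Nat.eq_zero_or_pos (i : ℕ) with h0 | h0
  · rw [h0, V.sub_zero, W.sub_zero]
  rcases Nat.lt_or_ge (i : ℕ) n with h1 | h1
  · exact h _ h0 h1
  · rw [V.sub_of_le h1, W.sub_of_le h1]

/-- A flag from a monotone sequence of subspaces. -/
def StepFlag.mk (f : ℕ → Submodule F (Fin d → F)) (h0 : f 0 = ⊥) (hn : f n = ⊤)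
    (hf : Monotone f) : StepFlag F n d :=
  ⟨fun i => f i, by simpa using h0, by simpa using hn, fun i => hf (by simp)⟩

theorem StepFlag.sub_mk (f : ℕ → Submodule F (Fin d → F)) (h0 : f 0 = ⊥) (hn : f n = ⊤)
    (hf : Monotone f) (m : ℕ) : (StepFlag.mk f h0 hn hf).sub m = f m := by
  simp only [StepFlag.sub, StepFlag.mk]
  rcases Nat.le_total m n with h | h
  · rw [min_eq_left h]
  · rw [min_eq_right h, hn]
    exact (top_le_iff.1 (hn ▸ hf h)).symm

/-- The dimension of the intersection of the `i`-th and the `j`-th members of two flags. -/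
noncomputable def interDim (V W : StepFlag F n d) (i j : ℕ) : ℕ :=
  Module.finrank F (V.sub i ⊓ W.sub j : Submodule F (Fin d → F))

/-- The dimension of the `m`-th member of a flag. -/
noncomputable def StepFlag.dim (V : StepFlag F n d) (m : ℕ) : ℕ :=
  Module.finrank F (V.sub m)

theorem interDim_comm (V W : StepFlag F n d) (i j : ℕ) : interDim V W i j = interDim W V j i := by
  rw [interDim, interDim, inf_comm]

theorem interDim_top_right (V W : StepFlag F n d) (i : ℕ) {j : ℕ} (h : n ≤ j) :
    interDim V W i j = V.dim i := by
  rw [interDim, W.sub_of_le h, inf_top_eq, StepFlag.dim]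

theorem interDim_top_left (V W : StepFlag F n d) {i : ℕ} (j : ℕ) (h : n ≤ i) :
    interDim V W i j = W.dim j := by
  rw [interDim, V.sub_of_le h, top_inf_eq, StepFlag.dim]

theorem interDim_zero_left (V W : StepFlag F n d) (j : ℕ) : interDim V W 0 j = 0 := by
  rw [interDim, V.sub_zero, bot_inf_eq, finrank_bot]

theorem interDim_zero_right (V W : StepFlag F n d) (i : ℕ) : interDim V W i 0 = 0 := by
  rw [interDim, W.sub_zero, inf_bot_eq, finrank_bot]

theorem StepFlag.dim_of_le (V : StepFlag F n d) {m : ℕ} (h : n ≤ m) : V.dim m = d := by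
  rw [StepFlag.dim, V.sub_of_le h, finrank_top, Module.finrank_fin_fun]

theorem StepFlag.dim_mono (V : StepFlag F n d) : Monotone V.dim := fun _ _ h =>
  Submodule.finrank_mono (V.sub_mono h)

/-- The dimension formula for `V_i + (V_{i+1} ∩ W_j)`, whose summands meet in `V_i ∩ W_j`, turns an
entry into a second difference of intersection dimensions. The additive form avoids truncated
subtraction. -/
theorem relPos_apply_add (V W : StepFlag F n d) (i j : Fin n) :
    relPos V W i j + interDim V W i (j + 1) + interDim V W (i + 1) j =
      interDim V W (i + 1) (j + 1) + interDim V W i j := by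
  have key : relPos V W i j =
      Module.finrank F (↥(V.sub i ⊔ (V.sub (i + 1) ⊓ W.sub (j + 1))) ⧸
        (V.sub i ⊔ (V.sub (i + 1) ⊓ W.sub j)).submoduleOf
          (V.sub i ⊔ (V.sub (i + 1) ⊓ W.sub (j + 1)))) := by
    have e1 : V.1 i.castSucc = V.sub i := V.sub_val _
    have e2 : V.1 i.succ = V.sub (i + 1) := V.sub_val _
    have e3 : W.1 j.castSucc = W.sub j := W.sub_val _
    have e4 : W.1 j.succ = W.sub (j + 1) := W.sub_val _
    rw [← e1, ← e2, ← e3, ← e4]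
    rfl
  have hle : V.sub i ⊔ (V.sub (i + 1) ⊓ W.sub j) ≤ V.sub i ⊔ (V.sub (i + 1) ⊓ W.sub (j + 1)) :=
    sup_le_sup_left (inf_le_inf_left _ (W.sub_mono (Nat.le_succ _))) _
  have h1 := Submodule.finrank_quotient_add_finrank ((V.sub i ⊔ (V.sub (i + 1) ⊓ W.sub j)).submoduleOf
          (V.sub i ⊔ (V.sub (i + 1) ⊓ W.sub (j + 1))))
  rw [← key, (Submodule.submoduleOfEquivOfLe hle).finrank_eq] at h1
  have h2 := Submodule.finrank_sup_add_finrank_inf_eq (V.sub i) (V.sub (i + 1) ⊓ W.sub j)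
  have h3 := Submodule.finrank_sup_add_finrank_inf_eq (V.sub i) (V.sub (i + 1) ⊓ W.sub (j + 1))
  rw [← inf_assoc, inf_eq_left.2 (V.sub_mono (Nat.le_succ _))] at h2 h3
  simp only [interDim]
  omega

end Flags

/-! ## Corner sums of matrices -/

section Corner

variable {n : ℕ}

/-- The sum of the entries in the first `i` rows and the first `j` columns. -/
def cornerSum (A : Matrix (Fin n) (Fin n) ℕ) (i j : ℕ) : ℕ :=
  ∑ r : Fin n, ∑ s : Fin n, if (r : ℕ) < i ∧ (s : ℕ) < j then A r s else 0

theorem cornerSum_zero_left (A : Matrix (Fin n) (Fin n) ℕ) (j : ℕ) : cornerSum A 0 j = 0 := by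
  simp [cornerSum]

theorem cornerSum_zero_right (A : Matrix (Fin n) (Fin n) ℕ) (i : ℕ) : cornerSum A i 0 = 0 := by
  simp [cornerSum]

theorem cornerSum_succ_succ (A : Matrix (Fin n) (Fin n) ℕ) (i j : Fin n) :
    A i j + cornerSum A i (j + 1) + cornerSum A (i + 1) j =
      cornerSum A (i + 1) (j + 1) + cornerSum A i j := by
  have : A i j = ∑ r : Fin n, ∑ s : Fin n, if r = i ∧ s = j then A r s else 0 := by
    simp [ite_and]
  rw [this]
  simp only [cornerSum, ← Finset.sum_add_distrib]
  refine Finset.sum_congr rfl fun r _ => Finset.sum_congr rfl fun s _ => ?_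
  simp only [Fin.ext_iff]
  split_ifs <;> omega

theorem cornerSum_of_le_left (A : Matrix (Fin n) (Fin n) ℕ) {i : ℕ} (j : ℕ) (h : n ≤ i) :
    cornerSum A i j = cornerSum A n j := by
  refine Finset.sum_congr rfl fun r _ => Finset.sum_congr rfl fun s _ => ?_
  have := r.2
  congr 1
  apply propext
  omega

theorem cornerSum_of_le_right (A : Matrix (Fin n) (Fin n) ℕ) (i : ℕ) {j : ℕ} (h : n ≤ j) :
    cornerSum A i j = cornerSum A i n := by
  refine Finset.sum_congr rfl fun r _ => Finset.sum_congr rfl fun s _ => ?_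
  have := s.2
  congr 1
  apply propext
  omega

theorem cornerSum_transpose (A : Matrix (Fin n) (Fin n) ℕ) (i j : ℕ) :
    cornerSum A.transpose i j = cornerSum A j i := by
  rw [cornerSum, cornerSum, Finset.sum_comm]
  simp only [Matrix.transpose_apply, and_comm]

theorem eq_of_cornerSum_eq {A B : Matrix (Fin n) (Fin n) ℕ}
    (h : ∀ i j, i ≤ n → j ≤ n → cornerSum A i j = cornerSum B i j) : A = B := by
  ext i j
  have h1 := cornerSum_succ_succ A i j
  have h2 := cornerSum_succ_succ B i j
  rw [h _ _ (by omega) (by omega), h _ _ (by omega) (by omega), h _ _ (by omega) (by omega),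
    h _ _ (by omega) (by omega)] at h1
  omega

variable {F : Type*} [Field F] {d : ℕ}

/-- Both sides vanish on the axes, have the same second differences, and are constant beyond `n`. -/
theorem interDim_eq_cornerSum (V W : StepFlag F n d) (i j : ℕ) :
    interDim V W i j = cornerSum (relPos V W) i j := by
  have main : ∀ i j, i ≤ n → j ≤ n → interDim V W i j = cornerSum (relPos V W) i j := by
    intro i
    induction i with
    | zero => intro j _ _; rw [interDim_zero_left, cornerSum_zero_left]
    | succ i ih =>
      intro j hi
      induction j with
      | zero => intro _; rw [interDim_zero_right, cornerSum_zero_right]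
      | succ j ihj =>
        intro hj
        have h1 := relPos_apply_add V W ⟨i, hi⟩ ⟨j, hj⟩
        have h2 := cornerSum_succ_succ (relPos V W) ⟨i, hi⟩ ⟨j, hj⟩
        have h3 := ih j (by omega) (by omega)
        have h4 := ih (j + 1) (by omega) (by omega)
        have h5 := ihj (by omega)
        simp only at h1 h2
        omega
  have e1 : interDim V W i j = interDim V W (min i n) (min j n) := by
    have : ∀ (V : StepFlag F n d) i, V.sub i = V.sub (min i n) := fun V i => by
      simp [StepFlag.sub]
    rw [interDim, interDim, this V, this W]
  have e2 : cornerSum (relPos V W) i j = cornerSum (relPos V W) (min i n) (min j n) := by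
    rcases Nat.le_total i n with h | h <;> rcases Nat.le_total j n with h' | h' <;>
      simp [h, h', cornerSum_of_le_left (h := h), cornerSum_of_le_right (h := h')]
  rw [e1, e2, main _ _ (by omega) (by omega)]

theorem relPos_eq_iff (V W : StepFlag F n d) (A : Matrix (Fin n) (Fin n) ℕ) :
    relPos V W = A ↔ ∀ i j, i ≤ n → j ≤ n → interDim V W i j = cornerSum A i j := by
  constructor
  · rintro rfl i j _ _
    exact interDim_eq_cornerSum V W i j
  · intro h
    apply eq_of_cornerSum_eq
    intro i j hi hj
    rw [← interDim_eq_cornerSum, h i j hi hj]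

theorem relPos_transpose (V W : StepFlag F n d) : relPos W V = (relPos V W).transpose := by
  rw [relPos_eq_iff]
  intro i j _ _
  rw [cornerSum_transpose, ← interDim_eq_cornerSum, interDim_comm]

theorem cornerSum_full (A : Matrix (Fin n) (Fin n) ℕ) : cornerSum A n n = ∑ i, ∑ j, A i j := by
  simp [cornerSum]

theorem mem_Theta_iff {A : Matrix (Fin n) (Fin n) ℕ} : A ∈ Theta n d ↔ cornerSum A n n = d := by
  rw [cornerSum_full]
  rfl

theorem relPos_mem_Theta (V W : StepFlag F n d) : relPos V W ∈ Theta n d := by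
  rw [mem_Theta_iff, ← interDim_eq_cornerSum, interDim_top_right _ _ _ le_rfl,
    StepFlag.dim_of_le _ le_rfl]

theorem transpose_mem_Theta {A : Matrix (Fin n) (Fin n) ℕ} (h : A ∈ Theta n d) :
    A.transpose ∈ Theta n d := by
  rw [mem_Theta_iff] at h ⊢
  rw [cornerSum_transpose, h]

/-- The row sums of a matrix. -/
def rowSum (A : Matrix (Fin n) (Fin n) ℕ) (i : Fin n) : ℕ := ∑ k, A i k

/-- The dimensions of the successive quotients of a flag. -/
noncomputable def StepFlag.type (V : StepFlag F n d) (i : Fin n) : ℕ := V.dim (i + 1) - V.dim i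

theorem cornerSum_succ_full (A : Matrix (Fin n) (Fin n) ℕ) (i : Fin n) :
    cornerSum A (i + 1) n = cornerSum A i n + rowSum A i := by
  have : rowSum A i = ∑ r : Fin n, ∑ s : Fin n, if r = i then A r s else 0 := by
    rw [rowSum, Finset.sum_comm]
    simp
  rw [this]
  simp only [cornerSum, ← Finset.sum_add_distrib]
  refine Finset.sum_congr rfl fun r _ => Finset.sum_congr rfl fun s _ => ?_
  have := s.2
  simp only [Fin.ext_iff]
  split_ifs <;> omega

theorem dim_eq_cornerSum (V W : StepFlag F n d) (i : ℕ) :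
    V.dim i = cornerSum (relPos V W) i n := by
  rw [← interDim_eq_cornerSum, interDim_top_right _ _ _ le_rfl]

theorem rowSum_relPos (V W : StepFlag F n d) : rowSum (relPos V W) = V.type := by
  funext i
  rw [StepFlag.type, dim_eq_cornerSum V W, dim_eq_cornerSum V W, cornerSum_succ_full]
  omega

theorem rowSum_relPos_transpose (V W : StepFlag F n d) :
    rowSum (relPos V W).transpose = W.type := by
  rw [← relPos_transpose, rowSum_relPos]

end Corner

/-! ## Elementary steps -/

section Steps

variable {F : Type*} [Field F] {n d : ℕ}

/-- The flag `W` arises from `V` by shrinking the `g`-th member by `c` dimensions. -/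
def IsStep (g c : ℕ) (V W : StepFlag F n d) : Prop :=
  (∀ m, m ≠ g → W.sub m = V.sub m) ∧ W.sub g ≤ V.sub g ∧ V.dim g = W.dim g + c

theorem IsStep.le {g c : ℕ} {V W : StepFlag F n d} (h : IsStep g c V W) (m : ℕ) :
    W.sub m ≤ V.sub m := by
  by_cases hm : m = g
  · exact hm ▸ h.2.1
  · exact (h.1 m hm).le

/-- The matrix `D + c E_{h,h+1}`, where `D` is diagonal with entries `δ`. -/
def elemMat (h c : ℕ) (δ : Fin n → ℕ) : Matrix (Fin n) (Fin n) ℕ :=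
  Matrix.diagonal δ + Matrix.of fun r s : Fin n => if (r : ℕ) = h ∧ (s : ℕ) = h + 1 then c else 0

theorem elemMat_apply (h c : ℕ) (δ : Fin n → ℕ) (r s : Fin n) :
    elemMat h c δ r s = (if r = s then δ r else 0) +
      if (r : ℕ) = h ∧ (s : ℕ) = h + 1 then c else 0 := by
  simp [elemMat, Matrix.diagonal_apply]

theorem rowSum_elemMat {h : ℕ} (hh : h + 1 < n) (c : ℕ) (δ : Fin n → ℕ) (i : Fin n) :
    rowSum (elemMat h c δ) i = δ i + if (i : ℕ) = h then c else 0 := by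
  simp only [rowSum, elemMat_apply, Finset.sum_add_distrib]
  congr 1
  · simp
  · rw [Finset.sum_eq_single ⟨h + 1, hh⟩]
    · simp
    · intro b _ hb
      rw [if_neg]
      rintro ⟨-, h2⟩
      exact hb (Fin.ext h2)
    · simp

theorem rowSum_elemMat_transpose {h : ℕ} (hh : h + 1 < n) (c : ℕ) (δ : Fin n → ℕ) (i : Fin n) :
    rowSum (elemMat h c δ).transpose i = δ i + if (i : ℕ) = h + 1 then c else 0 := by
  simp only [rowSum, Matrix.transpose_apply, elemMat_apply, Finset.sum_add_distrib]
  congr 1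
  · simp
  · rw [Finset.sum_eq_single ⟨h, by omega⟩]
    · simp
    · intro b _ hb
      rw [if_neg]
      rintro ⟨h2, -⟩
      exact hb (Fin.ext h2)
    · simp

theorem cornerSum_elemMat {h : ℕ} (hh : h + 1 < n) (c : ℕ) (δ : Fin n → ℕ) (i j : ℕ) :
    cornerSum (elemMat h c δ) i j =
      (∑ r : Fin n, if (r : ℕ) < min i j then δ r else 0) +
        if h < i ∧ h + 1 < j then c else 0 := by
  have e : ∀ r s : Fin n, (if (r : ℕ) < i ∧ (s : ℕ) < j then elemMat h c δ r s else 0) =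
      (if r = s then (if (r : ℕ) < min i j then δ r else 0) else 0) +
      (if r = ⟨h, by omega⟩ then
        (if s = ⟨h + 1, hh⟩ then (if h < i ∧ h + 1 < j then c else 0) else 0) else 0) := by
    intro r s
    rw [elemMat_apply]
    simp only [Fin.ext_iff]
    split_ifs <;> omega
  simp only [cornerSum, e, Finset.sum_add_distrib]
  simp

/-- As only one member shrinks, `V_i ⊆ W_j` whenever `i < j`, so every intersection is itself a
member of one of the flags. -/
theorem IsStep.interDim_eq {g c : ℕ} {V W : StepFlag F n d} (h : IsStep g c V W) (i j : ℕ) :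
    interDim V W i j = if i < j then V.dim i else W.dim j := by
  rw [interDim]
  split_ifs with hij
  · rw [inf_eq_left.2, StepFlag.dim]
    by_cases hj : j = g
    · exact (h.1 i (by omega)).symm.le.trans (W.sub_mono hij.le)
    · rw [h.1 j hj]
      exact V.sub_mono hij.le
  · rw [inf_eq_right.2, StepFlag.dim]
    exact (h.le j).trans (V.sub_mono (by omega))

theorem IsStep.relPos_eq {h c : ℕ} {V W : StepFlag F n d} (hs : IsStep (h + 1) c V W) :
    relPos V W = elemMat h c fun i => W.dim (i + 1) - V.dim i := by
  ext ⟨i, hi⟩ ⟨j, hj⟩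
  have h1 := relPos_apply_add V W ⟨i, hi⟩ ⟨j, hj⟩
  have hl : ∀ a b, a < b → interDim V W a b = V.dim a := fun a b hab => by
    rw [hs.interDim_eq, if_pos hab]
  have hr : ∀ a b, b ≤ a → interDim V W a b = W.dim b := fun a b hab => by
    rw [hs.interDim_eq, if_neg (by omega)]
  have e : ∀ m, m ≠ h + 1 → W.dim m = V.dim m := fun m hm => by
    rw [StepFlag.dim, hs.1 m hm, StepFlag.dim]
  -- This makes the subtraction in the diagonal entries an honest one.
  have h5 : V.dim i ≤ W.dim (i + 1) := by
    by_cases hi : i = h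
    · rw [hi, ← e h (by omega)]
      exact W.dim_mono (Nat.le_succ _)
    · rw [e (i + 1) (by omega)]
      exact V.dim_mono (Nat.le_succ _)
  rw [elemMat_apply]
  simp only [Fin.mk.injEq] at h1 ⊢
  rcases lt_trichotomy i j with hij | hij | hij
  · rw [if_neg hij.ne, hl i (j + 1) (by omega), hl (i + 1) (j + 1) (by omega), hl i j hij] at *
    by_cases h2 : i + 1 = j
    · subst h2
      rw [hr (i + 1) (i + 1) le_rfl] at h1
      by_cases h3 : i = h
      · subst h3
        rw [if_pos ⟨rfl, rfl⟩]
        have := hs.2.2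
        omega
      · rw [if_neg (fun h => h3 h.1)]
        have := e (i + 1) (by omega)
        omega
    · rw [if_neg (by omega)]
      rw [hl (i + 1) j (by omega)] at h1
      omega
  · subst hij
    rw [hl i (i + 1) (by omega), hr (i + 1) (i + 1) le_rfl, hr i i le_rfl,
      hr (i + 1) i (by omega)] at h1
    rw [if_pos rfl, if_neg (by omega)]
    omega
  · rw [hr i (j + 1) (by omega), hr (i + 1) (j + 1) (by omega), hr i j hij.le,
      hr (i + 1) j (by omega)] at h1
    rw [if_neg hij.ne', if_neg (by omega)]
    omega

/-- The corner sums at `(m, m)` and `(n, m)` agree, which gives `W_m ⊆ V_m`; those at `(m, n)` and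
`(n, m)` differ only for `m = h + 1`, and there by `c`. -/
theorem isStep_of_relPos_eq {h c : ℕ} (hh : h + 1 < n) {δ : Fin n → ℕ} {V W : StepFlag F n d}
    (hr : relPos V W = elemMat h c δ) : IsStep (h + 1) c V W := by
  have hn : ∀ i j, interDim V W i j = _ := fun i j =>
    (interDim_eq_cornerSum V W i j).trans (hr ▸ cornerSum_elemMat hh c δ i j)
  have hd : ∀ m, interDim V W m m = W.dim m := fun m => by
    rcases Nat.le_total n m with hm | hm
    · exact interDim_top_left _ _ _ hm
    · rw [hn, ← interDim_top_left V W m le_rfl, hn, min_self, min_eq_right hm]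
      congr 1
      simp only [show h < n by omega, true_and]
      congr 1
      apply propext
      omega
  have hle : ∀ m, W.sub m ≤ V.sub m := fun m =>
    inf_eq_right.1 (Submodule.eq_of_le_of_finrank_eq inf_le_right (hd m))
  have hV : ∀ m, m ≤ n → V.dim m = _ := fun m hm =>
    (interDim_top_right V W m le_rfl).symm.trans (hn m n)
  have hW : ∀ m, m ≤ n → W.dim m = _ := fun m hm =>
    (interDim_top_left V W m le_rfl).symm.trans (hn n m)
  refine ⟨fun m hm => ?_, hle _, ?_⟩
  · rcases Nat.le_total n m with hm' | hm'
    · rw [V.sub_of_le hm', W.sub_of_le hm']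
    apply Submodule.eq_of_le_of_finrank_eq (hle m)
    have h1 := hV m hm'
    have h2 := hW m hm'
    rw [min_eq_left hm'] at h1
    rw [min_eq_right hm'] at h2
    rw [StepFlag.dim] at h1 h2
    rw [h1, h2]
    congr 2
    apply propext
    omega
  · rw [hV _ hh.le, hW _ hh.le, min_eq_left hh.le, min_eq_right hh.le,
      if_pos ⟨by omega, hh⟩, if_neg (by omega), add_zero]

/-- This separates the geometry, which does not see `δ`, from a condition on the type of `V`. Chains
can then be studied without the diagonal matrices. -/
theorem relPos_eq_elemMat_iff {h c : ℕ} (hh : h + 1 < n) {δ : Fin n → ℕ} {V W : StepFlag F n d} :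
    relPos V W = elemMat h c δ ↔ IsStep (h + 1) c V W ∧ rowSum (elemMat h c δ) = V.type := by
  constructor
  · intro hr
    exact ⟨isStep_of_relPos_eq hh hr, by rw [← hr, rowSum_relPos]⟩
  · rintro ⟨hs, ht⟩
    rw [← rowSum_relPos V W, hs.relPos_eq] at ht
    rw [hs.relPos_eq]
    congr 1
    funext i
    have := congrFun ht i
    rw [rowSum_elemMat hh, rowSum_elemMat hh] at this
    omega

end Steps

/-! ## Products of step matrices -/

section Products

variable {F : Type*} [Field F] {n d : ℕ}

/-- The relation of which the product over a stage is the indicator matrix. -/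
def IsStage (a : ℕ → ℕ → ℕ) (j k c : ℕ) (X Z : StepFlag F n d) : Prop :=
  (∀ m, m ≤ k ∨ k + c < m → Z.sub m = X.sub m) ∧
  ∀ m, k < m → m ≤ k + c →
    X.sub (m - 1) ≤ Z.sub m ∧ Z.sub m ≤ X.sub m ∧ X.dim m = Z.dim m + a (m - 1 - k) j

/-- The flag `X` with its `g`-th member replaced. -/
def StepFlag.replace (X : StepFlag F n d) (g : ℕ) (hg : 0 < g) (hg' : g < n)
    (Z : Submodule F (Fin d → F)) (h1 : X.sub (g - 1) ≤ Z) (h2 : Z ≤ X.sub (g + 1)) :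
    StepFlag F n d :=
  StepFlag.mk (fun m => if m = g then Z else X.sub m) (by simp [hg.ne, X.sub_zero])
    (by simp [hg'.ne', X.sub_of_le]) (by
      apply monotone_nat_of_le_succ
      intro m
      split_ifs with h3 h4 h5
      · omega
      · rw [h3]; exact h2
      · rw [show m = g - 1 by omega]; exact h1
      · exact X.sub_mono (Nat.le_succ _))

theorem StepFlag.sub_replace (X : StepFlag F n d) (g : ℕ) (hg : 0 < g) (hg' : g < n)
    (Z : Submodule F (Fin d → F)) (h1 : X.sub (g - 1) ≤ Z) (h2 : Z ≤ X.sub (g + 1)) (m : ℕ) :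
    (X.replace g hg hg' Z h1 h2).sub m = if m = g then Z else X.sub m :=
  StepFlag.sub_mk _ _ _ _ _

theorem dim_congr {V W : StepFlag F n d} {m : ℕ} (h : V.sub m = W.sub m) : V.dim m = W.dim m := by
  rw [StepFlag.dim, h, StepFlag.dim]

/-- The flag with members `X_{m - k} + Y_m`. -/
def StepFlag.shiftSup (X Y : StepFlag F n d) (k : ℕ) : StepFlag F n d :=
  StepFlag.mk (fun m => X.sub (m - k) ⊔ Y.sub m) (by simp [StepFlag.sub_zero])
    (by simp [Y.sub_of_le])
    (fun _ _ h => sup_le_sup (X.sub_mono (Nat.sub_le_sub_right h k)) (Y.sub_mono h))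

theorem StepFlag.sub_shiftSup (X Y : StepFlag F n d) (k m : ℕ) :
    (X.shiftSup Y k).sub m = X.sub (m - k) ⊔ Y.sub m :=
  StepFlag.sub_mk _ _ _ _ _

/-- The flag with members `X_m ∩ U_j` for `m ≤ j` and `X_m` for `m > j`. -/
noncomputable def StepFlag.truncInf (X U : StepFlag F n d) (j : ℕ) (hj : j < n) :
    StepFlag F n d :=
  StepFlag.mk (fun m => if m ≤ j then X.sub m ⊓ U.sub j else X.sub m) (by simp [X.sub_zero])
    (by simp [hj, X.sub_of_le]) (by
      intro m m' h
      simp only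
      split_ifs with h1 h2
      · exact inf_le_inf_right _ (X.sub_mono h)
      · exact inf_le_left.trans (X.sub_mono h)
      · omega
      · exact X.sub_mono h)

theorem StepFlag.sub_truncInf (X U : StepFlag F n d) (j : ℕ) (hj : j < n) (m : ℕ) :
    (X.truncInf U j hj).sub m = if m ≤ j then X.sub m ⊓ U.sub j else X.sub m :=
  StepFlag.sub_mk _ _ _ _ _

/-- The sum of the `a r s` with `r < i` and `h ≤ s < j`. -/
def blockSum (a : ℕ → ℕ → ℕ) (i h j : ℕ) : ℕ :=
  ∑ r ∈ Finset.range i, ∑ s ∈ Finset.Ico h j, a r s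

theorem blockSum_succ (a : ℕ → ℕ → ℕ) (i : ℕ) {h j : ℕ} (hj : h ≤ j) :
    blockSum a i h (j + 1) = blockSum a i h j + ∑ r ∈ Finset.range i, a r j := by
  simp [blockSum, Finset.sum_Ico_succ_top hj, Finset.sum_add_distrib]

theorem blockSum_of_le (a : ℕ → ℕ → ℕ) (i : ℕ) {h j : ℕ} (hj : j ≤ h) : blockSum a i h j = 0 := by
  simp [blockSum, Finset.Ico_eq_empty_of_le hj]

/-- The triples `(i, i + k, j)` with `i < c`, in decreasing order of `i`. -/
def stageList (j k : ℕ) : ℕ → List (ℕ × ℕ × ℕ)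
  | 0 => []
  | c + 1 => (c, c + k, j) :: stageList j k c

/-- The stages `k` with `j - r ≤ k < j`, in increasing order of `k`. -/
def phaseList (j : ℕ) : ℕ → List (ℕ × ℕ × ℕ)
  | 0 => []
  | r + 1 => stageList j (j - (r + 1)) (r + 1) ++ phaseList j r

/-- All triples `(i, h, j)` with `i ≤ h < j < m`, in the order of the first product. -/
def tripleList : ℕ → List (ℕ × ℕ × ℕ)
  | 0 => []
  | j + 1 => phaseList j j ++ tripleList j

variable (R : Type*) [CommSemiring R]

open Classical in
/-- The indicator matrix of the relation `IsStep g c`. -/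
noncomputable def stepMatrix (F : Type*) [Field F] (n d g c : ℕ) :
    Matrix (StepFlag F n d) (StepFlag F n d) R :=
  Matrix.of fun V W => if IsStep g c V W then 1 else 0

variable {R}

theorem isStep_of_stepMatrix_ne_zero {g c : ℕ} {V W : StepFlag F n d}
    (h : stepMatrix R F n d g c V W ≠ 0) : IsStep g c V W := by
  by_contra h0
  exact h (by simp [stepMatrix, h0])

theorem stepMatrix_eq_one {g c : ℕ} {V W : StepFlag F n d} (h : IsStep g c V W) :
    stepMatrix R F n d g c V W = 1 := by
  simp [stepMatrix, h]

theorem exists_of_mul_apply_ne_zero {ι : Type*} [Fintype ι] {M N : Matrix ι ι R} {x z : ι}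
    (h : (M * N) x z ≠ 0) : ∃ y, M x y ≠ 0 ∧ N y z ≠ 0 := by
  rw [Matrix.mul_apply] at h
  obtain ⟨y, -, hy⟩ := Finset.exists_ne_zero_of_sum_ne_zero h
  exact ⟨y, left_ne_zero_of_mul hy, right_ne_zero_of_mul hy⟩

/-- All exact counts below come from the fact that the middle flag of a chain is forced. -/
theorem mul_apply_eq_of_unique {ι : Type*} [Fintype ι] {M N : Matrix ι ι R} {x z : ι} (y : ι)
    (h : ∀ y', M x y' ≠ 0 → N y' z ≠ 0 → y' = y) : (M * N) x z = M x y * N y z := by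
  rw [Matrix.mul_apply]
  refine Finset.sum_eq_single y (fun y' _ hy => ?_) (by simp)
  by_contra h0
  exact hy (h y' (left_ne_zero_of_mul h0) (right_ne_zero_of_mul h0))

/-! ### Chains of steps along the ordered list of triples -/

variable (R) [Finite F]

/-- The product of the step matrices attached to a list of triples `(i, h, j)`, which shrink the
`(h + 1)`-st member by `a i j`. -/
noncomputable def stepProd (F : Type*) [Field F] [Finite F] (n d : ℕ) (a : ℕ → ℕ → ℕ)
    (l : List (ℕ × ℕ × ℕ)) : Matrix (StepFlag F n d) (StepFlag F n d) R :=
  (l.map fun x => stepMatrix R F n d (x.2.1 + 1) (a x.1 x.2.2)).prod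

variable {R}

theorem stepProd_append (a : ℕ → ℕ → ℕ) (l l' : List (ℕ × ℕ × ℕ)) :
    stepProd R F n d a (l ++ l') = stepProd R F n d a l * stepProd R F n d a l' := by
  simp [stepProd]

theorem stepProd_cons (a : ℕ → ℕ → ℕ) (x : ℕ × ℕ × ℕ) (l : List (ℕ × ℕ × ℕ)) :
    stepProd R F n d a (x :: l) =
      stepMatrix R F n d (x.2.1 + 1) (a x.1 x.2.2) * stepProd R F n d a l := by
  simp [stepProd]

/-- Within a stage `i` decreases, so member `m` is cut while member `m - 1` is still the original
one; this is the source of the bound `X_{m-1} ⊆ Z_m`. Each member is touched at most once, so the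
ends determine the chain. -/
theorem stepProd_stage (a : ℕ → ℕ → ℕ) {j k : ℕ} (c : ℕ) (hj : j < n) (hc : k + c ≤ j)
    (X Z : StepFlag F n d) :
    (IsStage a j k c X Z → stepProd R F n d a (stageList j k c) X Z = 1) ∧
    (stepProd R F n d a (stageList j k c) X Z ≠ 0 → IsStage a j k c X Z) := by
  induction c generalizing X with
  | zero =>
    simp only [stageList, stepProd, List.map_nil, List.prod_nil]
    constructor
    · intro h
      rw [show X = Z from StepFlag.ext_sub fun m _ _ => (h.1 m (by omega)).symm,
        Matrix.one_apply_eq]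
    · intro h
      have : X = Z := by
        by_contra h0
        exact h (Matrix.one_apply_ne h0)
      subst this
      exact ⟨fun _ _ => rfl, fun m _ _ => by omega⟩
  | succ c ih =>
    have key : ∀ Y, IsStep (c + k + 1) (a c j) X Y → IsStage a j k c Y Z →
        (∀ m, m ≠ c + k + 1 → Y.sub m = X.sub m) ∧ Y.sub (c + k + 1) = Z.sub (c + k + 1) :=
      fun Y h1 h2 => ⟨h1.1, (h2.1 _ (by omega)).symm⟩
    rw [stageList, stepProd_cons]
    constructor
    · intro h
      have hm := h.2 (c + k + 1) (by omega) (by omega)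
      -- The head of the list cuts member `c + k + 1`, which no later triple of the stage touches,
      -- so it must receive its final value at once.
      set Y := X.replace (c + k + 1) (by omega) (by omega) (Z.sub (c + k + 1)) hm.1
        (hm.2.1.trans (X.sub_mono (Nat.le_succ _))) with hY
      have hYs : ∀ m, Y.sub m = _ := StepFlag.sub_replace X (c + k + 1) _ _ _ _ _
      have hYg : Y.sub (c + k + 1) = Z.sub (c + k + 1) := by rw [hYs, if_pos rfl]
      have hYm : ∀ m, m ≠ c + k + 1 → Y.sub m = X.sub m := fun m h0 => by rw [hYs, if_neg h0]
      rw [mul_apply_eq_of_unique Y, stepMatrix_eq_one, ((ih (by omega) Y).1 _), one_mul]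
      · refine ⟨fun m hm' => ?_, fun m h1 h2 => ?_⟩
        · by_cases h0 : m = c + k + 1
          · rw [h0, hYg]
          · rw [hYm m h0, h.1 m (by omega)]
        · rw [dim_congr (hYm m (by omega)), hYm m (by omega), hYm (m - 1) (by omega)]
          exact h.2 m h1 (by omega)
      · refine ⟨hYm, hYg ▸ hm.2.1, ?_⟩
        rw [dim_congr hYg, hm.2.2]
        congr 2
        simp only
        omega
      · intro Y' h1 h2
        have h3 := key Y' (isStep_of_stepMatrix_ne_zero h1) ((ih (by omega) Y').2 h2)
        apply StepFlag.ext_sub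
        intro m _ _
        by_cases h0 : m = c + k + 1
        · rw [h0, hYg, h3.2]
        · rw [hYm m h0, h3.1 m h0]
    · intro h
      obtain ⟨Y, h1, h2⟩ := exists_of_mul_apply_ne_zero h
      have h1 := isStep_of_stepMatrix_ne_zero h1
      have h2 := (ih (by omega) Y).2 h2
      simp only at h1
      obtain ⟨h3, h4⟩ := key Y h1 h2
      refine ⟨fun m hm => ?_, fun m hm1 hm2 => ?_⟩
      · rw [h2.1 m (by omega), h3 m (by omega)]
      · by_cases h0 : m = c + k + 1
        · rw [h0, ← h4, ← dim_congr h4]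
          refine ⟨?_, h1.2.1, ?_⟩
          · rw [← h3 _ (by omega)]
            exact Y.sub_mono (by omega)
          · rw [h1.2.2]
            congr 2
            omega
        · have := h2.2 m hm1 (by omega)
          rw [dim_congr (h3 m h0), h3 m h0, h3 (m - 1) (by omega)] at this
          exact this

/-- Stage `k` takes `a (m - 1 - k) j` dimensions from each member `m` with `k < m ≤ j`; the sum
collects these losses over the stages `k ≥ j - r`. -/
theorem phase_necessary (a : ℕ → ℕ → ℕ) {j : ℕ} (r : ℕ) (hj : j < n) (hr : r ≤ j)
    {Z Y : StepFlag F n d} (h : stepProd R F n d a (phaseList j r) Z Y ≠ 0) :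
    (∀ m, Y.sub m ≤ Z.sub m) ∧ (∀ m, j < m → Y.sub m = Z.sub m) ∧
    ∀ m, m ≤ j → Z.dim m = Y.dim m + ∑ i ∈ Finset.range (m - (j - r)), a i j := by
  induction r generalizing Z with
  | zero =>
    have : Z = Y := by
      by_contra h0
      exact h (Matrix.one_apply_ne h0)
    subst this
    refine ⟨fun _ => le_rfl, fun _ _ => rfl, fun m hm => ?_⟩
    rw [show m - (j - 0) = 0 by omega]
    simp
  | succ r ih =>
    rw [phaseList, stepProd_append] at h
    obtain ⟨Z', h1, h2⟩ := exists_of_mul_apply_ne_zero h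
    obtain ⟨h3, h4⟩ := (stepProd_stage a (r + 1) hj (by omega) Z Z').2 h1
    obtain ⟨h5, h6, h7⟩ := ih (by omega) h2
    refine ⟨fun m => (h5 m).trans ?_, fun m hm => ?_, fun m hm => ?_⟩
    · by_cases h0 : j - (r + 1) < m ∧ m ≤ j
      · exact (h4 m h0.1 (by omega)).2.1
      · rw [h3 m (by omega)]
    · rw [h6 m hm, h3 m (by omega)]
    · by_cases h0 : j - (r + 1) < m
      · rw [(h4 m h0 (by omega)).2.2, h7 m hm, show m - (j - (r + 1)) = m - (j - r) + 1 by omega,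
          Finset.sum_range_succ, show m - 1 - (j - (r + 1)) = m - (j - r) by omega]
        omega
      · rw [← dim_congr (h3 m (by omega)), h7 m hm, show m - (j - (r + 1)) = m - (j - r) by omega]

/-- The flag at the beginning of stage `k` is `X_{m-k} + Y_m`: it is `X` for `k = 0` and `Y` for `k
= j`. No other path exists, since the flag after stage `k` must contain both `X_{m-1-k}` and `Y_m`,
and its dimension leaves no room for more. -/
theorem phase_sufficient (a : ℕ → ℕ → ℕ) {j : ℕ} (r : ℕ) (hj : j < n) (hr : r ≤ j)
    {X Y : StepFlag F n d} (h1 : ∀ m, Y.sub m ≤ X.sub m) (h2 : ∀ m, j < m → Y.sub m = X.sub m)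
    (h3 : ∀ i m, i ≤ m → m ≤ j → X.sub i ⊓ Y.sub m ≤ Y.sub i)
    (h4 : ∀ m, m ≤ j → X.dim m = Y.dim m + ∑ i ∈ Finset.range m, a i j) :
    stepProd R F n d a (phaseList j r) (X.shiftSup Y (j - r)) Y = 1 := by
  have hdim : ∀ k m, m ≤ j →
      (X.shiftSup Y k).dim m = Y.dim m + ∑ i ∈ Finset.range (m - k), a i j := by
    intro k m hm
    -- Hypothesis `h3` makes the two summands meet as little as possible, so the dimension of the
    -- sum depends on `a` and `Y` alone.
    have h5 : X.sub (m - k) ⊓ Y.sub m = Y.sub (m - k) :=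
      le_antisymm (h3 _ _ (by omega) hm) (le_inf (h1 _) (Y.sub_mono (by omega)))
    have h6 := Submodule.finrank_sup_add_finrank_inf_eq (X.sub (m - k)) (Y.sub m)
    rw [h5] at h6
    have h7 := h4 (m - k) (by omega)
    rw [StepFlag.dim, StepFlag.dim] at h7
    rw [StepFlag.dim, StepFlag.sub_shiftSup, StepFlag.dim]
    omega
  have hY : ∀ k m, m ≤ k ∨ j < m → (X.shiftSup Y k).sub m = Y.sub m := by
    rintro k m (hm | hm)
    · rw [StepFlag.sub_shiftSup, show m - k = 0 by omega, X.sub_zero, bot_sup_eq]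
    · rw [StepFlag.sub_shiftSup, sup_eq_right, h2 m hm]
      exact X.sub_mono (by omega)
  induction r with
  | zero =>
    have : X.shiftSup Y (j - 0) = Y := StepFlag.ext_sub fun m _ _ => hY _ m (by omega)
    rw [this]
    simp [phaseList, stepProd]
  | succ r ih =>
    set k := j - (r + 1) with hk
    have hk' : j - r = k + 1 := by omega
    rw [hk'] at ih
    rw [phaseList, stepProd_append, mul_apply_eq_of_unique (X.shiftSup Y (k + 1)), ih (by omega),
      (stepProd_stage a (r + 1) hj (by omega) _ _).1, one_mul]
    · refine ⟨fun m hm => ?_, fun m hm1 hm2 => ⟨?_, ?_, ?_⟩⟩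
      · rw [hY _ m (by omega), hY _ m (by omega)]
      · rw [StepFlag.sub_shiftSup, StepFlag.sub_shiftSup, show m - (k + 1) = m - 1 - k by omega]
        exact sup_le_sup_left (Y.sub_mono (by omega)) _
      · rw [StepFlag.sub_shiftSup, StepFlag.sub_shiftSup]
        exact sup_le_sup_right (X.sub_mono (by omega)) _
      · rw [hdim _ m (by omega), hdim _ m (by omega), show m - k = m - 1 - k + 1 by omega,
          Finset.sum_range_succ, show m - (k + 1) = m - 1 - k by omega, ← hk]
        omega
    · intro Z h5 h6
      obtain ⟨h7, h8⟩ := (stepProd_stage a (r + 1) hj (by omega) _ _).2 h5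
      have h9 := (phase_necessary a r hj (by omega) h6).1
      apply StepFlag.ext_sub
      intro m hm0 _
      by_cases h0 : k < m ∧ m ≤ j
      · obtain ⟨h10, h11, h12⟩ := h8 m h0.1 (by omega)
        symm
        apply Submodule.eq_of_le_of_finrank_eq
        · rw [StepFlag.sub_shiftSup] at h10 ⊢
          refine sup_le ?_ (h9 m)
          rw [show m - (k + 1) = m - 1 - k by omega]
          exact le_sup_left.trans h10
        · have h13 := hdim (k + 1) m h0.2
          rw [hdim k m h0.2, show m - k = m - 1 - k + 1 by omega, Finset.sum_range_succ,
            ← hk] at h12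
          rw [show m - (k + 1) = m - 1 - k by omega] at h13
          simp only [StepFlag.dim] at h12 h13 ⊢
          omega
      · rw [h7 m (by omega), hY _ m (by omega), hY _ m (by omega)]

/-- Once the phases `s ≥ m` are over, member `m` equals `U_m` and contains the current member `i`.
Until then member `i` has lost at most the entries of the columns `s ≥ m` in the rows `< i`. -/
theorem tripleList_necessary (a : ℕ → ℕ → ℕ) (j : ℕ) (hj : j ≤ n)
    {X U : StepFlag F n d} (h : stepProd R F n d a (tripleList j) X U ≠ 0) :
    (∀ m, U.sub m ≤ X.sub m) ∧ (∀ m, j ≤ m → U.sub m = X.sub m) ∧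
    (∀ i m, i ≤ m → X.dim i ≤ interDim X U i m + blockSum a i m j) ∧
    ∀ m, X.dim m = U.dim m + blockSum a m m j := by
  induction j generalizing X with
  | zero =>
    have : X = U := by
      by_contra h0
      exact h (Matrix.one_apply_ne h0)
    subst this
    refine ⟨fun _ => le_rfl, fun _ _ => rfl, fun i m hm => ?_, fun m => ?_⟩
    · rw [interDim, inf_eq_left.2 (X.sub_mono hm), StepFlag.dim]
      omega
    · simp [blockSum]
  | succ j ih =>
    rw [tripleList, stepProd_append] at h
    obtain ⟨Y, h1, h2⟩ := exists_of_mul_apply_ne_zero h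
    obtain ⟨h3, h4, h5⟩ := phase_necessary a j hj le_rfl h1
    obtain ⟨h6, h7, h8, h9⟩ := ih (by omega) h2
    have h10 : ∀ m, j + 1 ≤ m → U.sub m = X.sub m := fun m hm => by
      rw [h7 m (by omega), h4 m hm]
    simp only [Nat.sub_self, Nat.sub_zero] at h5
    refine ⟨fun m => (h6 m).trans (h3 m), h10, fun i m hm => ?_, fun m => ?_⟩
    · rcases Nat.lt_or_ge j m with h0 | h0
      · rw [interDim, h10 m h0, inf_eq_left.2 (X.sub_mono hm), StepFlag.dim]
        omega
      · have h11 := h8 i m hm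
        have h12 := h5 i (by omega)
        have h13 : interDim Y U i m ≤ interDim X U i m :=
          Submodule.finrank_mono (inf_le_inf_right _ (h3 i))
        rw [blockSum_succ a i h0]
        omega
    · rcases Nat.lt_or_ge j m with h0 | h0
      · rw [dim_congr (h10 m h0), blockSum_of_le a m (by omega), add_zero]
      · rw [h5 m h0, h9 m, blockSum_succ a m h0]
        omega

/-- The flag after the first phase is forced and satisfies the same equalities with one column
fewer, so induction applies. -/
theorem tripleList_sufficient (a : ℕ → ℕ → ℕ) (j : ℕ) (hj : j ≤ n)
    {X U : StepFlag F n d} (h1 : ∀ m, U.sub m ≤ X.sub m)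
    (h2 : ∀ m, j ≤ m → U.sub m = X.sub m)
    (h3 : ∀ i m, i ≤ m → X.dim i = interDim X U i m + blockSum a i m j) :
    stepProd R F n d a (tripleList j) X U = 1 := by
  induction j generalizing X with
  | zero =>
    rw [show X = U from StepFlag.ext_sub fun m _ _ => (h2 m (by omega)).symm]
    simp [tripleList, stepProd]
  | succ j ih =>
    -- Later phases leave member `j` alone, so it must be `U_j` already, and members `m ≤ j` lie in
    -- `X_m ∩ U_j`; the equality for the pair `(m, j)` shows that they fill it.
    set Y := X.truncInf U j hj with hY
    have hYl : ∀ m, m ≤ j → Y.sub m = X.sub m ⊓ U.sub j := fun m hm => by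
      rw [StepFlag.sub_truncInf, if_pos hm]
    have hYr : ∀ m, j < m → Y.sub m = X.sub m := fun m hm => by
      rw [StepFlag.sub_truncInf, if_neg (by omega)]
    have hdim : ∀ m, m ≤ j → X.dim m = Y.dim m + ∑ i ∈ Finset.range m, a i j := fun m hm => by
      rw [h3 m j hm, blockSum_succ a m le_rfl, blockSum_of_le a m le_rfl, zero_add, interDim,
        StepFlag.dim, hYl m hm]
    rw [tripleList, stepProd_append, mul_apply_eq_of_unique Y]
    · have e1 := phase_sufficient (R := R) a j hj le_rfl (X := X) (Y := Y) ?_ hYr ?_ hdim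
      · have e2 : X.shiftSup Y (j - j) = X := by
          apply StepFlag.ext_sub
          intro m _ _
          rw [StepFlag.sub_shiftSup, Nat.sub_self, Nat.sub_zero, sup_eq_left]
          rcases Nat.lt_or_ge j m with h0 | h0
          · rw [hYr m h0]
          · rw [hYl m h0]
            exact inf_le_left
        rw [e2] at e1
        rw [e1, one_mul]
        apply ih (by omega)
        · intro m
          rcases Nat.lt_or_ge j m with h0 | h0
          · rw [hYr m h0]
            exact h1 m
          · rw [hYl m h0]
            exact le_inf (h1 m) (U.sub_mono h0)
        · intro m hm
          rcases Nat.lt_or_ge j m with h0 | h0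
          · rw [hYr m h0]
            exact h2 m h0
          · obtain rfl : m = j := by omega
            rw [hYl m h0, inf_eq_right.2 (h1 m)]
        · intro i m him
          rcases Nat.lt_or_ge j m with h0 | h0
          · rw [blockSum_of_le a i h0.le, interDim, inf_eq_left.2, StepFlag.dim, add_zero]
            rw [h2 m h0, ← hYr m h0]
            exact Y.sub_mono him
          · have h4 := hdim i (by omega)
            rw [h3 i m him, blockSum_succ a i h0] at h4
            have h5 : interDim Y U i m = interDim X U i m := by
              rw [interDim, hYl i (by omega), inf_assoc, inf_eq_right.2 (U.sub_mono h0), interDim]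
            omega
      · intro m
        rcases Nat.lt_or_ge j m with h0 | h0
        · rw [hYr m h0]
        · rw [hYl m h0]
          exact inf_le_left
      · intro i m him hm
        rw [hYl m hm, hYl i (by omega)]
        exact inf_le_inf_left _ inf_le_right
    · intro Y' h4 h5
      obtain ⟨h6, h7, h8⟩ := phase_necessary a j hj le_rfl h4
      obtain ⟨h9, h10, -⟩ := tripleList_necessary a j (by omega) h5
      apply StepFlag.ext_sub
      intro m _ _
      rcases Nat.lt_or_ge j m with h0 | h0
      · rw [hYr m h0, h7 m h0]
      · rw [hYl m h0]
        apply Submodule.eq_of_le_of_finrank_eq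
        · refine le_inf (h6 m) ?_
          rw [h10 j le_rfl]
          exact Y'.sub_mono h0
        · have h11 := h8 m h0
          rw [h3 m j h0, blockSum_succ a m le_rfl, blockSum_of_le a m le_rfl, Nat.sub_self,
            Nat.sub_zero] at h11
          simp only [interDim, StepFlag.dim] at h11
          omega

end Products

/-! ## The order of the factors -/

section Order

/-- `(i, h, j)` comes before `(i', h', j')` in the first product. -/
def TripleBefore (x y : ℕ × ℕ × ℕ) : Prop :=
  y.2.2 < x.2.2 ∨ (x.2.2 = y.2.2 ∧ x.2.1 + y.1 < y.2.1 + x.1) ∨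
    (x.2.2 = y.2.2 ∧ x.2.1 + y.1 = y.2.1 + x.1 ∧ y.1 < x.1)

theorem mem_stageList {j k c : ℕ} {x : ℕ × ℕ × ℕ} :
    x ∈ stageList j k c ↔ x.1 < c ∧ x.2.1 = x.1 + k ∧ x.2.2 = j := by
  obtain ⟨i, h, j'⟩ := x
  induction c with
  | zero => simp [stageList]
  | succ c ih =>
    rw [stageList, List.mem_cons, ih]
    simp only [Prod.mk.injEq]
    omega

theorem mem_phaseList {j r : ℕ} (hr : r ≤ j) {x : ℕ × ℕ × ℕ} :
    x ∈ phaseList j r ↔ x.1 + (j - r) ≤ x.2.1 ∧ x.2.1 < j ∧ x.2.2 = j := by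
  induction r with
  | zero => simp only [phaseList, List.not_mem_nil, false_iff]; omega
  | succ r ih =>
    rw [phaseList, List.mem_append, ih (by omega), mem_stageList]
    omega

theorem mem_tripleList {m : ℕ} {x : ℕ × ℕ × ℕ} :
    x ∈ tripleList m ↔ x.1 ≤ x.2.1 ∧ x.2.1 < x.2.2 ∧ x.2.2 < m := by
  induction m with
  | zero => simp [tripleList]
  | succ m ih =>
    rw [tripleList, List.mem_append, ih, mem_phaseList le_rfl]
    omega

theorem pairwise_stageList (j k c : ℕ) : (stageList j k c).Pairwise TripleBefore := by
  induction c with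
  | zero => exact List.Pairwise.nil
  | succ c ih =>
    refine List.Pairwise.cons (fun x hx => ?_) ih
    rw [mem_stageList] at hx
    simp only [TripleBefore]
    omega

theorem pairwise_phaseList {j r : ℕ} (hr : r ≤ j) : (phaseList j r).Pairwise TripleBefore := by
  induction r with
  | zero => exact List.Pairwise.nil
  | succ r ih =>
    refine List.pairwise_append.2 ⟨pairwise_stageList _ _ _, ih (by omega), fun x hx y hy => ?_⟩
    rw [mem_stageList] at hx
    rw [mem_phaseList (by omega)] at hy
    simp only [TripleBefore]
    omega

theorem pairwise_tripleList (m : ℕ) : (tripleList m).Pairwise TripleBefore := by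
  induction m with
  | zero => exact List.Pairwise.nil
  | succ m ih =>
    refine List.pairwise_append.2 ⟨pairwise_phaseList le_rfl, ih, fun x hx y hy => ?_⟩
    rw [mem_phaseList le_rfl] at hx
    rw [mem_tripleList] at hy
    simp only [TripleBefore]
    omega

theorem nodup_tripleList (m : ℕ) : (tripleList m).Nodup :=
  (pairwise_tripleList m).imp fun {x y} h => by
    rintro rfl
    simp only [TripleBefore] at h
    omega

/-- The relation is asymmetric, so an ordered list is determined by its members. This replaces the
sorted lists of the statement by the recursive one. -/
theorem eq_tripleList {m : ℕ} {l : List (ℕ × ℕ × ℕ)} (hl : l.Pairwise TripleBefore)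
    (hmem : ∀ x, x ∈ l ↔ x.1 ≤ x.2.1 ∧ x.2.1 < x.2.2 ∧ x.2.2 < m) : l = tripleList m := by
  have hnd : l.Nodup := hl.imp fun {x y} h => by
    rintro rfl
    simp only [TripleBefore] at h
    omega
  refine List.Perm.eq_of_pairwise (le := TripleBefore) (fun x y _ _ h1 h2 => ?_) hl
    (pairwise_tripleList m)
    ((List.perm_ext_iff_of_nodup hnd (nodup_tripleList m)).2 fun x => by
      rw [hmem, mem_tripleList])
  exfalso
  simp only [TripleBefore] at h1 h2
  omega

/-- The numbers in a triple of the first product. -/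
def UpperTriple.toNat {n : ℕ} (x : UpperTriple n) : ℕ × ℕ × ℕ := (x.1.1, x.1.2.1, x.1.2.2)

/-- The triple `(j, h, i)` attached to a triple `(i, h, j)` of the second product. -/
def LowerTriple.toNat {n : ℕ} (x : LowerTriple n) : ℕ × ℕ × ℕ := (x.1.2.2, x.1.2.1, x.1.1)

theorem UpperTriple.map_sort (n : ℕ) :
    ((Finset.univ : Finset (UpperTriple n)).sort UpperLE).map UpperTriple.toNat =
      tripleList n := by
  apply eq_tripleList
  · rw [List.pairwise_map]
    have h1 := Finset.pairwise_sort (Finset.univ : Finset (UpperTriple n)) UpperLE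
    have h2 := Finset.sort_nodup (Finset.univ : Finset (UpperTriple n)) UpperLE
    refine (h1.and h2).imp ?_
    rintro ⟨⟨i, h, j⟩, _⟩ ⟨⟨i', h', j'⟩, _⟩ ⟨h3, h4⟩
    rcases h3 with h3 | h3
    · exact absurd h3 h4
    · simp only [UpperBefore, Fin.ext_iff, Fin.lt_def] at h3
      simp only [TripleBefore, UpperTriple.toNat]
      omega
  · rintro ⟨i, h, j⟩
    simp only [List.mem_map, Finset.mem_sort, Finset.mem_univ, true_and]
    constructor
    · rintro ⟨⟨⟨i', h', j'⟩, h1, h2⟩, h3⟩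
      simp only [UpperTriple.toNat, Prod.mk.injEq, Fin.le_def, Fin.lt_def] at h1 h2 h3
      omega
    · rintro ⟨h1, h2, h3⟩
      exact ⟨⟨(⟨i, by omega⟩, ⟨h, by omega⟩, ⟨j, h3⟩), h1, h2⟩, rfl⟩

/-- Exchanging `i` and `j` and reversing carries the second order to the first. Transposition
therefore reduces the second product to the first. -/
theorem LowerTriple.map_sort (n : ℕ) :
    (((Finset.univ : Finset (LowerTriple n)).sort LowerLE).map LowerTriple.toNat).reverse =
      tripleList n := by
  apply eq_tripleList
  · rw [List.pairwise_reverse, List.pairwise_map]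
    have h1 := Finset.pairwise_sort (Finset.univ : Finset (LowerTriple n)) LowerLE
    have h2 := Finset.sort_nodup (Finset.univ : Finset (LowerTriple n)) LowerLE
    refine (h1.and h2).imp ?_
    rintro ⟨⟨i, h, j⟩, _⟩ ⟨⟨i', h', j'⟩, _⟩ ⟨h3, h4⟩
    rcases h3 with h3 | h3
    · exact absurd h3 h4
    · simp only [LowerBefore, Fin.ext_iff, Fin.lt_def] at h3
      simp only [TripleBefore, LowerTriple.toNat]
      omega
  · rintro ⟨i, h, j⟩
    simp only [List.mem_reverse, List.mem_map, Finset.mem_sort, Finset.mem_univ, true_and]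
    constructor
    · rintro ⟨⟨⟨i', h', j'⟩, h1, h2⟩, h3⟩
      simp only [LowerTriple.toNat, Prod.mk.injEq, Fin.le_def, Fin.lt_def] at h1 h2 h3
      omega
    · rintro ⟨h1, h2, h3⟩
      exact ⟨⟨(⟨j, h3⟩, ⟨h, by omega⟩, ⟨i, by omega⟩), h1, h2⟩, rfl⟩

end Order

/-! ## Compatible diagonal matrices -/

section Compatible

variable {n : ℕ}

/-- The factor `D + a i j E_{h,h+1}` attached to a triple `(i, h, j)`. -/
def tripleMat (a : ℕ → ℕ → ℕ) (D : ℕ × ℕ × ℕ → Fin n → ℕ) (x : ℕ × ℕ × ℕ) :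
    Matrix (Fin n) (Fin n) ℕ :=
  elemMat x.2.1 (a x.1 x.2.2) (D x)

/-- The row sums of each factor are the column sums of the preceding one, starting with `lam` and
ending with `mu`. -/
def IsCompatible (a : ℕ → ℕ → ℕ) (D : ℕ × ℕ × ℕ → Fin n → ℕ) :
    List (ℕ × ℕ × ℕ) → (Fin n → ℕ) → (Fin n → ℕ) → Prop
  | [], lam, mu => lam = mu
  | x :: l, lam, mu => rowSum (tripleMat a D x) = lam ∧
      IsCompatible a D l (rowSum (tripleMat a D x).transpose) mu

variable {a : ℕ → ℕ → ℕ} {D D' : ℕ × ℕ × ℕ → Fin n → ℕ}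

theorem isCompatible_append {l l' : List (ℕ × ℕ × ℕ)} {lam nu : Fin n → ℕ} :
    IsCompatible a D (l ++ l') lam nu ↔
      ∃ mu, IsCompatible a D l lam mu ∧ IsCompatible a D l' mu nu := by
  induction l generalizing lam with
  | nil => simp [IsCompatible]
  | cons x l ih =>
    simp only [List.cons_append, IsCompatible, ih, and_assoc, exists_and_left]

theorem IsCompatible.congr {l : List (ℕ × ℕ × ℕ)} {lam mu : Fin n → ℕ}
    (h : IsCompatible a D l lam mu) (hD : ∀ x ∈ l, D x = D' x) : IsCompatible a D' l lam mu := by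
  induction l generalizing lam with
  | nil => exact h
  | cons x l ih =>
    have hx : tripleMat a D' x = tripleMat a D x := by
      rw [tripleMat, tripleMat, hD x (by simp)]
    simp only [IsCompatible, hx]
    exact ⟨h.1, ih h.2 fun y hy => hD y (by simp [hy])⟩

/-- The initial row sums fix the first diagonal matrix, hence its column sums, hence the next
diagonal matrix, and so on. This is the uniqueness part of the theorem. -/
theorem IsCompatible.eq {l : List (ℕ × ℕ × ℕ)} (hl : ∀ x ∈ l, x.2.1 + 1 < n)
    {lam mu mu' : Fin n → ℕ} (h : IsCompatible a D l lam mu)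
    (h' : IsCompatible a D' l lam mu') : ∀ x ∈ l, D x = D' x := by
  induction l generalizing lam with
  | nil => simp
  | cons x l ih =>
    have hx : D x = D' x := by
      funext i
      have := congrFun (h.1.trans h'.1.symm) i
      rw [tripleMat, tripleMat, rowSum_elemMat (hl x (by simp)),
        rowSum_elemMat (hl x (by simp))] at this
      omega
    have hx' : tripleMat a D' x = tripleMat a D x := by
      rw [tripleMat, tripleMat, hx]
    intro y hy
    rcases List.mem_cons.1 hy with rfl | hy
    · exact hx
    · have h2 := h'.2
      rw [hx'] at h2
      exact ih (fun z hz => hl z (by simp [hz])) h.2 h2 y hy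

theorem sum_rowSum (A : Matrix (Fin n) (Fin n) ℕ) : ∑ i, rowSum A i = ∑ i, ∑ j, A i j := rfl

theorem sum_rowSum_transpose (A : Matrix (Fin n) (Fin n) ℕ) :
    ∑ i, rowSum A.transpose i = ∑ i, ∑ j, A i j := by
  simp only [rowSum, Matrix.transpose_apply]
  exact Finset.sum_comm

theorem IsCompatible.mem_Theta {l : List (ℕ × ℕ × ℕ)} {lam mu : Fin n → ℕ} {d : ℕ}
    (hd : ∑ i, lam i = d) (h : IsCompatible a D l lam mu) :
    ∀ x ∈ l, tripleMat a D x ∈ Theta n d := by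
  induction l generalizing lam with
  | nil => simp
  | cons x l ih =>
    have hx : tripleMat a D x ∈ Theta n d := by
      rw [← hd, ← h.1]
      exact (sum_rowSum _).symm
    intro y hy
    rcases List.mem_cons.1 hy with rfl | hy
    · exact hx
    · refine ih ?_ h.2 y hy
      rw [sum_rowSum_transpose]
      exact hx

variable {F : Type*} [Field F] {d : ℕ} {R : Type*} [CommSemiring R]

open Classical in
/-- The indicator matrix of the orbit `𝒪_A`. -/
noncomputable def orbitMatrix (R : Type*) [CommSemiring R] (F : Type*) [Field F] (d : ℕ)
    (A : Matrix (Fin n) (Fin n) ℕ) : Matrix (StepFlag F n d) (StepFlag F n d) R :=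
  Matrix.of fun V W => if relPos V W = A then 1 else 0

theorem orbitMatrix_eq_one {A : Matrix (Fin n) (Fin n) ℕ} {V W : StepFlag F n d}
    (h : relPos V W = A) : orbitMatrix R F d A V W = 1 := by
  simp [orbitMatrix, h]

theorem orbitMatrix_eq_zero {A : Matrix (Fin n) (Fin n) ℕ} {V W : StepFlag F n d}
    (h : relPos V W ≠ A) : orbitMatrix R F d A V W = 0 := by
  simp [orbitMatrix, h]

theorem orbitMatrix_transpose (A : Matrix (Fin n) (Fin n) ℕ) :
    (orbitMatrix R F d A).transpose = orbitMatrix R F d A.transpose := by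
  ext V W
  rw [Matrix.transpose_apply]
  by_cases h : relPos W V = A
  · rw [orbitMatrix_eq_one h, orbitMatrix_eq_one (by rw [← h, relPos_transpose W V])]
  · rw [orbitMatrix_eq_zero h, orbitMatrix_eq_zero]
    intro h'
    rw [relPos_transpose W V, Matrix.transpose_inj] at h'
    exact h h'

theorem relPos_of_orbitMatrix_ne_zero {A : Matrix (Fin n) (Fin n) ℕ} {V W : StepFlag F n d}
    (h : orbitMatrix R F d A V W ≠ 0) : relPos V W = A := by
  by_contra h0
  exact h (orbitMatrix_eq_zero h0)

theorem orbitMatrix_eq_stepMatrix {x : ℕ × ℕ × ℕ} (hx : x.2.1 + 1 < n) {V : StepFlag F n d}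
    (h : rowSum (tripleMat a D x) = V.type) (W : StepFlag F n d) :
    orbitMatrix R F d (tripleMat a D x) V W =
      stepMatrix R F n d (x.2.1 + 1) (a x.1 x.2.2) V W := by
  by_cases hs : IsStep (x.2.1 + 1) (a x.1 x.2.2) V W
  · rw [stepMatrix_eq_one hs, orbitMatrix_eq_one (A := tripleMat a D x) ((relPos_eq_elemMat_iff hx).2 ⟨hs, h⟩)]
  · rw [orbitMatrix_eq_zero (A := tripleMat a D x) fun h' => hs ((relPos_eq_elemMat_iff hx).1 h').1]
    simp [stepMatrix, hs]

variable [Finite F]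

/-- The product of the orbit matrices of the factors. -/
noncomputable def orbitProd (R : Type*) [CommSemiring R] (F : Type*) [Field F] [Finite F] (d : ℕ)
    (a : ℕ → ℕ → ℕ) (D : ℕ × ℕ × ℕ → Fin n → ℕ) (l : List (ℕ × ℕ × ℕ)) :
    Matrix (StepFlag F n d) (StepFlag F n d) R :=
  (l.map fun x => orbitMatrix R F d (tripleMat a D x)).prod

theorem orbitProd_cons (x : ℕ × ℕ × ℕ) (l : List (ℕ × ℕ × ℕ)) :
    orbitProd R F d a D (x :: l) =
      orbitMatrix R F d (tripleMat a D x) * orbitProd R F d a D l := by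
  simp [orbitProd]

/-- The type of each flag in a contributing chain is the column sum vector of the factor before it
and the row sum vector of the factor after it. -/
theorem isCompatible_of_orbitProd_ne_zero {l : List (ℕ × ℕ × ℕ)} {V W : StepFlag F n d}
    (h : orbitProd R F d a D l V W ≠ 0) : IsCompatible a D l V.type W.type := by
  induction l generalizing V with
  | nil =>
    have : V = W := by
      by_contra h0
      exact h (Matrix.one_apply_ne h0)
    rw [this]
    rfl
  | cons x l ih =>
    rw [orbitProd_cons] at h
    obtain ⟨Y, h1, h2⟩ := exists_of_mul_apply_ne_zero h
    have h1 := relPos_of_orbitMatrix_ne_zero h1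
    simp only [IsCompatible]
    rw [← h1, rowSum_relPos, rowSum_relPos_transpose]
    exact ⟨rfl, ih h2⟩

/-- If the type of the first flag is right, compatibility makes all later type conditions automatic,
and the diagonal matrices drop out of the count. -/
theorem orbitProd_eq_stepProd {l : List (ℕ × ℕ × ℕ)} (hl : ∀ x ∈ l, x.2.1 + 1 < n)
    {V : StepFlag F n d} {mu : Fin n → ℕ} (h : IsCompatible a D l V.type mu)
    (W : StepFlag F n d) : orbitProd R F d a D l V W = stepProd R F n d a l V W := by
  induction l generalizing V with
  | nil => rfl
  | cons x l ih =>
    rw [orbitProd_cons, stepProd_cons, Matrix.mul_apply, Matrix.mul_apply]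
    refine Finset.sum_congr rfl fun Y _ => ?_
    have hx := hl x (by simp)
    rw [← orbitMatrix_eq_stepMatrix hx h.1]
    by_cases h0 : orbitMatrix R F d (tripleMat a D x) V Y = 0
    · rw [h0, zero_mul, zero_mul]
    · have h1 := relPos_of_orbitMatrix_ne_zero h0
      have h2 := h.2
      rw [← h1, rowSum_relPos_transpose] at h2
      rw [ih (fun z hz => hl z (by simp [hz])) h2]

/-- The diagonal matrices are read off from the relative positions along a chain. Distinct triples
are needed so that they can be assigned one triple at a time. -/
theorem exists_isCompatible_of_stepProd_ne_zero {l : List (ℕ × ℕ × ℕ)}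
    (hl : ∀ x ∈ l, x.2.1 + 1 < n) (hnd : l.Nodup) {V W : StepFlag F n d}
    (h : stepProd R F n d a l V W ≠ 0) :
    ∃ D : ℕ × ℕ × ℕ → Fin n → ℕ, IsCompatible a D l V.type W.type := by
  induction l generalizing V with
  | nil =>
    have : V = W := by
      by_contra h0
      exact h (Matrix.one_apply_ne h0)
    exact ⟨fun _ _ => 0, this ▸ rfl⟩
  | cons x l ih =>
    rw [stepProd_cons] at h
    obtain ⟨Y, h1, h2⟩ := exists_of_mul_apply_ne_zero h
    obtain ⟨hxl, hnd⟩ := List.nodup_cons.1 hnd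
    obtain ⟨D, hD⟩ := ih (fun z hz => hl z (by simp [hz])) hnd h2
    have h3 := (isStep_of_stepMatrix_ne_zero h1).relPos_eq
    refine ⟨Function.update D x fun i => Y.dim (i + 1) - V.dim i, ?_⟩
    simp only [IsCompatible, tripleMat, Function.update_self]
    rw [← h3, rowSum_relPos, rowSum_relPos_transpose]
    refine ⟨rfl, hD.congr fun y hy => ?_⟩
    rw [Function.update_of_ne]
    rintro rfl
    exact hxl hy

end Compatible

/-! ## Counting subspaces with prescribed intersections -/

section Counting

/-! ### Subspaces transversal to a hyperplane -/

section Hyperplane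

variable {F M : Type*} [Field F] [AddCommGroup M] [Module F M] {E E' : Submodule F M}

theorem sup_eq_of_covBy (h : E' ⋖ E) {X : Submodule F M} (hX : X ≤ E) (hX' : ¬X ≤ E') :
    E' ⊔ X = E := by
  rcases h.eq_or_eq (le_sup_left : E' ≤ E' ⊔ X) (sup_le h.le hX) with h1 | h1
  · exact absurd (sup_eq_left.1 h1) hX'
  · exact h1

theorem finrank_covBy [FiniteDimensional F M] (h : E' ⋖ E) :
    Module.finrank F E' + 1 = Module.finrank F E := by
  obtain ⟨v, hv, hv'⟩ := SetLike.exists_of_lt h.lt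
  have h0 : v ≠ 0 := fun h0 => hv' (h0 ▸ E'.zero_mem)
  have h1 := sup_eq_of_covBy h ((Submodule.span_singleton_le_iff_mem v E).2 hv)
    fun h2 => hv' ((Submodule.span_singleton_le_iff_mem v E').1 h2)
  have h2 : E' ⊓ Submodule.span F {v} = ⊥ :=
    (Submodule.disjoint_span_singleton' h0).2 hv' |>.eq_bot
  have h3 := Submodule.finrank_sup_add_finrank_inf_eq E' (Submodule.span F {v})
  rw [h1, h2, finrank_bot, finrank_span_singleton h0] at h3
  omega

theorem finrank_inf_covBy [FiniteDimensional F M] (h : E' ⋖ E) {X : Submodule F M} (hX : X ≤ E)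
    (hX' : ¬X ≤ E') : Module.finrank F (X ⊓ E' : Submodule F M) + 1 = Module.finrank F X := by
  have h1 := finrank_covBy h
  have h3 := Submodule.finrank_sup_add_finrank_inf_eq E' X
  rw [sup_eq_of_covBy h hX hX', inf_comm] at h3
  omega

theorem card_submodule [Finite F] [Finite M] (Z : Submodule F M) :
    Nat.card Z = Nat.card F ^ Module.finrank F Z := by
  have := Fintype.ofFinite F
  have := Fintype.ofFinite Z
  rw [Nat.card_eq_fintype_card, Nat.card_eq_fintype_card, ← Module.card_eq_pow_finrank]

/-- Fix `v` in `E` outside `E'` and count pairs `(Z, w)` with `w ∈ E'`, `v + w ∈ Z` in two ways.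
Each `Z` has `q ^ z` such `w`, a coset of `Z ∩ E'`; conversely `Z ∩ E'` and `w` may be chosen freely
and give back `Z = (Z ∩ E') + ⟨v + w⟩`. -/
theorem card_transversal [Finite F] [Finite M] (h : E' ⋖ E) (p : Submodule F M → Prop) (z : ℕ)
    (hp : ∀ Z, p Z → Module.finrank F Z = z) :
    Nat.card {Z : Submodule F M // Z ≤ E ∧ ¬Z ≤ E' ∧ p (Z ⊓ E')} * Nat.card F ^ z =
      Nat.card {Z : Submodule F M // Z ≤ E' ∧ p Z} * Nat.card F ^ Module.finrank F E' := by
  obtain ⟨v, hv, hv'⟩ := SetLike.exists_of_lt h.lt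
  have : Finite (Submodule F M) := Finite.of_injective (fun W => (W : Set M)) SetLike.coe_injective
  have hu : ∀ w : E', v + w ∈ E := fun w => E.add_mem hv (h.le w.2)
  have hu' : ∀ w : E', v + w ∉ E' := fun w h0 => hv' (by simpa using E'.sub_mem h0 w.2)
  have hdisj : ∀ w : E', E' ⊓ Submodule.span F {v + (w : M)} = ⊥ := fun w => by
    have h0 : v + (w : M) ≠ 0 := fun h0 => hu' w (by rw [h0]; exact E'.zero_mem)
    exact ((Submodule.disjoint_span_singleton' h0).2 (hu' w)).eq_bot
  let e1 : (Σ Z : {Z : Submodule F M // Z ≤ E ∧ ¬Z ≤ E' ∧ p (Z ⊓ E')},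
      {w : E' // v + w ∈ Z.1}) ≃ {Z : Submodule F M // Z ≤ E' ∧ p Z} × E' :=
    { toFun := fun x => (⟨x.1.1 ⊓ E', inf_le_right, x.1.2.2.2⟩, x.2.1)
      invFun := fun y => ⟨⟨y.1.1 ⊔ Submodule.span F {v + (y.2 : M)}, by
        refine ⟨sup_le (y.1.2.1.trans h.le)
          ((Submodule.span_singleton_le_iff_mem _ _).2 (hu y.2)), fun h1 => hu' y.2
          ((Submodule.span_singleton_le_iff_mem _ _).1 (le_sup_right.trans h1)), ?_⟩
        rw [sup_inf_assoc_of_le _ y.1.2.1, inf_comm, hdisj, sup_bot_eq]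
        exact y.1.2.2⟩, ⟨y.2, (le_sup_right : _ ≤ y.1.1 ⊔ Submodule.span F {v + (y.2 : M)})
          (Submodule.mem_span_singleton_self _)⟩⟩
      left_inv := by
        rintro ⟨⟨Z, h1, h2, h3⟩, ⟨w, hw⟩⟩
        have hw' : Submodule.span F {v + (w : M)} ≤ Z :=
          (Submodule.span_singleton_le_iff_mem _ _).2 hw
        have : Z ⊓ E' ⊔ Submodule.span F {v + (w : M)} = Z := by
          rw [inf_sup_assoc_of_le _ hw', sup_eq_of_covBy h
            ((Submodule.span_singleton_le_iff_mem _ _).2 (hu w))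
            fun h0 => hu' w ((Submodule.span_singleton_le_iff_mem _ _).1 h0), inf_eq_left.2 h1]
        simp only [Sigma.mk.injEq, this, true_and]
        congr!
      right_inv := by
        rintro ⟨⟨Z, h1, h2⟩, w⟩
        simp only [Prod.mk.injEq, Subtype.mk.injEq, and_true]
        rw [sup_inf_assoc_of_le _ h1, inf_comm, hdisj, sup_bot_eq] }
  have e2 : ∀ Z : {Z : Submodule F M // Z ≤ E ∧ ¬Z ≤ E' ∧ p (Z ⊓ E')},
      Nat.card {w : E' // v + w ∈ Z.1} = Nat.card F ^ z := by
    rintro ⟨Z, h1, h2, h3⟩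
    have h4 : v ∈ E' ⊔ Z := by rw [sup_eq_of_covBy h h1 h2]; exact hv
    obtain ⟨w, hw, u, hu1, rfl⟩ := Submodule.mem_sup.1 h4
    rw [← hp _ h3, ← card_submodule]
    refine Nat.card_congr
      { toFun := fun x => ⟨w + x.1, ?_, E'.add_mem hw x.1.2⟩
        invFun := fun y => ⟨⟨y.1 - w, E'.sub_mem y.2.2 hw⟩, ?_⟩
        left_inv := fun x => ?_
        right_inv := fun y => ?_ }
    · have := Z.sub_mem x.2 hu1
      rwa [show w + u + (x.1 : M) - u = w + x.1 by abel] at this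
    · have := Z.add_mem y.2.1 hu1
      simpa [show w + u + (y.1 - w) = y.1 + u by abel] using this
    · ext
      simp
    · ext
      simp
  have h1 := Nat.card_congr e1
  have := Fintype.ofFinite {Z : Submodule F M // Z ≤ E ∧ ¬Z ≤ E' ∧ p (Z ⊓ E')}
  rw [Nat.card_prod, card_submodule, Nat.card_sigma, Finset.sum_congr rfl fun Z _ => e2 Z,
    Finset.sum_const, smul_eq_mul, Finset.card_univ, ← Nat.card_eq_fintype_card] at h1
  exact h1

end Hyperplane

-- Induction on the codimension `N` of `L` in `E`, by splitting off a hyperplane `E'` of `E` that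
-- contains `L`. The `Z` inside `E'` are counted by induction; the others are counted through `Z ∩
-- E'`, with fibres whose size is a power of `q`. The hyperplane is chosen so that passing to `E'`
-- changes the prescribed dimensions in a way independent of `Z`.
open Polynomial in
theorem exists_polynomial_card_submodule (n : ℕ) (l : ℕ → ℕ) (N : ℕ) (e ζ : ℕ → ℕ)
    (hN : e n = l n + N) : ∃ P : ℤ[X], ∀ (F M : Type) [Field F] [Finite F] [AddCommGroup M]
      [Module F M] [Finite M] (L E : Submodule F M) (W : ℕ → Submodule F M), Monotone W →
      W n = ⊤ → L ≤ E → (∀ j, j ≤ n → Module.finrank F (L ⊓ W j : Submodule F M) = l j) →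
      (∀ j, j ≤ n → Module.finrank F (E ⊓ W j : Submodule F M) = e j) →
      (Nat.card {Z : Submodule F M // L ≤ Z ∧ Z ≤ E ∧
        ∀ j, j ≤ n → Module.finrank F (Z ⊓ W j : Submodule F M) = ζ j} : ℤ) =
        P.eval (Nat.card F : ℤ) := by
  classical
  induction N generalizing e ζ with
  | zero =>
    refine ⟨if ∀ j, j ≤ n → l j = ζ j then 1 else 0, ?_⟩
    intro F M _ _ _ _ _ L E W hW hn hLE hL hE
    have hLE' : L = E := by
      apply Submodule.eq_of_le_of_finrank_eq hLE
      have h1 := hL n le_rfl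
      have h2 := hE n le_rfl
      rw [hn, inf_top_eq] at h1 h2
      omega
    subst hLE'
    split_ifs with h
    · rw [eval_one, Nat.cast_eq_one, Nat.card_eq_one_iff_unique]
      exact ⟨⟨fun a b => Subtype.ext
        ((le_antisymm a.2.2.1 a.2.1).trans (le_antisymm b.2.1 b.2.2.1))⟩,
        ⟨⟨L, le_rfl, le_rfl, fun j hj => (hL j hj).trans (h j hj)⟩⟩⟩
    · rw [eval_zero, Nat.cast_eq_zero]
      have : IsEmpty {Z : Submodule F M // L ≤ Z ∧ Z ≤ L ∧
          ∀ j, j ≤ n → Module.finrank F (Z ⊓ W j : Submodule F M) = ζ j} := by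
        refine ⟨fun a => h fun j hj => ?_⟩
        rw [← hL j hj, ← a.2.2.2 j hj, le_antisymm a.2.2.1 a.2.1]
      exact Nat.card_of_isEmpty
  | succ N ih =>
    have hex : ∃ j, l n + e j = e n + l j := ⟨n, by omega⟩
    -- The least `j` with `L + (E ∩ W_j) = E`, expressed through dimensions so that it does not
    -- depend on the field.
    set j0 := Nat.find hex with hj0
    have hj0n : j0 ≤ n := Nat.find_min' hex (by omega)
    obtain ⟨P1, hP1⟩ := ih (fun j => if j < j0 then e j else e j - 1) ζ
      (by simp only [hj0n.not_gt, if_false]; omega)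
    obtain ⟨P2, hP2⟩ := ih (fun j => if j < j0 then e j else e j - 1)
      (fun j => if j < j0 then ζ j else ζ j - 1) (by simp only [hj0n.not_gt, if_false]; omega)
    -- A subspace not inside `E'` loses one dimension in `Z ∩ W_j` exactly for `j ≥ j0`, so it can
    -- exist only if these `ζ j` are positive. The condition also keeps `ζ j - 1` from being
    -- truncated.
    refine ⟨P1 + if ∀ j, j ≤ n → j0 ≤ j → 0 < ζ j then X ^ (e n - ζ n) * P2 else 0, ?_⟩
    intro F M _ _ _ _ _ L E W hW hn hLE hL hE
    have hsup : ∀ j, j ≤ n → Module.finrank F (L ⊔ (E ⊓ W j) : Submodule F M) + l j =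
        l n + e j := fun j hj => by
      have h1 := Submodule.finrank_sup_add_finrank_inf_eq L (E ⊓ W j)
      rw [← inf_assoc, inf_eq_left.2 hLE, hL j hj, hE j hj] at h1
      have h2 := hL n le_rfl
      rw [hn, inf_top_eq] at h2
      omega
    have hEn : Module.finrank F E = e n := by rw [← hE n le_rfl, hn, inf_top_eq]
    have hge : ∀ j, j ≤ n → j0 ≤ j → L ⊔ (E ⊓ W j) = E := fun j hj h => by
      have h1 : L ⊔ (E ⊓ W j0) = E := by
        apply Submodule.eq_of_le_of_finrank_eq (sup_le hLE inf_le_left)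
        have h2 := Nat.find_spec hex
        have h3 := hsup j0 hj0n
        rw [← hj0] at h2
        omega
      refine le_antisymm (sup_le hLE inf_le_left) ?_
      calc E = L ⊔ (E ⊓ W j0) := h1.symm
        _ ≤ _ := sup_le_sup_left (inf_le_inf_left _ (hW h)) _
    -- By minimality of `j0` the sum of `L` and all `E ∩ W_j` with `j < j0` is still proper, so some
    -- hyperplane contains it.
    obtain ⟨T, hTE, hLT, hT⟩ : ∃ T, T < E ∧ L ≤ T ∧ ∀ j, j < j0 → E ⊓ W j ≤ T := by
      rcases Nat.eq_zero_or_pos j0 with h0 | h0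
      · refine ⟨L, lt_of_le_of_ne hLE ?_, le_rfl, fun j hj => by omega⟩
        intro h1
        have h2 := hL n le_rfl
        have h3 := hE n le_rfl
        rw [h1] at h2
        omega
      · refine ⟨L ⊔ (E ⊓ W (j0 - 1)), lt_of_le_of_ne (sup_le hLE inf_le_left) ?_, le_sup_left,
          fun j hj => (inf_le_inf_left _ (hW (by omega))).trans le_sup_right⟩
        intro h1
        have h2 := hsup (j0 - 1) (by omega)
        rw [h1, hEn] at h2
        exact Nat.find_min hex (m := j0 - 1) (by omega) h2.symm
    obtain ⟨E', hTE', hE'⟩ := exists_le_covBy_of_lt hTE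
    have hlow : ∀ Z, Z ≤ E → ∀ j, j < j0 → Z ⊓ W j ⊓ E' = Z ⊓ W j := fun Z hZ j hj =>
      inf_eq_left.2 (((inf_le_inf_right _ hZ).trans (hT j hj)).trans hTE')
    have hnot : ∀ Z, L ≤ Z → Z ≤ E → ¬Z ≤ E' → ∀ j, j ≤ n → j0 ≤ j → ¬Z ⊓ W j ≤ E' := by
      intro Z h1 h2 h3 j hj hj' h4
      apply h3
      have h5 : L ⊔ (E ⊓ W j) ⊓ Z = Z := by
        rw [← sup_inf_assoc_of_le _ h1, hge j hj hj', inf_eq_right.2 h2]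
      rw [← h5, inf_right_comm, inf_eq_right.2 h2]
      exact sup_le (hLT.trans hTE') h4
    have hhigh : ∀ Z, L ≤ Z → Z ≤ E → ¬Z ≤ E' → ∀ j, j ≤ n → j0 ≤ j →
        Module.finrank F (Z ⊓ W j ⊓ E' : Submodule F M) + 1 =
        Module.finrank F (Z ⊓ W j : Submodule F M) := fun Z h1 h2 h3 j hj hj' =>
      finrank_inf_covBy hE' (inf_le_left.trans h2) (hnot Z h1 h2 h3 j hj hj')
    have hE'dim : ∀ j, j ≤ n → Module.finrank F (E' ⊓ W j : Submodule F M) =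
        if j < j0 then e j else e j - 1 := by
      intro j hj
      rw [← inf_eq_right.2 hE'.le, inf_right_comm]
      split_ifs with h
      · rw [hlow E le_rfl j h, hE j hj]
      · have := hhigh E hLE le_rfl (fun h0 => hE'.lt.not_ge h0) j hj (by omega)
        rw [hE j hj] at this
        omega
    have h1 := hP1 F M L E' W hW hn (hLT.trans hTE') hL hE'dim
    have h2 := hP2 F M L E' W hW hn (hLT.trans hTE') hL hE'dim
    have : Finite (Submodule F M) :=
      Finite.of_injective (fun W => (W : Set M)) SetLike.coe_injective
    have hsplit : Nat.card {Z : Submodule F M // L ≤ Z ∧ Z ≤ E ∧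
        ∀ j, j ≤ n → Module.finrank F (Z ⊓ W j : Submodule F M) = ζ j} =
        Nat.card {Z : Submodule F M // L ≤ Z ∧ Z ≤ E' ∧
        ∀ j, j ≤ n → Module.finrank F (Z ⊓ W j : Submodule F M) = ζ j} +
        Nat.card {Z : Submodule F M // (L ≤ Z ∧ Z ≤ E ∧
        ∀ j, j ≤ n → Module.finrank F (Z ⊓ W j : Submodule F M) = ζ j) ∧ ¬Z ≤ E'} := by
      rw [← Nat.card_sum]
      refine Nat.card_congr (((Equiv.sumCompl fun Z : {Z : Submodule F M // L ≤ Z ∧ Z ≤ E ∧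
        ∀ j, j ≤ n → Module.finrank F (Z ⊓ W j : Submodule F M) = ζ j} =>
          Z.1 ≤ E').symm).trans (Equiv.sumCongr ?_ ?_))
      · exact (Equiv.subtypeSubtypeEquivSubtypeInter (fun Z => L ≤ Z ∧ Z ≤ E ∧
          ∀ j, j ≤ n → Module.finrank F (Z ⊓ W j : Submodule F M) = ζ j) (fun Z => Z ≤ E')).trans
          (Equiv.subtypeEquivRight fun Z => ⟨fun h => ⟨h.1.1, h.2, h.1.2.2⟩,
            fun h => ⟨⟨h.1, h.2.1.trans hE'.le, h.2.2⟩, h.2.1⟩⟩)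
      · exact (Equiv.subtypeSubtypeEquivSubtypeInter _ fun Z => ¬Z ≤ E')
    rw [hsplit, Nat.cast_add, h1, eval_add]
    congr 1
    split_ifs with hpos
    · have h3 := card_transversal hE' (fun Z => L ≤ Z ∧ ∀ j, j ≤ n →
        Module.finrank F (Z ⊓ W j : Submodule F M) = if j < j0 then ζ j else ζ j - 1) (ζ n - 1)
        (fun Z hZ => by
          have := hZ.2 n le_rfl
          rwa [if_neg hj0n.not_gt, hn, inf_top_eq] at this)
      have e1 : Nat.card {Z : Submodule F M // Z ≤ E' ∧ L ≤ Z ∧ ∀ j, j ≤ n →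
          Module.finrank F (Z ⊓ W j : Submodule F M) = if j < j0 then ζ j else ζ j - 1} =
          Nat.card {Z : Submodule F M // L ≤ Z ∧ Z ≤ E' ∧ ∀ j, j ≤ n →
          Module.finrank F (Z ⊓ W j : Submodule F M) = if j < j0 then ζ j else ζ j - 1} :=
        Nat.card_congr (Equiv.subtypeEquivRight fun Z => and_left_comm)
      have e2 : Nat.card {Z : Submodule F M // Z ≤ E ∧ ¬Z ≤ E' ∧ L ≤ Z ⊓ E' ∧ ∀ j, j ≤ n →
          Module.finrank F (Z ⊓ E' ⊓ W j : Submodule F M) = if j < j0 then ζ j else ζ j - 1} =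
          Nat.card {Z : Submodule F M // (L ≤ Z ∧ Z ≤ E ∧
          ∀ j, j ≤ n → Module.finrank F (Z ⊓ W j : Submodule F M) = ζ j) ∧ ¬Z ≤ E'} := by
        refine Nat.card_congr (Equiv.subtypeEquivRight fun Z => ?_)
        have key : L ≤ Z → Z ≤ E → ¬Z ≤ E' → ∀ j, j ≤ n →
            (Module.finrank F (Z ⊓ E' ⊓ W j : Submodule F M) =
              (if j < j0 then ζ j else ζ j - 1) ↔
            Module.finrank F (Z ⊓ W j : Submodule F M) = ζ j) := by
          intro h4 h5 h6 j hj
          rw [inf_right_comm]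
          split_ifs with h7
          · rw [hlow Z h5 j h7]
          · have h8 := hhigh Z h4 h5 h6 j hj (by omega)
            have h9 := hpos j hj (by omega)
            omega
        constructor
        · rintro ⟨h4, h5, h6, h7⟩
          have h8 := h6.trans inf_le_left
          exact ⟨⟨h8, h4, fun j hj => (key h8 h4 h5 j hj).1 (h7 j hj)⟩, h5⟩
        · rintro ⟨⟨h4, h5, h6⟩, h7⟩
          exact ⟨h5, h7, le_inf h4 (hLT.trans hTE'),
            fun j hj => (key h4 h5 h7 j hj).2 (h6 j hj)⟩
      rw [e1, e2] at h3
      rw [eval_mul, eval_pow, eval_X, ← h2]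
      norm_cast
      have hq : 0 < Nat.card F := Nat.card_pos
      have h4 := finrank_covBy hE'
      rw [hEn] at h4
      have h5 := hpos n le_rfl hj0n
      -- Without any such subspace the exponent `e n - ζ n` could be truncated, but then both counts
      -- vanish.
      rcases Nat.eq_zero_or_pos (Nat.card {Z : Submodule F M // L ≤ Z ∧ Z ≤ E' ∧ ∀ j, j ≤ n →
          Module.finrank F (Z ⊓ W j : Submodule F M) = if j < j0 then ζ j else ζ j - 1})
        with h0 | h0
      · rw [h0, zero_mul] at h3
        rw [h0, mul_zero]
        exact (Nat.mul_eq_zero.1 h3).resolve_right (pow_pos hq _).ne'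
      · obtain ⟨⟨Z, -, hZ, hZ'⟩⟩ := (Nat.card_pos_iff.1 h0).1
        have h6 := hZ' n le_rfl
        rw [if_neg hj0n.not_gt, hn, inf_top_eq] at h6
        have h7 := Submodule.finrank_mono hZ
        apply Nat.eq_of_mul_eq_mul_right (pow_pos hq (ζ n - 1))
        rw [h3, mul_comm, mul_right_comm, ← pow_add]
        congr 2
        omega
    · rw [eval_zero, Nat.cast_eq_zero]
      have : IsEmpty {Z : Submodule F M // (L ≤ Z ∧ Z ≤ E ∧
          ∀ j, j ≤ n → Module.finrank F (Z ⊓ W j : Submodule F M) = ζ j) ∧ ¬Z ≤ E'} := by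
        refine ⟨fun ⟨Z, ⟨h4, h5, h6⟩, h7⟩ => hpos fun j hj hj' => ?_⟩
        have := hhigh Z h4 h5 h7 j hj hj'
        rw [h6 j hj] at this
        omega
      exact Nat.card_of_isEmpty

end Counting

/-! ## Specialization -/

section Specialization

theorem specialize_vPow (q : OddPrimePower) (k : ℤ) :
    specialize q (vPow k) = LaurentPolynomial.C ((q.sqrtUnit ^ k : ℝˣ) : ℝ) := by
  rw [specialize, vPow, LaurentPolynomial.eval₂_C, RingHom.comp_apply, LaurentPolynomial.eval₂_T]

/-- The coefficient `P (v ^ 2)` attached to a polynomial `P`. -/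
noncomputable def polyCoeff (P : Polynomial ℤ) : CoeffRing := Polynomial.aeval (vPow 2) P

theorem specialize_polyCoeff (q : OddPrimePower) (P : Polynomial ℤ) :
    specialize q (polyCoeff P) = ((P.eval (q.card : ℤ) : ℤ) : ℝ[T;T⁻¹]) := by
  have h : specialize q (vPow 2) = ((q.card : ℤ) : ℝ[T;T⁻¹]) := by
    have h1 : ((q.sqrtUnit ^ (2 : ℤ) : ℝˣ) : ℝ) = ((q.card : ℤ) : ℝ) := by
      rw [zpow_ofNat, Units.val_pow_eq_pow_val]
      simp only [OddPrimePower.sqrtUnit, Units.val_mk0]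
      rw [Real.sq_sqrt (by positivity)]
      simp
    rw [specialize_vPow, h1, map_intCast]
  rw [polyCoeff, Polynomial.aeval_def, Polynomial.hom_eval₂, h, Polynomial.eval₂_at_intCast]
  simp

theorem OddPrimePower.card_field (q : OddPrimePower) : Nat.card q.field = q.card :=
  GaloisField.card q.p q.k q.pos.ne'

/-- The odd prime power `3 ^ (m + 1)`. -/
def OddPrimePower.ofThree (m : ℕ) : OddPrimePower :=
  ⟨3, m + 1, Nat.prime_three, by norm_num, Nat.succ_pos m⟩

theorem sqrtUnit_ofThree_injective :
    Function.Injective fun m => ((OddPrimePower.ofThree m).sqrtUnit : ℝ) := by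
  intro m m' h
  simp only [OddPrimePower.sqrtUnit, Units.val_mk0, OddPrimePower.ofThree,
    OddPrimePower.card] at h
  rw [Real.sqrt_inj (by positivity) (by positivity)] at h
  have := Nat.pow_right_injective (le_refl 2 |>.trans (by norm_num : 2 ≤ 3)) (by exact_mod_cast h)
  omega

/-- Clearing denominators leaves a polynomial with infinitely many real roots. -/
theorem LaurentPolynomial.eq_zero_of_eval₂_eq_zero {f : ℤ[T;T⁻¹]} {s : ℕ → ℝˣ}
    (hs : Function.Injective fun m => (s m : ℝ))
    (h : ∀ m, LaurentPolynomial.eval₂ (Int.castRingHom ℝ) (s m) f = 0) : f = 0 := by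
  obtain ⟨k, P, hP⟩ := LaurentPolynomial.exists_T_pow f
  have hP0 : P = 0 := by
    rw [← Polynomial.map_eq_zero_iff (f := Int.castRingHom ℝ) Int.cast_injective]
    apply Polynomial.eq_zero_of_infinite_isRoot
    refine (Set.infinite_range_of_injective hs).mono ?_
    rintro _ ⟨m, rfl⟩
    have h1 := congrArg (LaurentPolynomial.eval₂ (Int.castRingHom ℝ) (s m)) hP
    rw [map_mul, h m, zero_mul, LaurentPolynomial.eval₂_toLaurent] at h1
    simpa [Polynomial.IsRoot, Polynomial.eval_map] using h1
  rw [hP0, map_zero] at hP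
  have h2 := congrArg (· * LaurentPolynomial.T (-(k : ℤ))) hP
  rw [mul_assoc, ← LaurentPolynomial.T_add, add_neg_cancel, LaurentPolynomial.T_zero, mul_one,
    zero_mul] at h2
  exact h2.symm

theorem tUnit_zpow (m : ℤ) : ((tUnit ^ m : (ℝ[T;T⁻¹])ˣ) : ℝ[T;T⁻¹]) = LaurentPolynomial.T m := by
  induction m using Int.induction_on with
  | zero => simp
  | succ i ih => rw [zpow_add_one, Units.val_mul, ih, LaurentPolynomial.T_add]; rfl
  | pred i ih => rw [zpow_sub_one, Units.val_mul, ih, sub_eq_add_neg, LaurentPolynomial.T_add]; rfl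

theorem coeff_specialize (q : OddPrimePower) (a : CoeffRing) (k : ℤ) :
    (specialize q a).coeff k =
      LaurentPolynomial.eval₂ (Int.castRingHom ℝ) q.sqrtUnit (a.coeff k) := by
  induction a using LaurentPolynomial.induction_on' with
  | add a b ha hb => rw [map_add, AddMonoidAlgebra.coeff_add, AddMonoidAlgebra.coeff_add,
      Finsupp.add_apply, Finsupp.add_apply, ha, hb, map_add]
  | C_mul_T m b =>
    rw [specialize, LaurentPolynomial.eval₂_C_mul_T, tUnit_zpow, RingHom.comp_apply,
      ← LaurentPolynomial.single_eq_C_mul_T, ← LaurentPolynomial.single_eq_C_mul_T,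
      AddMonoidAlgebra.coeff_single, AddMonoidAlgebra.coeff_single, Finsupp.single_apply,
      Finsupp.single_apply]
    split_ifs
    · rfl
    · rw [map_zero]

/-- Specialization acts on each coefficient of a power of `t`, and the powers of 3 supply infinitely
many values of `v`. Identities in `𝒜` can thus be tested over finite fields. -/
theorem eq_zero_of_specialize {a : CoeffRing} (h : ∀ q, specialize q a = 0) : a = 0 := by
  ext k : 1
  apply LaurentPolynomial.eq_zero_of_eval₂_eq_zero sqrtUnit_ofThree_injective
  intro m
  have := coeff_specialize (OddPrimePower.ofThree m) a k
  rw [h] at this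
  exact this.symm

end Specialization

/-! ## Multiplication by elementary orbit functions -/

section Elementary

variable {n d : ℕ}

theorem cornerSum_mono_left (A : Matrix (Fin n) (Fin n) ℕ) {i i' : ℕ} (h : i ≤ i') (j : ℕ) :
    cornerSum A i j ≤ cornerSum A i' j := by
  refine Finset.sum_le_sum fun r _ => Finset.sum_le_sum fun s _ => ?_
  split_ifs <;> omega

/-- The flag `U` amounts to its member `g`, a subspace between `V_x` and `V_y`. Its position
relative to `W` prescribes the dimensions of the intersections with the `W_j`; the remaining rows of
corner sums of `A` must agree with those of `C`, a condition independent of the field. -/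
theorem exists_polynomial_card_replace {g x y : ℕ} (hg : 0 < g) (hgn : g < n) (hx : g - 1 ≤ x)
    (hxy : x ≤ y) (hy : y ≤ g + 1) (A C : Matrix (Fin n) (Fin n) ℕ) :
    ∃ P : Polynomial ℤ, ∀ (F : Type) [Field F] [Finite F] (V W : StepFlag F n d),
      relPos V W = C →
      (Nat.card {U : StepFlag F n d // ((∀ m, m ≠ g → U.sub m = V.sub m) ∧
        V.sub x ≤ U.sub g ∧ U.sub g ≤ V.sub y) ∧ relPos U W = A} : ℤ) =
        P.eval (Nat.card F : ℤ) := by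
  by_cases hAC : ∀ i j, i ≤ n → j ≤ n → i ≠ g → cornerSum C i j = cornerSum A i j
  · have hN : cornerSum C y n = cornerSum C x n + (cornerSum C y n - cornerSum C x n) := by
      have := cornerSum_mono_left C hxy n
      omega
    obtain ⟨P, hP⟩ := exists_polynomial_card_submodule n (cornerSum C x) _ (cornerSum C y)
      (cornerSum A g) hN
    refine ⟨P, fun F _ _ V W hVW => ?_⟩
    rw [← hP F (Fin d → F) (V.sub x) (V.sub y) W.sub W.sub_mono (W.sub_of_le le_rfl)
      (V.sub_mono hxy) (fun j _ => hVW ▸ interDim_eq_cornerSum V W x j)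
      (fun j _ => hVW ▸ interDim_eq_cornerSum V W y j), Nat.cast_inj]
    refine Nat.card_congr
      { toFun := fun U => ⟨U.1.sub g, U.2.1.2.1, U.2.1.2.2, fun j hj => ?_⟩
        invFun := fun Z => ⟨V.replace g hg hgn Z.1 ((V.sub_mono hx).trans Z.2.1)
          (Z.2.2.1.trans (V.sub_mono hy)), ⟨fun m hm => ?_, ?_, ?_⟩, ?_⟩
        left_inv := fun U => ?_
        right_inv := fun Z => ?_ }
    · have h1 := interDim_eq_cornerSum U.1 W g j
      rwa [U.2.2] at h1
    · rw [StepFlag.sub_replace, if_neg hm]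
    · rw [StepFlag.sub_replace, if_pos rfl]
      exact Z.2.1
    · rw [StepFlag.sub_replace, if_pos rfl]
      exact Z.2.2.1
    · rw [relPos_eq_iff]
      intro i j hi hj
      rw [interDim, StepFlag.sub_replace]
      by_cases h : i = g
      · rw [if_pos h, h]
        exact Z.2.2.2 j hj
      · rw [if_neg h, ← hAC i j hi hj h, ← hVW, ← interDim_eq_cornerSum, interDim]
    · apply Subtype.ext
      apply StepFlag.ext_sub
      intro m _ _
      rw [StepFlag.sub_replace]
      split_ifs with h
      · rw [h]
      · rw [U.2.1.1 m h]
    · apply Subtype.ext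
      simp only [StepFlag.sub_replace, if_true]
  · refine ⟨0, fun F _ _ V W hVW => ?_⟩
    rw [Polynomial.eval_zero, Nat.cast_eq_zero]
    have : IsEmpty {U : StepFlag F n d // ((∀ m, m ≠ g → U.sub m = V.sub m) ∧
        V.sub x ≤ U.sub g ∧ U.sub g ≤ V.sub y) ∧ relPos U W = A} := by
      refine ⟨fun U => hAC fun i j _ _ h => ?_⟩
      rw [← hVW, ← U.2.2, ← interDim_eq_cornerSum, ← interDim_eq_cornerSum, interDim, interDim,
        U.2.1.1 i h]
    exact Nat.card_of_isEmpty

theorem StepFlag.type_sum {F : Type*} [Field F] (V : StepFlag F n d) (i : Fin n) :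
    V.dim (i + 1) = V.dim i + V.type i := by
  rw [StepFlag.type]
  have := V.dim_mono (Nat.le_succ (i : ℕ))
  simp only [Nat.succ_eq_add_one] at this
  omega

/-- The two types already determine the drop of dimension, so `c` need not be prescribed separately.
-/
theorem relPos_eq_elemMat_iff_type {F : Type*} [Field F] {h c : ℕ} (hh : h + 1 < n)
    {δ : Fin n → ℕ} {V W : StepFlag F n d} :
    relPos V W = elemMat h c δ ↔ ((∀ m, m ≠ h + 1 → W.sub m = V.sub m) ∧
      W.sub (h + 1) ≤ V.sub (h + 1)) ∧ V.type = rowSum (elemMat h c δ) ∧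
      W.type = rowSum (elemMat h c δ).transpose := by
  constructor
  · intro hr
    have h1 := (relPos_eq_elemMat_iff hh).1 hr
    exact ⟨⟨h1.1.1, h1.1.2.1⟩, h1.2.symm, by rw [← hr, rowSum_relPos_transpose]⟩
  · rintro ⟨⟨h1, h2⟩, h3, h4⟩
    refine (relPos_eq_elemMat_iff hh).2 ⟨⟨h1, h2, ?_⟩, h3.symm⟩
    have h5 := V.type_sum ⟨h, by omega⟩
    have h6 := W.type_sum ⟨h, by omega⟩
    rw [h3, rowSum_elemMat hh, if_pos rfl] at h5
    rw [h4, rowSum_elemMat_transpose hh, if_neg (by simp)] at h6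
    have h7 := dim_congr (h1 h (by omega))
    simp only at h5 h6
    omega

/-- The numbers of flags that describe the left multiplication by `e_B` are polynomials in `q`. -/
def HasPolynomialCounts (d : ℕ) (B : Matrix (Fin n) (Fin n) ℕ) : Prop :=
  ∀ A C : Matrix (Fin n) (Fin n) ℕ, ∃ P : Polynomial ℤ,
    ∀ (F : Type) [Field F] [Finite F] (V W : StepFlag F n d), relPos V W = C →
      (Nat.card {U : StepFlag F n d // relPos V U = B ∧ relPos U W = A} : ℤ) =
        P.eval (Nat.card F : ℤ)

/-- The bounds `V_x` and `V_y` cover both kinds of factors: member `g` shrinks when `x = g - 1`, `y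
= g`, and grows when `x = g`, `y = g + 1`. -/
theorem hasPolynomialCounts_of_iff {B : Matrix (Fin n) (Fin n) ℕ} {g x y : ℕ} (hg : 0 < g)
    (hgn : g < n) (hx : g - 1 ≤ x) (hxy : x ≤ y) (hy : y ≤ g + 1) {lam mu : Fin n → ℕ}
    (h : ∀ (F : Type) [Field F] (V U : StepFlag F n d), relPos V U = B ↔
      ((∀ m, m ≠ g → U.sub m = V.sub m) ∧ V.sub x ≤ U.sub g ∧ U.sub g ≤ V.sub y) ∧
      V.type = lam ∧ U.type = mu) : HasPolynomialCounts d B := by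
  intro A C
  by_cases hAC : rowSum C = lam ∧ rowSum A = mu
  · obtain ⟨P, hP⟩ := exists_polynomial_card_replace (d := d) hg hgn hx hxy hy A C
    refine ⟨P, fun F _ _ V W hVW => ?_⟩
    rw [← hP F V W hVW, Nat.cast_inj]
    refine Nat.card_congr (Equiv.subtypeEquivRight fun U => ?_)
    rw [h]
    refine ⟨fun h1 => ⟨h1.1.1, h1.2⟩, fun h1 => ⟨⟨h1.1, ?_, ?_⟩, h1.2⟩⟩
    · rw [← rowSum_relPos V W, hVW, hAC.1]
    · rw [← rowSum_relPos U W, h1.2, hAC.2]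
  · refine ⟨0, fun F _ _ V W hVW => ?_⟩
    rw [Polynomial.eval_zero, Nat.cast_eq_zero]
    have : IsEmpty {U : StepFlag F n d // relPos V U = B ∧ relPos U W = A} := by
      refine ⟨fun U => hAC ?_⟩
      have h1 := ((h F V U.1).1 U.2.1).2
      rw [← hVW, ← U.2.2, rowSum_relPos, rowSum_relPos]
      exact h1
    exact Nat.card_of_isEmpty

theorem hasPolynomialCounts_elemMat {h : ℕ} (hh : h + 1 < n) (c : ℕ) (δ : Fin n → ℕ) :
    HasPolynomialCounts d (elemMat h c δ) := by
  refine hasPolynomialCounts_of_iff (g := h + 1) (x := h) (y := h + 1) (by omega) hh (by omega)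
    (by omega) (by omega) (lam := rowSum (elemMat h c δ))
    (mu := rowSum (elemMat h c δ).transpose) fun F _ V U => ?_
  rw [relPos_eq_elemMat_iff_type hh]
  refine and_congr_left fun _ => and_congr_right fun h1 => ?_
  rw [iff_and_self, ← h1 h (by omega)]
  exact fun _ => U.sub_mono (Nat.le_succ _)

theorem hasPolynomialCounts_elemMat_transpose {h : ℕ} (hh : h + 1 < n) (c : ℕ) (δ : Fin n → ℕ) :
    HasPolynomialCounts d (elemMat h c δ).transpose := by
  refine hasPolynomialCounts_of_iff (g := h + 1) (x := h + 1) (y := h + 2) (by omega) hh (by omega)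
    (by omega) (by omega) (lam := rowSum (elemMat h c δ).transpose)
    (mu := rowSum (elemMat h c δ)) fun F _ V U => ?_
  rw [relPos_transpose U V, Matrix.transpose_inj, relPos_eq_elemMat_iff_type hh,
    and_comm (a := U.type = _)]
  refine and_congr_left fun _ => ⟨fun h1 => ⟨fun m hm => (h1.1 m hm).symm, h1.2, ?_⟩,
    fun h1 => ⟨fun m hm => (h1.1 m hm).symm, h1.2.1⟩⟩
  rw [h1.1 (h + 2) (by omega)]
  exact U.sub_mono (Nat.le_succ _)

theorem finite_Theta (n d : ℕ) : (Theta n d).Finite := by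
  have : (Set.univ.pi fun _ : Fin n => Set.univ.pi fun _ : Fin n => Set.Iic d).Finite :=
    Set.Finite.pi fun _ => Set.Finite.pi fun _ => Set.finite_Iic d
  refine this.subset fun A hA i _ j _ => ?_
  rw [Set.mem_Iic]
  calc A i j ≤ ∑ j, A i j := Finset.single_le_sum (f := fun j => A i j) (by simp) (by simp)
    _ ≤ ∑ i, ∑ j, A i j :=
      Finset.single_le_sum (f := fun i => ∑ j, A i j) (by simp) (by simp)
    _ = d := hA

theorem ConvFamily.smul_apply (a : CoeffRing) (f : ConvFamily n d) (q : OddPrimePower)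
    (V W : StepFlag q.field n d) : (a • f) q V W = specialize q a * f q V W := by
  rw [Algebra.smul_def]
  change (Matrix.scalar (StepFlag q.field n d) (specialize q a) * f q) V W = _
  simp

theorem ConvFamily.mul_apply (f g : ConvFamily n d) (q : OddPrimePower)
    (V W : StepFlag q.field n d) : (f * g) q V W = ∑ U, f q V U * g q U W :=
  Matrix.mul_apply

/-- The submodule of the generic invariant functions. -/
noncomputable def invariantSubmodule (n d : ℕ) : Submodule CoeffRing (ConvFamily n d) where
  carrier := Set.range (invariantFun (n := n) d)
  add_mem' := by
    rintro _ _ ⟨c, rfl⟩ ⟨c', rfl⟩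
    refine ⟨c + c', ?_⟩
    funext q
    ext V W : 1
    exact map_add (specialize q) _ _
  zero_mem' := by
    refine ⟨0, ?_⟩
    funext q
    ext V W : 1
    exact map_zero (specialize q)
  smul_mem' := by
    rintro a _ ⟨c, rfl⟩
    refine ⟨a • c, ?_⟩
    funext q
    ext V W : 1
    rw [ConvFamily.smul_apply]
    exact map_mul (specialize q) _ _

theorem one_mem_invariantSubmodule (n d : ℕ) : 1 ∈ invariantSubmodule n d := by
  classical
  -- This condition on corner sums expresses that the matrix is diagonal, that is, that the two
  -- flags coincide.
  refine ⟨fun M => if ∀ i j, i ≤ n → j ≤ n → cornerSum M i j = cornerSum M (min i j) n then 1 else 0,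
    ?_⟩
  funext q
  ext V W : 1
  change specialize q (ite _ _ _) = (1 : Matrix _ _ _) V W
  by_cases h : V = W
  · subst h
    rw [if_pos, map_one, Matrix.one_apply_eq]
    intro i j hi hj
    rw [← interDim_eq_cornerSum, ← interDim_eq_cornerSum, interDim_top_right _ _ _ le_rfl, interDim]
    rcases Nat.le_total i j with hij | hij
    · rw [min_eq_left hij, inf_eq_left.2 (V.sub_mono hij), StepFlag.dim]
    · rw [min_eq_right hij, inf_eq_right.2 (V.sub_mono hij), StepFlag.dim]
  · rw [if_neg, map_zero, Matrix.one_apply_ne h]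
    intro h0
    apply h
    apply StepFlag.ext_sub
    intro m _ hm
    have h1 := h0 m m hm.le hm.le
    have h2 := h0 n m le_rfl hm.le
    rw [← interDim_eq_cornerSum, ← interDim_eq_cornerSum, interDim_top_right _ _ _ le_rfl,
      min_self] at h1
    rw [← interDim_eq_cornerSum, ← interDim_eq_cornerSum, interDim_top_right _ _ _ le_rfl,
      min_eq_right hm.le, interDim_top_left _ _ _ le_rfl] at h2
    have h3 : V.sub m ⊓ W.sub m = V.sub m :=
      Submodule.eq_of_le_of_finrank_eq inf_le_left h1
    have h4 : V.sub m ⊓ W.sub m = W.sub m :=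
      Submodule.eq_of_le_of_finrank_eq inf_le_right (h1.trans h2.symm)
    exact h3.symm.trans h4

theorem orbitFun_apply (A : Matrix (Fin n) (Fin n) ℕ) (q : OddPrimePower) :
    (orbitFun d A : ConvFamily n d) q = orbitMatrix ℝ[T;T⁻¹] q.field d A := by
  ext V W : 1
  change specialize q (ite _ _ _) = _
  by_cases h : relPos V W = A
  · rw [orbitMatrix_eq_one h, if_pos h, map_one]
  · rw [orbitMatrix_eq_zero h, if_neg h, map_zero]

/-- The middle flags are grouped by their position relative to `W`; each group has a polynomial
number of members, and the polynomial in `q` is lifted to one in `v ^ 2`. -/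
theorem orbitFun_mul_mem {B : Matrix (Fin n) (Fin n) ℕ} (hB : HasPolynomialCounts d B)
    {f : ConvFamily n d} (hf : f ∈ invariantSubmodule n d) :
    (orbitFun d B : ConvFamily n d) * f ∈ invariantSubmodule n d := by
  classical
  obtain ⟨c, rfl⟩ := hf
  choose P hP using hB
  refine ⟨fun C => ∑ A ∈ (finite_Theta n d).toFinset, polyCoeff (P A C) * c A, ?_⟩
  funext q
  ext V W : 1
  rw [ConvFamily.mul_apply, orbitFun_apply]
  change specialize q (∑ A ∈ _, _) = ∑ U, _ * specialize q (c (relPos U W))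
  rw [map_sum, ← Finset.sum_fiberwise_of_maps_to
    (s := Finset.univ) (g := fun U => relPos U W)
    (fun U _ => (Set.Finite.mem_toFinset (finite_Theta n d)).2 (relPos_mem_Theta U W))]
  refine Finset.sum_congr rfl fun A _ => ?_
  rw [map_mul, specialize_polyCoeff, ← OddPrimePower.card_field, ← hP A _ q.field V W rfl,
    Finset.sum_filter]
  have h1 : ∀ U : StepFlag q.field n d, (if relPos U W = A then
      orbitMatrix ℝ[T;T⁻¹] q.field d B V U * specialize q (c (relPos U W)) else 0) =
      (if relPos V U = B ∧ relPos U W = A then 1 else 0) * specialize q (c A) := by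
    intro U
    by_cases h1 : relPos U W = A
    · by_cases h2 : relPos V U = B
      · rw [orbitMatrix_eq_one h2, if_pos h1, if_pos ⟨h2, h1⟩, h1]
      · rw [orbitMatrix_eq_zero h2, if_pos h1, if_neg fun h => h2 h.1, zero_mul, zero_mul]
    · rw [if_neg h1, if_neg fun h => h1 h.2, zero_mul]
  rw [Finset.sum_congr rfl fun U _ => h1 U, ← Finset.sum_mul, Finset.sum_boole,
    Nat.card_eq_fintype_card, Fintype.card_subtype]
  simp

end Elementary

/-! ## Dimensions of orbits -/

section Orbits

variable {n d : ℕ}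

/-- The subspace of the vectors that are supported on `P`. -/
def coordSubmodule (F : Type*) [Field F] (P : Fin d → Prop) : Submodule F (Fin d → F) :=
  LinearMap.ker (LinearMap.funLeft F F fun s : {s // ¬P s} => s.1)

theorem mem_coordSubmodule {F : Type*} [Field F] {P : Fin d → Prop} {x : Fin d → F} :
    x ∈ coordSubmodule F P ↔ ∀ s, ¬P s → x s = 0 := by
  simp only [coordSubmodule, LinearMap.mem_ker, funext_iff, LinearMap.funLeft_apply,
    Pi.zero_apply, Subtype.forall]

theorem finrank_coordSubmodule (F : Type*) [Field F] (P : Fin d → Prop) :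
    Module.finrank F (coordSubmodule F P) = Nat.card {s // P s} := by
  classical
  have h1 := LinearMap.finrank_range_add_finrank_ker
    (LinearMap.funLeft F F fun s : {s // ¬P s} => s.1)
  rw [LinearMap.range_eq_top.2 (LinearMap.funLeft_surjective_of_injective _ _ _
    Subtype.val_injective), finrank_top, Module.finrank_fintype_fun_eq_card,
    Module.finrank_fin_fun] at h1
  have h2 := Fintype.card_subtype_compl P
  have h3 := Fintype.card_subtype_le P
  rw [Fintype.card_fin] at h2 h3
  rw [Nat.card_eq_fintype_card, coordSubmodule]
  omega

/-- The flag of coordinate subspaces with steps given by a partition of the coordinates. -/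
def coordFlag (F : Type*) [Field F] (κ : Fin d → Fin n) : StepFlag F n d :=
  StepFlag.mk (fun m => coordSubmodule F fun s => (κ s : ℕ) < m)
    (eq_bot_iff.2 fun x hx => by
      rw [mem_coordSubmodule] at hx
      ext s
      exact hx s (by simp))
    (eq_top_iff.2 fun x _ => by
      rw [mem_coordSubmodule]
      exact fun s hs => absurd (κ s).2 hs)
    (fun a b h x hx => by
      rw [mem_coordSubmodule] at hx ⊢
      exact fun s hs => hx s fun h' => hs (lt_of_lt_of_le h' h))

theorem sub_coordFlag (F : Type*) [Field F] (κ : Fin d → Fin n) (m : ℕ) :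
    (coordFlag F κ).sub m = coordSubmodule F fun s => (κ s : ℕ) < m :=
  StepFlag.sub_mk _ _ _ _ _

/-- Distribute the `d` coordinates over the cells, `A i j` of them to the cell `(i, j)`. The
coordinate flags by rows and by columns have relative position `A`. -/
theorem exists_relPos_eq (F : Type*) [Field F] {A : Matrix (Fin n) (Fin n) ℕ}
    (hA : A ∈ Theta n d) : ∃ V W : StepFlag F n d, relPos V W = A := by
  classical
  have hcard : Fintype.card (Σ p : Fin n × Fin n, Fin (A p.1 p.2)) = Fintype.card (Fin d) := by
    simp only [Fintype.card_sigma, Fintype.card_fin, Fintype.sum_prod_type]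
    exact hA
  let φ := Fintype.equivOfCardEq hcard
  refine ⟨coordFlag F fun s => (φ.symm s).1.1, coordFlag F fun s => (φ.symm s).1.2,
    (relPos_eq_iff _ _ A).2 fun i j _ _ => ?_⟩
  have h1 : (coordFlag F fun s => (φ.symm s).1.1).sub i ⊓
      (coordFlag F fun s => (φ.symm s).1.2).sub j =
      coordSubmodule F fun s => ((φ.symm s).1.1 : ℕ) < i ∧ ((φ.symm s).1.2 : ℕ) < j := by
    rw [sub_coordFlag, sub_coordFlag]
    ext x
    rw [Submodule.mem_inf, mem_coordSubmodule, mem_coordSubmodule, mem_coordSubmodule,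
      ← forall_and]
    refine forall_congr' fun s => ?_
    rw [not_and_or]
    tauto
  rw [interDim, h1, finrank_coordSubmodule, Nat.card_congr (φ.symm.subtypeEquiv (q := fun x =>
    (x.1.1 : ℕ) < i ∧ (x.1.2 : ℕ) < j) fun s => Iff.rfl), Nat.card_eq_fintype_card,
    Fintype.card_subtype, Finset.card_filter, Fintype.sum_sigma, Fintype.sum_prod_type]
  refine Finset.sum_congr rfl fun r _ => Finset.sum_congr rfl fun s _ => ?_
  split_ifs <;> simp

/-! ### Stabilizers and the dimension formula -/

variable {F : Type*} [Field F]

theorem exists_complement_block (V W : StepFlag F n d) (i j : Fin n) :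
    ∃ C : Submodule F (Fin d → F),
      (V.sub i ⊓ W.sub (j + 1)) ⊔ (V.sub (i + 1) ⊓ W.sub j) ⊔ C = V.sub (i + 1) ⊓ W.sub (j + 1) ∧
      Module.finrank F C = relPos V W i j := by
  set X := V.sub (i + 1) ⊓ W.sub (j + 1) with hX
  set Y := (V.sub i ⊓ W.sub (j + 1)) ⊔ (V.sub (i + 1) ⊓ W.sub j) with hY
  have hYX : Y ≤ X := sup_le (inf_le_inf_right _ (V.sub_mono (Nat.le_succ _)))
    (inf_le_inf_left _ (W.sub_mono (Nat.le_succ _)))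
  obtain ⟨C, hC⟩ := exists_isCompl Y
  have h1 : Y ⊔ C ⊓ X = X := by
    rw [← sup_inf_assoc_of_le _ hYX, hC.sup_eq_top, top_inf_eq]
  refine ⟨C ⊓ X, h1, ?_⟩
  have h2 := Submodule.finrank_sup_add_finrank_inf_eq Y (C ⊓ X)
  rw [h1, ← inf_assoc, hC.inf_eq_bot, bot_inf_eq, finrank_bot] at h2
  have h3 := Submodule.finrank_sup_add_finrank_inf_eq (V.sub i ⊓ W.sub (j + 1))
    (V.sub (i + 1) ⊓ W.sub j)
  rw [← hY, inf_inf_inf_comm, inf_eq_left.2 (V.sub_mono (Nat.le_succ _)),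
    inf_eq_right.2 (W.sub_mono (Nat.le_succ _))] at h3
  have h4 := relPos_apply_add V W i j
  have h5 : Module.finrank F X = interDim V W (i + 1) (j + 1) := rfl
  simp only [interDim] at h4 h5
  omega

/-- The sum of the products of the entries of a matrix with the corner sums up to them; this is the
dimension of the stabilizer of a pair of flags in the orbit. -/
def stabDim (A : Matrix (Fin n) (Fin n) ℕ) : ℕ :=
  ∑ i : Fin n, ∑ j : Fin n, A i j * cornerSum A (i + 1) (j + 1)

/-- Complements in the cells form a basis adapted to both flags. An endomorphism preserves the flags
if and only if it maps each basis vector of the cell `(i, j)` into `V_{i+1} ∩ W_{j+1}`, and these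
images can be chosen freely. -/
theorem finrank_stabAlg (V W : StepFlag F n d) :
    Module.finrank F (stabAlg V W) = stabDim (relPos V W) := by
  choose C hC hC' using exists_complement_block V W
  let ι := Σ p : Fin n × Fin n, Fin (Module.finrank F (C p.1 p.2))
  let f : ι → (Fin d → F) := fun s => (Module.finBasis F (C s.1.1 s.1.2) s.2 : Fin d → F)
  have hmem : ∀ s : ι, f s ∈ V.sub (s.1.1 + 1) ⊓ W.sub (s.1.2 + 1) := fun s => by
    rw [← hC]
    exact (le_sup_right : C s.1.1 s.1.2 ≤ _) (Subtype.mem _)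
  have hspan : ∀ i j, i ≤ n → j ≤ n → V.sub i ⊓ W.sub j ≤
      Submodule.span F (f '' {s | (s.1.1 : ℕ) < i ∧ (s.1.2 : ℕ) < j}) := by
    intro i
    induction i with
    | zero => intro j _ _; rw [V.sub_zero, bot_inf_eq]; exact bot_le
    | succ i ih =>
      intro j hi
      induction j with
      | zero => intro _; rw [W.sub_zero, inf_bot_eq]; exact bot_le
      | succ j ihj =>
        intro hj
        rw [← hC ⟨i, hi⟩ ⟨j, hj⟩]
        refine sup_le (sup_le ?_ ?_) ?_
        · refine (ih (j + 1) (by omega) hj).trans (Submodule.span_mono (Set.image_mono ?_))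
          rintro s ⟨h1, h2⟩
          exact ⟨by omega, h2⟩
        · refine (ihj (by omega)).trans (Submodule.span_mono (Set.image_mono ?_))
          rintro s ⟨h1, h2⟩
          exact ⟨h1, by omega⟩
        · have h1 : Submodule.span F (Set.range fun k : Fin (Module.finrank F (C ⟨i, hi⟩ ⟨j, hj⟩)) =>
              f ⟨(⟨i, hi⟩, ⟨j, hj⟩), k⟩) = C ⟨i, hi⟩ ⟨j, hj⟩ := by
            have h2 := congrArg (Submodule.map (C ⟨i, hi⟩ ⟨j, hj⟩).subtype)
              (Module.finBasis F (C ⟨i, hi⟩ ⟨j, hj⟩)).span_eq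
            rw [Submodule.map_span, Submodule.map_top, Submodule.range_subtype,
              ← Set.range_comp] at h2
            exact h2
          rw [← h1]
          refine Submodule.span_mono ?_
          rintro _ ⟨k, rfl⟩
          exact ⟨⟨(⟨i, hi⟩, ⟨j, hj⟩), k⟩, ⟨Nat.lt_succ_self i, Nat.lt_succ_self j⟩, rfl⟩
  have htop : ⊤ ≤ Submodule.span F (Set.range f) := by
    have h1 := hspan n n le_rfl le_rfl
    rw [V.sub_of_le le_rfl, W.sub_of_le le_rfl, inf_top_eq] at h1
    exact h1.trans (Submodule.span_mono (Set.image_subset_range _ _))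
  have hcard : Fintype.card ι = Module.finrank F (Fin d → F) := by
    rw [Module.finrank_fin_fun]
    simp only [ι, Fintype.card_sigma, Fintype.card_fin, Fintype.sum_prod_type, hC']
    exact relPos_mem_Theta V W
  -- Independence is free: the vectors span and their number is `d`, the sum of the entries.
  let b := Module.Basis.mk (linearIndependent_of_top_le_span_of_card_eq_finrank htop hcard) htop
  have hb : ∀ s, b s = f s := fun s => by rw [Module.Basis.mk_apply]
  have hstab : ∀ T : Module.End F (Fin d → F), T ∈ stabAlg V W ↔
      ∀ s : ι, T (b s) ∈ V.sub (s.1.1 + 1) ⊓ W.sub (s.1.2 + 1) := by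
    intro T
    constructor
    · intro hT s
      have h1 := hT s.1.1.succ
      have h2 := hT s.1.2.succ
      simp only [StepFlag.sub_val, Fin.val_succ] at h1 h2
      rw [hb]
      exact ⟨h1.1 _ (hmem s).1, h2.2 _ (hmem s).2⟩
    · intro hT i
      rw [V.sub_val, W.sub_val]
      have h1 := hspan i n (by omega) le_rfl
      have h2 := hspan n i le_rfl (by omega)
      rw [W.sub_of_le le_rfl, inf_top_eq] at h1
      rw [V.sub_of_le le_rfl, top_inf_eq] at h2
      have h3 : V.sub i ≤ (V.sub i).comap T := by
        refine h1.trans (Submodule.span_le.2 ?_)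
        rintro _ ⟨s, ⟨hs, -⟩, rfl⟩
        rw [← hb]
        exact V.sub_mono hs (hT s).1
      have h4 : W.sub i ≤ (W.sub i).comap T := by
        refine h2.trans (Submodule.span_le.2 ?_)
        rintro _ ⟨s, ⟨-, hs⟩, rfl⟩
        rw [← hb]
        exact W.sub_mono hs (hT s).2
      exact ⟨fun x hx => h3 hx, fun x hx => h4 hx⟩
  let e : stabAlg V W ≃ₗ[F] ∀ s : ι, (V.sub (s.1.1 + 1) ⊓ W.sub (s.1.2 + 1) : Submodule F _) :=
    { toFun := fun T s => ⟨T.1 (b s), (hstab T.1).1 T.2 s⟩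
      map_add' := fun _ _ => rfl
      map_smul' := fun _ _ => rfl
      invFun := fun g => ⟨b.constr F fun s => (g s : Fin d → F), (hstab _).2 fun s => by
        rw [Module.Basis.constr_basis]
        exact (g s).2⟩
      left_inv := fun T => Subtype.ext (b.ext fun s => by rw [Module.Basis.constr_basis])
      right_inv := fun g => by
        funext s
        apply Subtype.ext
        simp only [Module.Basis.constr_basis] }
  rw [e.finrank_eq, Module.finrank_pi_fintype, stabDim, Fintype.sum_sigma, Fintype.sum_prod_type]
  refine Finset.sum_congr rfl fun i _ => Finset.sum_congr rfl fun j _ => ?_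
  have h5 := interDim_eq_cornerSum V W (i + 1) (j + 1)
  rw [interDim] at h5
  simp only [h5, Finset.sum_const, Finset.card_univ, Fintype.card_fin, hC', smul_eq_mul]

theorem orbitDim_add_stabDim (K : Type*) [Field K] {A : Matrix (Fin n) (Fin n) ℕ}
    (hA : A ∈ Theta n d) : orbitDim K d A + stabDim A = d * d := by
  have h1 : ∀ V W : StepFlag K n d, relPos V W = A → pairOrbitDim V W + stabDim A = d * d := by
    rintro V W rfl
    rw [pairOrbitDim, ← finrank_stabAlg, Submodule.finrank_quotient_add_finrank,
      Module.finrank_linearMap, Module.finrank_fin_fun]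
  obtain ⟨V, W, hVW⟩ := exists_relPos_eq K hA
  have h2 : {m : ℕ | ∃ V V' : StepFlag K n d, relPos V V' = A ∧ m = pairOrbitDim V V'} =
      {pairOrbitDim V W} := by
    ext m
    constructor
    · rintro ⟨V', W', h3, rfl⟩
      have h4 := h1 V W hVW
      have h5 := h1 V' W' h3
      rw [Set.mem_singleton_iff]
      omega
    · rintro rfl
      exact ⟨V, W, hVW, rfl⟩
  rw [orbitDim, h2, csSup_singleton, h1 V W hVW]

theorem cornerSum_diagonal (lam : Fin n → ℕ) (i j : ℕ) :
    cornerSum (Matrix.diagonal lam) i j = ∑ r : Fin n, if (r : ℕ) < min i j then lam r else 0 := by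
  refine Finset.sum_congr rfl fun r _ => ?_
  rw [Finset.sum_eq_single r]
  · simp
  · intro s _ hs
    rw [Matrix.diagonal_apply_ne _ hs.symm, ite_self]
  · simp

theorem cornerSum_right_full (A : Matrix (Fin n) (Fin n) ℕ) (i : ℕ) :
    cornerSum A i n = ∑ r : Fin n, if (r : ℕ) < i then rowSum A r else 0 := by
  refine Finset.sum_congr rfl fun r _ => ?_
  split_ifs with h <;> simp [h, rowSum]

/-- The dimension of `G` cancels, leaving the stabilizer dimension for the diagonal matrix minus
that for `A`. -/
theorem codimExp_eq (K : Type*) [Field K] {A : Matrix (Fin n) (Fin n) ℕ} (hA : A ∈ Theta n d) :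
    codimExp K d A = ∑ i : Fin n, ∑ j : Fin n,
      (A i j : ℤ) * (cornerSum A (i + 1) n - cornerSum A (i + 1) (j + 1)) := by
  have hB : Matrix.diagonal (rowSum A) ∈ Theta n d := by
    rw [mem_Theta_iff, cornerSum_diagonal, ← mem_Theta_iff.1 hA, cornerSum_right_full, min_self]
  have h1 := orbitDim_add_stabDim K hA
  have h2 := orbitDim_add_stabDim K hB
  have h3 : stabDim (Matrix.diagonal (rowSum A)) =
      ∑ i : Fin n, ∑ j : Fin n, A i j * cornerSum A (i + 1) n := by
    refine Finset.sum_congr rfl fun i _ => ?_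
    rw [Finset.sum_eq_single i, cornerSum_diagonal, min_self, ← cornerSum_right_full,
      Matrix.diagonal_apply_eq, rowSum, Finset.sum_mul]
    · intro j _ hj
      rw [Matrix.diagonal_apply_ne _ hj.symm, zero_mul]
    · simp
  simp only [mul_sub, Finset.sum_sub_distrib]
  have h4 : ((stabDim A : ℕ) : ℤ) =
      ∑ i : Fin n, ∑ j : Fin n, (A i j : ℤ) * cornerSum A (i + 1) (j + 1) := by
    simp [stabDim]
  have h5 : ((stabDim (Matrix.diagonal (rowSum A)) : ℕ) : ℤ) =
      ∑ i : Fin n, ∑ j : Fin n, (A i j : ℤ) * cornerSum A (i + 1) n := by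
    simp [h3]
  rw [← h4, ← h5, codimExp]
  change (orbitDim K d A : ℤ) - (orbitDim K d (Matrix.diagonal (rowSum A)) : ℤ) = _
  omega

end Orbits

/-! ## The exponents of the factors -/

section Exponents

variable {n : ℕ}

/-- The entries of a matrix, indexed by natural numbers and extended by zero. -/
def natEntry (A : Matrix (Fin n) (Fin n) ℕ) (i j : ℕ) : ℕ :=
  if h : i < n ∧ j < n then A ⟨i, h.1⟩ ⟨j, h.2⟩ else 0

theorem natEntry_val (A : Matrix (Fin n) (Fin n) ℕ) (i j : Fin n) : natEntry A i j = A i j := by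
  simp [natEntry]

theorem natEntry_transpose (A : Matrix (Fin n) (Fin n) ℕ) (i j : ℕ) :
    natEntry A.transpose i j = natEntry A j i := by
  simp only [natEntry, Matrix.transpose_apply, and_comm]

/-- The numbers of boxes in the rows during stage `k` of phase `j`, when the triples with
`i ≥ c` of this stage have been processed. -/
def StageState (a : ℕ → ℕ → ℕ) (j k c : ℕ) (lam : Fin n → ℕ) : Prop :=
  ∀ m : Fin n,
    ((m : ℕ) < j → lam m = ∑ s ∈ Finset.range j, a m s +
      if k + c + 1 ≤ m then a (m - 1 - k) j else if k ≤ m ∧ m < k + c then a (m - k) j else 0) ∧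
    ((m : ℕ) = j → lam m = ∑ s ∈ Finset.range (j + 1), a j s +
      ∑ r ∈ Finset.Ico (if k + c < j then j - k - 1 else j - k) j, a r j)

/-- The values of the two diagonal entries that matter for the exponent of a factor. -/
def HasDiagValues (a : ℕ → ℕ → ℕ) (D : ℕ × ℕ × ℕ → Fin n → ℕ) (x : ℕ × ℕ × ℕ) : Prop :=
  (∀ m : Fin n, (m : ℕ) = x.2.1 → D x m = ∑ s ∈ Finset.range x.2.2, a x.2.1 s) ∧
  ∀ m : Fin n, (m : ℕ) = x.2.1 + 1 → D x m =
    if x.2.1 + 1 < x.2.2 then ∑ s ∈ Finset.range x.2.2, a (x.2.1 + 1) s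
    else ∑ s ∈ Finset.range (x.2.2 + 1), a x.2.2 s + ∑ r ∈ Finset.Ico (x.1 + 1) x.2.2, a r x.2.2

variable {a : ℕ → ℕ → ℕ} {D : ℕ × ℕ × ℕ → Fin n → ℕ}

/-- A factor moves `a i j` boxes from row `h` to row `h + 1`. In phase `j` the boxes of column `j`
travel one row per stage until they reach row `j`; the rows `m < j` also keep their boxes of the
columns `< j`, which form the diagonal entries in question. -/
theorem stage_diagValues {j k : ℕ} (c : ℕ) (hj : j < n) (hc : k + c ≤ j) {lam mu : Fin n → ℕ}
    (h : IsCompatible a D (stageList j k c) lam mu) (hs : StageState a j k c lam) :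
    StageState a j k 0 mu ∧ ∀ x ∈ stageList j k c, HasDiagValues a D x := by
  induction c generalizing lam with
  | zero =>
    obtain rfl : lam = mu := h
    exact ⟨hs, by simp [stageList]⟩
  | succ c ih =>
    obtain ⟨h1, h2⟩ := h
    have hD : ∀ m : Fin n, D (c, c + k, j) m + (if (m : ℕ) = c + k then a c j else 0) = lam m :=
      fun m => by
        rw [← h1, tripleMat, rowSum_elemMat (by simp only; omega)]
    have hnew : ∀ m : Fin n, rowSum (tripleMat a D (c, c + k, j)).transpose m =
        D (c, c + k, j) m + if (m : ℕ) = c + k + 1 then a c j else 0 := fun m => by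
      rw [tripleMat, rowSum_elemMat_transpose (by simp only; omega)]
    have hs' : StageState a j k c (rowSum (tripleMat a D (c, c + k, j)).transpose) := by
      intro m
      have hD := hD m
      obtain ⟨hs1, hs2⟩ := hs m
      constructor
      · intro hm
        have hs1 := hs1 hm
        rw [hnew]
        by_cases e1 : (m : ℕ) = c + k
        · rw [if_pos e1] at hD
          rw [if_neg (by omega), if_pos (by omega), show (m : ℕ) - k = c by omega] at hs1
          rw [if_neg (by omega), if_neg (by omega), if_neg (by omega)]
          omega
        by_cases e2 : (m : ℕ) = c + k + 1
        · rw [if_neg e1] at hD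
          rw [if_neg (by omega), if_neg (by omega)] at hs1
          rw [if_pos e2, if_pos (by omega), show (m : ℕ) - 1 - k = c by omega]
          omega
        rw [if_neg e1] at hD
        rw [if_neg e2, add_zero, ← add_zero (D _ m), hD, hs1]
        congr 1
        by_cases e3 : k + c + 1 ≤ m
        · rw [if_pos e3, if_pos (by omega)]
        · rw [if_neg e3, if_neg (by omega)]
          congr 1
          apply propext
          omega
      · intro hm
        have hs2 := hs2 hm
        rw [hnew]
        rw [if_neg (by omega), add_zero] at hD
        rw [hD, hs2, if_pos (show k + c < j by omega)]
        by_cases e2 : (m : ℕ) = c + k + 1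
        · rw [if_pos e2, if_neg (by omega), show j - k - 1 = c by omega,
            Finset.sum_eq_sum_Ico_succ_bot (show c < j by omega) (fun r => a r j), show j - k = c + 1 by omega]
          omega
        · rw [if_neg e2, if_pos (by omega), add_zero]
    obtain ⟨ih1, ih2⟩ := ih (by omega) h2 hs'
    refine ⟨ih1, fun x hx => ?_⟩
    rcases List.mem_cons.1 hx with rfl | hx
    · constructor
      · intro m hm
        simp only at hm ⊢
        have h3 := hD m
        rw [if_pos hm, (hs m).1 (by omega), if_neg (by omega), if_pos (by omega),
          show (m : ℕ) - k = c by omega, hm] at h3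
        omega
      · intro m hm
        simp only at hm ⊢
        have h3 := hD m
        rw [if_neg (by omega), add_zero] at h3
        rw [h3]
        split_ifs with h4
        · rw [(hs m).1 (by omega), if_neg (by omega), if_neg (by omega), hm, add_zero]
        · rw [(hs m).2 (by omega), if_neg (by omega), show j - k = c + 1 by omega]
    · exact ih2 x hx

theorem phase_diagValues {j : ℕ} (r : ℕ) (hj : j < n) (hr : r ≤ j) {lam mu : Fin n → ℕ}
    (h : IsCompatible a D (phaseList j r) lam mu) (hs : StageState a j (j - r) r lam) :
    StageState a j j 0 mu ∧ ∀ x ∈ phaseList j r, HasDiagValues a D x := by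
  induction r generalizing lam with
  | zero =>
    obtain rfl : lam = mu := h
    exact ⟨hs, by simp [phaseList]⟩
  | succ r ih =>
    rw [phaseList, isCompatible_append] at h
    obtain ⟨nu, h1, h2⟩ := h
    obtain ⟨h3, h4⟩ := stage_diagValues (r + 1) hj (by omega) h1 hs
    -- The end of a stage, with `c = 0`, is the beginning of the next one with `k` raised by one.
    have h5 : StageState a j (j - r) r nu := by
      intro m
      obtain ⟨h6, h7⟩ := h3 m
      refine ⟨fun hm => ?_, fun hm => ?_⟩
      · rw [h6 hm, if_neg (show ¬j - r + r + 1 ≤ m by omega)]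
        congr 1
        by_cases e : j - r ≤ m
        · rw [if_pos (by omega), if_pos ⟨e, by omega⟩]
          congr 1
          omega
        · rw [if_neg (by omega), if_neg (by omega), if_neg (by omega)]
      · rw [h7 hm, if_pos (by omega), if_neg (by omega)]
        congr 3
        omega
    obtain ⟨h6, h7⟩ := ih (by omega) h2 h5
    refine ⟨h6, fun x hx => ?_⟩
    rw [phaseList] at hx
    rcases List.mem_append.1 hx with hx | hx
    · exact h4 x hx
    · exact h7 x hx

/-- After phase `j` the rows `< j` hold only the boxes of the columns `< j`, the initial situation
for the remaining phases. Other rows no longer matter. -/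
theorem tripleList_diagValues (j : ℕ) (hj : j ≤ n) {lam mu : Fin n → ℕ}
    (h : IsCompatible a D (tripleList j) lam mu)
    (hs : ∀ m : Fin n, (m : ℕ) < j → lam m = ∑ s ∈ Finset.range j, a m s) :
    ∀ x ∈ tripleList j, HasDiagValues a D x := by
  induction j generalizing lam with
  | zero => simp [tripleList]
  | succ j ih =>
    rw [tripleList, isCompatible_append] at h
    obtain ⟨nu, h1, h2⟩ := h
    have h3 : StageState a j (j - j) j lam := by
      intro m
      refine ⟨fun hm => ?_, fun hm => ?_⟩
      · rw [hs m (by omega), if_neg (by omega), if_pos (by omega), Finset.sum_range_succ,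
          Nat.sub_self, Nat.sub_zero]
      · rw [hs m (by omega), if_neg (by omega), Nat.sub_self, Nat.sub_zero, Finset.Ico_self, hm]
        simp
    obtain ⟨h4, h5⟩ := phase_diagValues j hj le_rfl h1 h3
    have h6 := ih (by omega) h2 fun m hm => by
      rw [(h4 m).1 hm, if_neg (by omega), if_neg (by omega), add_zero]
    intro x hx
    rw [tripleList] at hx
    rcases List.mem_append.1 hx with hx | hx
    · exact h5 x hx
    · exact h6 x hx

/-! ### Exponents of elementary matrices and their sum -/

theorem sum_elemMat_mul {h : ℕ} (hh : h + 1 < n) (c : ℕ) (δ : Fin n → ℕ) (g : Fin n → Fin n → ℤ) :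
    ∑ i, ∑ j, (elemMat h c δ i j : ℤ) * g i j =
      ∑ i, (δ i : ℤ) * g i i + c * g ⟨h, by omega⟩ ⟨h + 1, hh⟩ := by
  have e : ∀ i j : Fin n, (elemMat h c δ i j : ℤ) * g i j =
      (if i = j then (δ i : ℤ) * g i i else 0) +
      if i = ⟨h, by omega⟩ then
        (if j = ⟨h + 1, hh⟩ then (c : ℤ) * g ⟨h, by omega⟩ ⟨h + 1, hh⟩ else 0) else 0 := by
    intro i j
    rw [elemMat_apply, Nat.cast_add, add_mul]
    congr 1
    · split_ifs with h1
      · rw [h1]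
      · simp
    · by_cases h1 : i = ⟨h, by omega⟩
      · by_cases h2 : j = ⟨h + 1, hh⟩
        · simp [h1, h2]
        · rw [if_neg fun h3 => h2 (Fin.ext h3.2), if_pos h1, if_neg h2]
          simp
      · rw [if_neg fun h3 => h1 (Fin.ext h3.1), if_neg h1]
        simp
  simp only [e, Finset.sum_add_distrib]
  simp

variable {d : ℕ}

/-- Only the cells `(h, h)` and `(h, h + 1)` lie in the position that contributes; for the transpose
these are `(h + 1, h)` and `(h + 1, h + 1)`. -/
theorem codimExp_elemMat (K : Type*) [Field K] {h : ℕ} (hh : h + 1 < n) {c : ℕ} {δ : Fin n → ℕ}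
    (hA : elemMat h c δ ∈ Theta n d) :
    codimExp K d (elemMat h c δ) = c * δ ⟨h, by omega⟩ := by
  rw [codimExp_eq K hA, sum_elemMat_mul hh c δ fun i j =>
    (cornerSum (elemMat h c δ) (i + 1) n : ℤ) - cornerSum (elemMat h c δ) (i + 1) (j + 1)]
  simp only [cornerSum_elemMat hh]
  have e1 : ∀ i : Fin n, min ((i : ℕ) + 1) n = i + 1 := fun i => by omega
  have e2 : min (h + 1) n = h + 1 := by omega
  have e3 : min (h + 1) (h + 1 + 1) = h + 1 := by omega
  simp only [e1, e2, e3, min_self, Nat.cast_add, add_sub_add_left_eq_sub]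
  rw [if_pos (by omega), if_pos (by omega), sub_self, mul_zero, add_zero,
    Finset.sum_eq_single ⟨h, by omega⟩]
  · simp [hh, mul_comm]
  · intro i _ hi
    have hi : (i : ℕ) ≠ h := fun h0 => hi (Fin.ext h0)
    simp only [show (h < (i : ℕ) + 1 ∧ h + 1 < n) ↔ (h < (i : ℕ) + 1 ∧ h + 1 < (i : ℕ) + 1) by omega,
      sub_self, mul_zero]
  · simp

theorem codimExp_elemMat_transpose (K : Type*) [Field K] {h : ℕ} (hh : h + 1 < n) {c : ℕ}
    {δ : Fin n → ℕ} (hA : elemMat h c δ ∈ Theta n d) :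
    codimExp K d (elemMat h c δ).transpose = c * δ ⟨h + 1, hh⟩ := by
  rw [codimExp_eq K (transpose_mem_Theta hA), Finset.sum_comm]
  simp only [Matrix.transpose_apply, cornerSum_transpose]
  rw [sum_elemMat_mul hh c δ fun i j =>
    (cornerSum (elemMat h c δ) n (j + 1) : ℤ) - cornerSum (elemMat h c δ) (i + 1) (j + 1)]
  simp only [cornerSum_elemMat hh]
  have e1 : ∀ i : Fin n, min n ((i : ℕ) + 1) = i + 1 := fun i => by omega
  have e2 : min n (h + 1 + 1) = h + 1 + 1 := by omega
  have e3 : min (h + 1) (h + 1 + 1) = h + 1 := by omega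
  simp only [e1, e2, e3, min_self, Nat.cast_add, add_sub_add_left_eq_sub]
  rw [if_pos (by omega), if_pos (by omega), add_sub_add_right_eq_sub, Finset.sum_eq_zero, zero_add]
  · congr 1
    rw [sub_eq_iff_eq_add, ← Nat.cast_add, Nat.cast_inj]
    have : δ ⟨h + 1, hh⟩ = ∑ r : Fin n, if r = ⟨h + 1, hh⟩ then δ r else 0 := by simp
    rw [this, ← Finset.sum_add_distrib]
    refine Finset.sum_congr rfl fun r _ => ?_
    simp only [Fin.ext_iff]
    split_ifs <;> omega
  · intro i _
    simp only [show (h < n ∧ h + 1 < (i : ℕ) + 1) ↔ (h < (i : ℕ) + 1 ∧ h + 1 < (i : ℕ) + 1) by omega,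
      sub_self, mul_zero]

theorem sum_tripleList (n : ℕ) (f : ℕ × ℕ × ℕ → ℤ) :
    ((tripleList n).map f).sum = ∑ j ∈ Finset.range n, ∑ i ∈ Finset.range j,
      ∑ h ∈ Finset.Ico i j, f (i, h, j) := by
  rw [← List.sum_toFinset f (nodup_tripleList n)]
  simp only [Finset.sum_sigma']
  refine Finset.sum_nbij' (fun x => ⟨x.2.2, x.1, x.2.1⟩) (fun y => (y.2.1, y.2.2, y.1))
    ?_ ?_ ?_ ?_ ?_
  · rintro ⟨i, h, j⟩ hx
    rw [List.mem_toFinset, mem_tripleList] at hx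
    simp only [Finset.mem_sigma, Finset.mem_range, Finset.mem_Ico] at hx ⊢
    omega
  · rintro ⟨j, i, h⟩ hx
    rw [List.mem_toFinset, mem_tripleList]
    simp only [Finset.mem_sigma, Finset.mem_range, Finset.mem_Ico] at hx ⊢
    omega
  · rintro ⟨i, h, j⟩ _
    rfl
  · rintro ⟨j, i, h⟩ _
    rfl
  · rintro ⟨i, h, j⟩ _
    rfl

theorem sum_Ico_eq_sum_range_ite {a b N : ℕ} (h : b ≤ N) (f : ℕ → ℤ) :
    ∑ s ∈ Finset.Ico a b, f s =
      ∑ s ∈ Finset.range N, (if a ≤ s ∧ s < b then 1 else 0) * f s := by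
  simp only [ite_mul, one_mul, zero_mul]
  rw [← Finset.sum_filter]
  refine Finset.sum_congr ?_ fun _ _ => rfl
  ext s
  simp only [Finset.mem_Ico, Finset.mem_filter, Finset.mem_range]
  omega

theorem sum_range_four_comm (N : ℕ) (g : ℕ → ℕ → ℕ → ℕ → ℤ) :
    ∑ l ∈ Finset.range N, ∑ k ∈ Finset.range N, ∑ i ∈ Finset.range N, ∑ j ∈ Finset.range N,
      g i j k l = ∑ i ∈ Finset.range N, ∑ j ∈ Finset.range N, ∑ k ∈ Finset.range N,
        ∑ l ∈ Finset.range N, g i j k l := by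
  have h : ∀ f : ℕ → ℕ → ℕ → ℤ, ∑ k ∈ Finset.range N, ∑ i ∈ Finset.range N, ∑ j ∈ Finset.range N,
      f k i j = ∑ i ∈ Finset.range N, ∑ j ∈ Finset.range N, ∑ k ∈ Finset.range N, f k i j := by
    intro f
    rw [Finset.sum_comm]
    exact Finset.sum_congr rfl fun i _ => Finset.sum_comm
  rw [Finset.sum_comm]
  exact (Finset.sum_congr rfl fun k _ => h fun l i j => g i j k l).trans
    (h fun k i j => ∑ l ∈ Finset.range N, g i j k l)

/-- The identity that makes the exponents of the factors add up. -/
theorem sum_blocks_eq (N : ℕ) (a : ℕ → ℕ → ℤ) :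
    (∑ j ∈ Finset.range N, ∑ i ∈ Finset.range j, ∑ h ∈ Finset.Ico i j,
      a i j * ∑ s ∈ Finset.range j, a h s) +
    (∑ j ∈ Finset.range N, ∑ i ∈ Finset.range j, ∑ h ∈ Finset.Ico i j,
      a j i * if h + 1 < j then ∑ s ∈ Finset.range j, a s (h + 1)
        else ∑ s ∈ Finset.range (j + 1), a s j + ∑ r ∈ Finset.Ico (i + 1) j, a j r) =
    ∑ i ∈ Finset.range N, ∑ j ∈ Finset.range N, ∑ k ∈ Finset.range N, ∑ l ∈ Finset.range N,
      (if k ≤ i ∧ j < l then 1 else 0) * (a i j * a k l) := by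
  -- The extra sum in the last factor, `h + 1 = j`, supplies the entries in row `j` that the columns
  -- `p < j` lack, so that all columns `i < p ≤ j` are summed over the rows `≤ j`.
  have hlow : ∀ i j, i < j → ∑ h ∈ Finset.Ico i j,
      a j i * (if h + 1 < j then ∑ s ∈ Finset.range j, a s (h + 1)
        else ∑ s ∈ Finset.range (j + 1), a s j + ∑ r ∈ Finset.Ico (i + 1) j, a j r) =
      a j i * ∑ p ∈ Finset.Ico (i + 1) (j + 1), ∑ s ∈ Finset.range (j + 1), a s p := by
    intro i j hij
    rw [← Finset.mul_sum]
    congr 1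
    rw [Finset.sum_Ico_add' (fun p => if p < j then ∑ s ∈ Finset.range j, a s p
        else ∑ s ∈ Finset.range (j + 1), a s j + ∑ r ∈ Finset.Ico (i + 1) j, a j r) i j 1,
      Finset.sum_Ico_succ_top (by omega), Finset.sum_Ico_succ_top (by omega),
      if_neg (lt_irrefl _), add_comm (∑ s ∈ Finset.range (j + 1), a s j), ← add_assoc,
      ← Finset.sum_add_distrib]
    congr 1
    refine Finset.sum_congr rfl fun p hp => ?_
    rw [if_pos (Finset.mem_Ico.1 hp).2, Finset.sum_range_succ]
  have h1 : ∀ j ∈ Finset.range N, ∑ i ∈ Finset.range j, ∑ h ∈ Finset.Ico i j,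
      a i j * ∑ s ∈ Finset.range j, a h s =
      ∑ i ∈ Finset.range N, ∑ h ∈ Finset.range N, ∑ s ∈ Finset.range N,
        (if i ≤ h ∧ h < j ∧ s < j then 1 else 0) * (a h s * a i j) := by
    intro j hj
    have hj := (Finset.mem_range.1 hj).le
    simp only [Finset.range_eq_Ico (a := j), sum_Ico_eq_sum_range_ite hj, Finset.mul_sum]
    refine Finset.sum_congr rfl fun i _ => Finset.sum_congr rfl fun h _ =>
      Finset.sum_congr rfl fun s _ => ?_
    split_ifs <;> first | omega | ring
  have h2 : ∀ j ∈ Finset.range N, ∑ i ∈ Finset.range j, ∑ h ∈ Finset.Ico i j,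
      a j i * (if h + 1 < j then ∑ s ∈ Finset.range j, a s (h + 1)
        else ∑ s ∈ Finset.range (j + 1), a s j + ∑ r ∈ Finset.Ico (i + 1) j, a j r) =
      ∑ i ∈ Finset.range N, ∑ s ∈ Finset.range N, ∑ p ∈ Finset.range N,
        (if i < p ∧ p ≤ j ∧ s ≤ j then 1 else 0) * (a j i * a s p) := by
    intro j hj
    have hj' := Finset.mem_range.1 hj
    rw [Finset.sum_congr rfl fun i hi => hlow i j (Finset.mem_range.1 hi)]
    simp only [Finset.range_eq_Ico (a := j), Finset.range_eq_Ico (a := j + 1),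
      sum_Ico_eq_sum_range_ite hj'.le, sum_Ico_eq_sum_range_ite (b := j + 1) hj', Finset.mul_sum]
    refine Finset.sum_congr rfl fun i _ => ?_
    rw [Finset.sum_comm]
    refine Finset.sum_congr rfl fun p _ => Finset.sum_congr rfl fun s _ => ?_
    split_ifs <;> first | omega | ring
  -- After renaming, the first sum runs over the quadruples with `i < l` and the second over those
  -- with `l ≤ i`.
  rw [Finset.sum_congr rfl h1, Finset.sum_congr rfl h2,
    sum_range_four_comm N fun h s i j => (if i ≤ h ∧ h < j ∧ s < j then 1 else 0) * (a h s * a i j),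
    ← Finset.sum_add_distrib]
  refine Finset.sum_congr rfl fun i _ => ?_
  rw [← Finset.sum_add_distrib]
  refine Finset.sum_congr rfl fun j _ => ?_
  rw [← Finset.sum_add_distrib]
  refine Finset.sum_congr rfl fun k _ => ?_
  rw [← Finset.sum_add_distrib]
  refine Finset.sum_congr rfl fun l _ => ?_
  split_ifs <;> omega

theorem codimExp_eq_sum_range (K : Type*) [Field K] {A : Matrix (Fin n) (Fin n) ℕ}
    (hA : A ∈ Theta n d) :
    codimExp K d A = ∑ i ∈ Finset.range n, ∑ j ∈ Finset.range n, ∑ k ∈ Finset.range n,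
      ∑ l ∈ Finset.range n, (if k ≤ i ∧ j < l then 1 else 0) *
        ((natEntry A i j : ℤ) * (natEntry A k l : ℤ)) := by
  rw [codimExp_eq K hA, Finset.sum_range]
  refine Finset.sum_congr rfl fun i _ => ?_
  rw [Finset.sum_range]
  refine Finset.sum_congr rfl fun j _ => ?_
  rw [natEntry_val, cornerSum, cornerSum, Nat.cast_sum, Nat.cast_sum, ← Finset.sum_sub_distrib,
    Finset.sum_range, Finset.mul_sum]
  refine Finset.sum_congr rfl fun k _ => ?_
  rw [Nat.cast_sum, Nat.cast_sum, ← Finset.sum_sub_distrib, Finset.sum_range, Finset.mul_sum]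
  refine Finset.sum_congr rfl fun l _ => ?_
  have := l.2
  rw [natEntry_val]
  split_ifs <;> first | omega | simp

/-- Compatibility gives the diagonal entries explicitly, and `sum_blocks_eq` adds up the products.
This is why the leading coefficient of `m_A` is exactly 1. -/
theorem sum_codimExp (K : Type*) [Field K] {A : Matrix (Fin n) (Fin n) ℕ} (hA : A ∈ Theta n d)
    {D D' : ℕ × ℕ × ℕ → Fin n → ℕ} {mu mu' : Fin n → ℕ}
    (hD : IsCompatible (natEntry A) D (tripleList n) (rowSum A) mu)
    (hD' : IsCompatible (natEntry A.transpose) D' (tripleList n) (rowSum A.transpose) mu') :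
    ((tripleList n).map fun x => codimExp K d (tripleMat (natEntry A) D x)).sum +
      ((tripleList n).map fun x =>
        codimExp K d (tripleMat (natEntry A.transpose) D' x).transpose).sum = codimExp K d A := by
  have hrow : ∀ (B : Matrix (Fin n) (Fin n) ℕ) (m : Fin n),
      rowSum B m = ∑ s ∈ Finset.range n, natEntry B m s := fun B m => by
    rw [Finset.sum_range]
    simp only [natEntry_val, rowSum]
  have hT : ∀ x ∈ tripleList n, tripleMat (natEntry A) D x ∈ Theta n d := hD.mem_Theta hA
  have hT' : ∀ x ∈ tripleList n, tripleMat (natEntry A.transpose) D' x ∈ Theta n d :=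
    hD'.mem_Theta (transpose_mem_Theta hA)
  have hv := tripleList_diagValues n le_rfl hD fun m _ => hrow A m
  have hv' := tripleList_diagValues n le_rfl hD' fun m _ => hrow A.transpose m
  have e1 : ∀ x ∈ tripleList n, codimExp K d (tripleMat (natEntry A) D x) =
      (natEntry A x.1 x.2.2 : ℤ) * ∑ s ∈ Finset.range x.2.2, (natEntry A x.2.1 s : ℤ) := by
    intro x hx
    have h1 := mem_tripleList.1 hx
    rw [tripleMat, codimExp_elemMat K (by omega) (hT x hx), (hv x hx).1 _ rfl, Nat.cast_sum]
  have e2 : ∀ x ∈ tripleList n, codimExp K d (tripleMat (natEntry A.transpose) D' x).transpose =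
      (natEntry A x.2.2 x.1 : ℤ) * if x.2.1 + 1 < x.2.2 then
        ∑ s ∈ Finset.range x.2.2, (natEntry A s (x.2.1 + 1) : ℤ)
      else ∑ s ∈ Finset.range (x.2.2 + 1), (natEntry A s x.2.2 : ℤ) +
        ∑ r ∈ Finset.Ico (x.1 + 1) x.2.2, (natEntry A x.2.2 r : ℤ) := by
    intro x hx
    have h1 := mem_tripleList.1 hx
    rw [tripleMat, codimExp_elemMat_transpose K (by omega) (hT' x hx), (hv' x hx).2 _ rfl]
    simp only [natEntry_transpose]
    push_cast
    rfl
  rw [List.map_congr_left e1, List.map_congr_left e2, sum_tripleList, sum_tripleList,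
    codimExp_eq_sum_range K hA]
  exact sum_blocks_eq n fun i j => (natEntry A i j : ℤ)

end Exponents

/-! ## The expansion of the monomials -/

section Corners

variable {n : ℕ}

theorem sum_range_eq_sum_fin {f : ℕ → ℕ} (hf : ∀ r, n ≤ r → f r = 0) (i : ℕ) :
    ∑ r ∈ Finset.range i, f r = ∑ r : Fin n, if (r : ℕ) < i then f r else 0 := by
  rw [← Finset.sum_range fun r => if r < i then f r else 0, ← Finset.sum_filter]
  symm
  apply Finset.sum_subset
  · intro r hr
    simp only [Finset.mem_filter, Finset.mem_range] at hr ⊢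
    exact hr.2
  · intro r hr hr'
    simp only [Finset.mem_filter, Finset.mem_range] at hr hr'
    exact hf r (by omega)

theorem cornerSum_eq_sum_range (A : Matrix (Fin n) (Fin n) ℕ) (i j : ℕ) :
    cornerSum A i j = ∑ r ∈ Finset.range i, ∑ s ∈ Finset.range j, natEntry A r s := by
  rw [sum_range_eq_sum_fin (n := n)]
  · refine Finset.sum_congr rfl fun r _ => ?_
    rw [sum_range_eq_sum_fin (n := n)]
    · simp only [natEntry_val]
      split_ifs with h <;> simp [h]
    · intro s hs
      rw [natEntry, dif_neg (by omega)]
  · intro r hr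
    refine Finset.sum_eq_zero fun s _ => ?_
    rw [natEntry, dif_neg (by omega)]

theorem blockSum_add_cornerSum (A : Matrix (Fin n) (Fin n) ℕ) (i j : ℕ) :
    blockSum (natEntry A) i j n + cornerSum A i j = cornerSum A i n := by
  rcases Nat.le_total j n with h | h
  · rw [cornerSum_eq_sum_range, cornerSum_eq_sum_range, blockSum, ← Finset.sum_add_distrib]
    refine Finset.sum_congr rfl fun r _ => ?_
    rw [add_comm, Finset.sum_range_add_sum_Ico _ h]
  · rw [blockSum_of_le _ _ h, zero_add, cornerSum_of_le_right _ _ h]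

/-- The sum of the entries in the rows `≤ i` and the columns `≥ j`. -/
def upperCorner (A : Matrix (Fin n) (Fin n) ℕ) (i j : Fin n) : ℕ :=
  ∑ r ∈ Finset.Iic i, ∑ s ∈ Finset.Ici j, A r s

theorem upperCorner_add_cornerSum (A : Matrix (Fin n) (Fin n) ℕ) (i j : Fin n) :
    upperCorner A i j + cornerSum A (i + 1) j = cornerSum A (i + 1) n := by
  have h : upperCorner A i j =
      ∑ r : Fin n, ∑ s : Fin n, if (r : ℕ) < i + 1 ∧ (j : ℕ) ≤ s then A r s else 0 := by
    rw [upperCorner, ← Finset.filter_ge_eq_Iic, ← Finset.filter_le_eq_Ici, Finset.sum_filter]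
    refine Finset.sum_congr rfl fun r _ => ?_
    rw [Finset.sum_filter]
    simp only [Fin.le_def, Nat.lt_succ_iff]
    split_ifs with h <;> simp [h]
  rw [h, cornerSum, cornerSum, ← Finset.sum_add_distrib]
  refine Finset.sum_congr rfl fun r _ => ?_
  rw [← Finset.sum_add_distrib]
  refine Finset.sum_congr rfl fun s _ => ?_
  have := s.2
  split_ifs <;> omega

theorem lowerCorner_eq (A : Matrix (Fin n) (Fin n) ℕ) (i j : Fin n) :
    ∑ r ∈ Finset.Ici i, ∑ s ∈ Finset.Iic j, A r s = upperCorner A.transpose j i := by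
  exact Finset.sum_comm

theorem matPreceq_iff {A B : Matrix (Fin n) (Fin n) ℕ} :
    MatPreceq A B ↔ (∀ i j, i < j → upperCorner A i j ≤ upperCorner B i j) ∧
      ∀ i j, i < j → upperCorner A.transpose i j ≤ upperCorner B.transpose i j := by
  simp only [MatPreceq, lowerCorner_eq]
  exact and_congr_right fun _ => ⟨fun h i j => h j i, fun h i j => h j i⟩

theorem MatPrec.ne {A B : Matrix (Fin n) (Fin n) ℕ} (h : MatPrec A B) : A ≠ B := by
  rintro rfl
  rcases h.2 with ⟨i, j, -, h⟩ | ⟨i, j, -, h⟩ <;> exact lt_irrefl _ h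

/-- Row sums convert the upper corners into the corner sums at `(i, j)` with `i ≤ j`; column sums
and the lower corners give the rest. Hence `⪯` between distinct matrices with equal row and column
sums is strict. -/
theorem eq_of_upperCorner_eq {A B : Matrix (Fin n) (Fin n) ℕ} (hrow : rowSum A = rowSum B)
    (hcol : rowSum A.transpose = rowSum B.transpose)
    (h1 : ∀ i j, i < j → upperCorner A i j = upperCorner B i j)
    (h2 : ∀ i j, i < j → upperCorner A.transpose i j = upperCorner B.transpose i j) : A = B := by
  have half : ∀ {A B : Matrix (Fin n) (Fin n) ℕ}, rowSum A = rowSum B →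
      (∀ i j, i < j → upperCorner A i j = upperCorner B i j) → ∀ i j : ℕ, i ≤ j → j ≤ n →
      cornerSum A i j = cornerSum B i j := by
    intro A B hrow h i j hij hj
    have hfull : ∀ i, cornerSum A i n = cornerSum B i n := fun i => by
      rw [cornerSum_right_full, cornerSum_right_full, hrow]
    rcases Nat.eq_zero_or_pos i with h0 | h0
    · rw [h0, cornerSum_zero_left, cornerSum_zero_left]
    rcases hj.eq_or_lt with h3 | h3
    · rw [h3, hfull]
    have h4 := upperCorner_add_cornerSum A ⟨i - 1, by omega⟩ ⟨j, h3⟩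
    have h5 := upperCorner_add_cornerSum B ⟨i - 1, by omega⟩ ⟨j, h3⟩
    rw [h _ _ (by simp only [Fin.lt_def]; omega)] at h4
    simp only [show i - 1 + 1 = i by omega] at h4 h5
    have := hfull i
    omega
  apply eq_of_cornerSum_eq
  intro i j hi hj
  rcases Nat.le_total i j with hij | hij
  · exact half hrow h1 i j hij hj
  · have := half hcol h2 j i hij hi
    rwa [cornerSum_transpose, cornerSum_transpose] at this

theorem MatPreceq.matPrec {A B : Matrix (Fin n) (Fin n) ℕ} (h : MatPreceq A B) (hne : A ≠ B)
    (hrow : rowSum A = rowSum B) (hcol : rowSum A.transpose = rowSum B.transpose) :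
    MatPrec A B := by
  refine ⟨h, ?_⟩
  by_contra h0
  simp only [lowerCorner_eq] at h0
  push Not at h0
  rw [matPreceq_iff] at h
  exact hne (eq_of_upperCorner_eq hrow hcol
    (fun i j hij => le_antisymm (h.1 i j hij) (h0.1 i j hij))
    fun i j hij => le_antisymm (h.2 i j hij) (h0.2 j i hij))

/-- A weight that increases strictly along `≺`. -/
def cornerWeight (A : Matrix (Fin n) (Fin n) ℕ) : ℕ :=
  ∑ p : Fin n × Fin n,
    if p.1 < p.2 then upperCorner A p.1 p.2 + upperCorner A.transpose p.1 p.2 else 0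

theorem MatPrec.cornerWeight_lt {A B : Matrix (Fin n) (Fin n) ℕ} (h : MatPrec A B) :
    cornerWeight A < cornerWeight B := by
  obtain ⟨h1, h2⟩ := h
  rw [matPreceq_iff] at h1
  simp only [lowerCorner_eq] at h2
  apply Finset.sum_lt_sum
  · rintro ⟨i, j⟩ _
    simp only
    split_ifs with hij
    · exact add_le_add (h1.1 i j hij) (h1.2 i j hij)
    · exact le_rfl
  · rcases h2 with ⟨i, j, hij, h3⟩ | ⟨i, j, hij, h3⟩
    · refine ⟨(i, j), Finset.mem_univ _, ?_⟩
      rw [if_pos hij, if_pos hij]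
      exact add_lt_add_of_lt_of_le h3 (h1.2 i j hij)
    · refine ⟨(j, i), Finset.mem_univ _, ?_⟩
      rw [if_pos hij, if_pos hij]
      exact add_lt_add_of_le_of_lt (h1.1 j i hij) h3

end Corners

/-! ### Chains of flags and the values of the monomials -/

section Counts

variable {F : Type*} [Field F] {n d : ℕ}

/-- The flag with members `V_m ∩ W_m`. -/
def StepFlag.infFlag (V W : StepFlag F n d) : StepFlag F n d :=
  StepFlag.mk (fun m => V.sub m ⊓ W.sub m) (by simp [StepFlag.sub_zero]) (by simp [StepFlag.sub_of_le])
    (fun _ _ h => inf_le_inf (V.sub_mono h) (W.sub_mono h))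

theorem StepFlag.sub_infFlag (V W : StepFlag F n d) (m : ℕ) :
    (V.infFlag W).sub m = V.sub m ⊓ W.sub m :=
  StepFlag.sub_mk _ _ _ _ _

theorem infFlag_comm (V W : StepFlag F n d) : V.infFlag W = W.infFlag V :=
  StepFlag.ext_sub fun m _ _ => by rw [StepFlag.sub_infFlag, StepFlag.sub_infFlag, inf_comm]

variable [Finite F] {R : Type*} [CommSemiring R]

/-- Replacing `U` by the larger `W` only enlarges the intersections in the inequality of
`tripleList_necessary`. -/
theorem upperCorner_le_of_stepProd_ne_zero {A : Matrix (Fin n) (Fin n) ℕ} {V U W : StepFlag F n d}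
    (h : stepProd R F n d (natEntry A) (tripleList n) V U ≠ 0) (hUW : ∀ m, U.sub m ≤ W.sub m)
    {i j : Fin n} (hij : i < j) : upperCorner (relPos V W) i j ≤ upperCorner A i j := by
  obtain ⟨-, -, h1, -⟩ := tripleList_necessary _ n le_rfl h
  have h2 := h1 (i + 1) j hij
  have h3 : interDim V U (i + 1) j ≤ interDim V W (i + 1) j :=
    Submodule.finrank_mono (inf_le_inf_left _ (hUW _))
  rw [interDim_eq_cornerSum V W] at h3
  rw [dim_eq_cornerSum V W] at h2
  have h4 := upperCorner_add_cornerSum (relPos V W) i j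
  have h5 := upperCorner_add_cornerSum A i j
  have h6 := blockSum_add_cornerSum A (i + 1) j
  omega

/-- For `i ≤ m` the intersection of `V_i` with `V_m ∩ W_m` is `V_i ∩ W_m`, so all the inequalities
are equalities. -/
theorem stepProd_infFlag {V W : StepFlag F n d} :
    stepProd R F n d (natEntry (relPos V W)) (tripleList n) V (V.infFlag W) = 1 := by
  apply tripleList_sufficient _ n le_rfl
  · intro m
    rw [StepFlag.sub_infFlag]
    exact inf_le_left
  · intro m hm
    rw [StepFlag.sub_infFlag, W.sub_of_le hm, inf_top_eq]
  · intro i m him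
    have h1 : interDim V (V.infFlag W) i m = interDim V W i m := by
      rw [interDim, StepFlag.sub_infFlag, ← inf_assoc, inf_eq_left.2 (V.sub_mono him), interDim]
    rw [h1, interDim_eq_cornerSum, dim_eq_cornerSum V W, add_comm, blockSum_add_cornerSum]

/-- The flag `U` lies in `V ∩ W`, and the total loss of dimension along the chain is the codimension
of `V_m ∩ W_m` in `V_m`. -/
theorem eq_infFlag {V W U : StepFlag F n d}
    (h : stepProd R F n d (natEntry (relPos V W)) (tripleList n) V U ≠ 0)
    (hUW : ∀ m, U.sub m ≤ W.sub m) : U = V.infFlag W := by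
  obtain ⟨h1, -, -, h2⟩ := tripleList_necessary _ n le_rfl h
  refine StepFlag.ext_sub fun m _ _ => ?_
  rw [StepFlag.sub_infFlag]
  apply Submodule.eq_of_le_of_finrank_eq (le_inf (h1 m) (hUW m))
  have h3 := h2 m
  have h4 := blockSum_add_cornerSum (relPos V W) m m
  have h5 := interDim_eq_cornerSum V W m m
  rw [dim_eq_cornerSum V W] at h3
  rw [interDim] at h5
  rw [StepFlag.dim] at h3
  omega

/-- The first factor fixes its row sums. For `n < 2` there is no factor, and the total decides. -/
theorem type_eq_of_isCompatible {a : ℕ → ℕ → ℕ} {D : ℕ × ℕ × ℕ → Fin n → ℕ}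
    {lam lam' mu mu' : Fin n → ℕ} (h : IsCompatible a D (tripleList n) lam mu)
    (h' : IsCompatible a D (tripleList n) lam' mu') (hs : ∑ i, lam i = ∑ i, lam' i) :
    lam = lam' := by
  rcases Nat.lt_or_ge n 2 with hn | hn
  · have : Subsingleton (Fin n) := Fin.subsingleton_iff_le_one.2 (by omega)
    funext i
    rwa [Fintype.sum_subsingleton _ i, Fintype.sum_subsingleton _ i] at hs
  · have hmem : ((0, 0, 1) : ℕ × ℕ × ℕ) ∈ tripleList n := mem_tripleList.2 ⟨le_rfl, by simp, hn⟩
    generalize tripleList n = l at h h' hmem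
    cases l with
    | nil => simp at hmem
    | cons x l => exact h.1.symm.trans h'.1

theorem tripleList_bound : ∀ x ∈ tripleList n, x.2.1 + 1 < n := fun x hx => by
  have := mem_tripleList.1 hx
  omega

/-- The row sums of the matrices in both products are compatible with the matrix `A`. -/
def IsCompatiblePair (A : Matrix (Fin n) (Fin n) ℕ) (D D' : ℕ × ℕ × ℕ → Fin n → ℕ) : Prop :=
  (∃ mu, IsCompatible (natEntry A) D (tripleList n) (rowSum A) mu) ∧
  ∃ mu, IsCompatible (natEntry A.transpose) D' (tripleList n) (rowSum A.transpose) mu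

theorem orbitProd_mul_relPos {D D' : ℕ × ℕ × ℕ → Fin n → ℕ} (V W : StepFlag F n d)
    (h : IsCompatiblePair (relPos V W) D D') :
    (orbitProd R F d (natEntry (relPos V W)) D (tripleList n) *
      (orbitProd R F d (natEntry (relPos V W).transpose) D' (tripleList n)).transpose) V W = 1 := by
  obtain ⟨⟨mu, h1⟩, ⟨mu', h2⟩⟩ := h
  rw [rowSum_relPos] at h1
  rw [rowSum_relPos_transpose] at h2
  have e1 := orbitProd_eq_stepProd (R := R) tripleList_bound h1
  have e2 := orbitProd_eq_stepProd (R := R) tripleList_bound h2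
  rw [mul_apply_eq_of_unique (V.infFlag W), Matrix.transpose_apply, e1, e2, stepProd_infFlag,
    infFlag_comm, ← relPos_transpose, stepProd_infFlag, one_mul]
  intro U h3 h4
  rw [e1] at h3
  rw [Matrix.transpose_apply, e2] at h4
  exact eq_infFlag h3 (tripleList_necessary _ n le_rfl h4).1

theorem preceq_of_orbitProd_mul_ne_zero {A : Matrix (Fin n) (Fin n) ℕ} (hA : A ∈ Theta n d)
    {D D' : ℕ × ℕ × ℕ → Fin n → ℕ} {V W : StepFlag F n d} (h : IsCompatiblePair A D D')
    (h0 : (orbitProd R F d (natEntry A) D (tripleList n) *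
      (orbitProd R F d (natEntry A.transpose) D' (tripleList n)).transpose) V W ≠ 0) :
    relPos V W = A ∨ MatPrec (relPos V W) A := by
  obtain ⟨⟨mu, h1⟩, ⟨mu', h2⟩⟩ := h
  obtain ⟨U, h3, h4⟩ := exists_of_mul_apply_ne_zero h0
  rw [Matrix.transpose_apply] at h4
  have hd := relPos_mem_Theta V W
  have hV : V.type = rowSum A :=
    type_eq_of_isCompatible (isCompatible_of_orbitProd_ne_zero h3) h1 (by
      rw [← rowSum_relPos V W]
      exact hd.trans hA.symm)
  have hW : W.type = rowSum A.transpose :=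
    type_eq_of_isCompatible (isCompatible_of_orbitProd_ne_zero h4) h2 (by
      rw [← rowSum_relPos_transpose V W, sum_rowSum_transpose, sum_rowSum_transpose]
      exact hd.trans hA.symm)
  rw [orbitProd_eq_stepProd tripleList_bound (hV ▸ h1)] at h3
  rw [orbitProd_eq_stepProd tripleList_bound (hW ▸ h2)] at h4
  by_cases hne : relPos V W = A
  · exact Or.inl hne
  right
  refine MatPreceq.matPrec (matPreceq_iff.2 ⟨fun i j hij => ?_, fun i j hij => ?_⟩) hne
    ((rowSum_relPos V W).trans hV) ((rowSum_relPos_transpose V W).trans hW)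
  · exact upperCorner_le_of_stepProd_ne_zero h3 (tripleList_necessary _ n le_rfl h4).1 hij
  · rw [← relPos_transpose]
    exact upperCorner_le_of_stepProd_ne_zero h4 (tripleList_necessary _ n le_rfl h3).1 hij

theorem isCompatiblePair_of_ne_zero {D D' : ℕ × ℕ × ℕ → Fin n → ℕ} {V W : StepFlag F n d}
    (h0 : (orbitProd R F d (natEntry (relPos V W)) D (tripleList n) *
      (orbitProd R F d (natEntry (relPos V W).transpose) D' (tripleList n)).transpose) V W ≠ 0) :
    IsCompatiblePair (relPos V W) D D' := by
  obtain ⟨U, h3, h4⟩ := exists_of_mul_apply_ne_zero h0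
  rw [Matrix.transpose_apply] at h4
  have h1 := isCompatible_of_orbitProd_ne_zero h3
  have h2 := isCompatible_of_orbitProd_ne_zero h4
  rw [← rowSum_relPos V W] at h1
  rw [← rowSum_relPos_transpose V W] at h2
  exact ⟨⟨_, h1⟩, ⟨_, h2⟩⟩

/-- Compatibility is purely combinatorial, so the chains through `V ∩ W` over a single finite field
suffice. -/
theorem exists_isCompatiblePair {A : Matrix (Fin n) (Fin n) ℕ} (hA : A ∈ Theta n d) :
    ∃ D D', IsCompatiblePair A D D' := by
  obtain ⟨V, W, rfl⟩ := exists_relPos_eq (ZMod 2) hA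
  have h1 : stepProd ℕ (ZMod 2) n d (natEntry (relPos V W)) (tripleList n) V (V.infFlag W) ≠ 0 := by
    rw [stepProd_infFlag]
    exact one_ne_zero
  have h2 : stepProd ℕ (ZMod 2) n d (natEntry (relPos V W).transpose) (tripleList n) W
      (W.infFlag V) ≠ 0 := by
    rw [← relPos_transpose, stepProd_infFlag]
    exact one_ne_zero
  obtain ⟨D, hD⟩ := exists_isCompatible_of_stepProd_ne_zero tripleList_bound (nodup_tripleList n) h1
  obtain ⟨D', hD'⟩ := exists_isCompatible_of_stepProd_ne_zero tripleList_bound (nodup_tripleList n) h2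
  rw [← rowSum_relPos V W] at hD
  rw [← rowSum_relPos_transpose V W] at hD'
  exact ⟨D, D', ⟨_, hD⟩, ⟨_, hD'⟩⟩

end Counts

/-! ## The monomials in the convolution algebra -/

section Monomials

variable {n d : ℕ}

/-- The unit `v ^ (-k) t ^ k`. -/
noncomputable def uPow (k : ℤ) : CoeffRing := vPow (-k) * tPow k

theorem uPow_zero : uPow 0 = 1 := by simp [uPow, vPow, tPow]

theorem uPow_add (k l : ℤ) : uPow (k + l) = uPow k * uPow l := by
  simp only [uPow, vPow, tPow, neg_add, LaurentPolynomial.T_add, map_mul]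
  ring

theorem uPow_neg_mul (k : ℤ) : uPow (-k) * uPow k = 1 := by
  rw [← uPow_add, neg_add_cancel, uPow_zero]

theorem specialize_uPow_ne_zero (q : OddPrimePower) (k : ℤ) : specialize q (uPow k) ≠ 0 := by
  intro h
  have h1 := congrArg (specialize q) (uPow_neg_mul k)
  rw [map_mul, h, mul_zero, map_one] at h1
  exact zero_ne_one h1

theorem stdElt_eq (K : Type*) [Field K] (A : Matrix (Fin n) (Fin n) ℕ) :
    stdElt K d A = uPow (codimExp K d A) • orbitFun d A := rfl

theorem orbitFun_eq (K : Type*) [Field K] (A : Matrix (Fin n) (Fin n) ℕ) :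
    orbitFun d A = uPow (-codimExp K d A) • stdElt K d A := by
  rw [stdElt_eq, smul_smul, uPow_neg_mul, one_smul]

theorem stdElt_apply (K : Type*) [Field K] (A : Matrix (Fin n) (Fin n) ℕ) (q : OddPrimePower) :
    (stdElt K d A : ConvFamily n d) q =
      specialize q (uPow (codimExp K d A)) • orbitMatrix ℝ[T;T⁻¹] q.field d A := by
  rw [← orbitFun_apply]
  ext V W : 1
  exact ConvFamily.smul_apply _ _ q V W

theorem prod_stdElt_apply (K : Type*) [Field K] (l : List (Matrix (Fin n) (Fin n) ℕ))
    (q : OddPrimePower) : ((l.map (stdElt K d)).prod : ConvFamily n d) q =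
      specialize q (uPow (l.map (codimExp K d)).sum) •
        (l.map (orbitMatrix ℝ[T;T⁻¹] q.field d)).prod := by
  induction l with
  | nil =>
    rw [List.map_nil, List.map_nil, List.map_nil, List.sum_nil, uPow_zero, map_one, one_smul]
    rfl
  | cons A l ih =>
    simp only [List.map_cons, List.prod_cons, List.sum_cons]
    rw [uPow_add, map_mul, ← smul_mul_smul_comm, ← stdElt_apply, ← ih]
    rfl

theorem UpperTriple.toNat_injective : Function.Injective (UpperTriple.toNat (n := n)) := by
  rintro ⟨⟨i, h, j⟩, _⟩ ⟨⟨i', h', j'⟩, _⟩ h0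
  simp only [UpperTriple.toNat, Prod.mk.injEq, Fin.val_inj] at h0
  simp only [Subtype.mk.injEq, Prod.mk.injEq]
  exact h0

theorem LowerTriple.toNat_injective : Function.Injective (LowerTriple.toNat (n := n)) := by
  rintro ⟨⟨i, h, j⟩, _⟩ ⟨⟨i', h', j'⟩, _⟩ h0
  simp only [LowerTriple.toNat, Prod.mk.injEq, Fin.val_inj] at h0
  simp only [Subtype.mk.injEq, Prod.mk.injEq]
  exact ⟨h0.2.2, h0.2.1, h0.1⟩

/-- The diagonal matrices of the first product, indexed by triples of numbers. -/
noncomputable def DiagData.upper (D : DiagData n) : ℕ × ℕ × ℕ → Fin n → ℕ :=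
  Function.extend UpperTriple.toNat D.1 0

/-- The diagonal matrices of the second product, indexed by triples `(j, h, i)` of numbers. -/
noncomputable def DiagData.lower (D : DiagData n) : ℕ × ℕ × ℕ → Fin n → ℕ :=
  Function.extend LowerTriple.toNat D.2 0

theorem DiagData.upper_toNat (D : DiagData n) (x : UpperTriple n) : D.upper x.toNat = D.1 x :=
  UpperTriple.toNat_injective.extend_apply _ _ _

theorem DiagData.lower_toNat (D : DiagData n) (x : LowerTriple n) : D.lower x.toNat = D.2 x :=
  LowerTriple.toNat_injective.extend_apply _ _ _

theorem UpperTriple.toNat_mem (x : UpperTriple n) : x.toNat ∈ tripleList n :=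
  mem_tripleList.2 ⟨x.2.1, x.2.2, x.1.2.2.2⟩

theorem LowerTriple.toNat_mem (x : LowerTriple n) : x.toNat ∈ tripleList n :=
  mem_tripleList.2 ⟨x.2.1, x.2.2, x.1.1.2⟩

theorem UpperTriple.exists_toNat_eq {y : ℕ × ℕ × ℕ} (hy : y ∈ tripleList n) :
    ∃ x : UpperTriple n, x.toNat = y := by
  rw [← UpperTriple.map_sort, List.mem_map] at hy
  obtain ⟨x, -, hx⟩ := hy
  exact ⟨x, hx⟩

theorem LowerTriple.exists_toNat_eq {y : ℕ × ℕ × ℕ} (hy : y ∈ tripleList n) :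
    ∃ x : LowerTriple n, x.toNat = y := by
  rw [← LowerTriple.map_sort, List.mem_reverse, List.mem_map] at hy
  obtain ⟨x, -, hx⟩ := hy
  exact ⟨x, hx⟩

theorem upperFactor_eq (A : Matrix (Fin n) (Fin n) ℕ) (D : DiagData n) (x : UpperTriple n) :
    upperFactor A D x = tripleMat (natEntry A) D.upper x.toNat := by
  rw [tripleMat, D.upper_toNat]
  ext r s
  rw [elemMat_apply]
  simp [upperFactor, UpperTriple.toNat, Matrix.diagonal_apply, Fin.ext_iff, natEntry_val]

theorem lowerFactor_eq (A : Matrix (Fin n) (Fin n) ℕ) (D : DiagData n) (x : LowerTriple n) :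
    lowerFactor A D x = (tripleMat (natEntry A.transpose) D.lower x.toNat).transpose := by
  rw [tripleMat, D.lower_toNat]
  ext r s
  rw [Matrix.transpose_apply, elemMat_apply]
  simp only [lowerFactor, LowerTriple.toNat, Matrix.add_apply, Matrix.diagonal_apply,
    Matrix.of_apply, Fin.ext_iff, natEntry_val, Matrix.transpose_apply]
  congr 1
  · split_ifs with h1 h2 h2
    · rw [Fin.ext h1]
    · omega
    · omega
    · rfl
  · split_ifs <;> omega

theorem map_upperFactor (A : Matrix (Fin n) (Fin n) ℕ) (D : DiagData n) :
    ((Finset.univ : Finset (UpperTriple n)).sort UpperLE).map (upperFactor A D) =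
      (tripleList n).map (tripleMat (natEntry A) D.upper) := by
  rw [← UpperTriple.map_sort, List.map_map]
  exact List.map_congr_left fun x _ => upperFactor_eq A D x

theorem map_lowerFactor (A : Matrix (Fin n) (Fin n) ℕ) (D : DiagData n) :
    ((Finset.univ : Finset (LowerTriple n)).sort LowerLE).map (lowerFactor A D) =
      ((tripleList n).map fun x =>
        (tripleMat (natEntry A.transpose) D.lower x).transpose).reverse := by
  rw [← LowerTriple.map_sort, List.map_reverse, List.reverse_reverse, List.map_map]
  exact List.map_congr_left fun x _ => lowerFactor_eq A D x

theorem monomialElt_eq (K : Type*) [Field K] (A : Matrix (Fin n) (Fin n) ℕ) (D : DiagData n) :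
    monomialElt K d A D =
      (((tripleList n).map (tripleMat (natEntry A) D.upper)).map (stdElt K d)).prod *
      ((((tripleList n).map fun x =>
        (tripleMat (natEntry A.transpose) D.lower x).transpose).reverse).map (stdElt K d)).prod := by
  rw [← map_upperFactor, ← map_lowerFactor, List.map_map, List.map_map]
  rfl

/-- The exponent of the power of `t` in the leading coefficient of a monomial. -/
noncomputable def monomialExp (K : Type*) [Field K] (d : ℕ) (A : Matrix (Fin n) (Fin n) ℕ)
    (D : DiagData n) : ℤ :=
  ((tripleList n).map fun x => codimExp K d (tripleMat (natEntry A) D.upper x)).sum +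
    ((tripleList n).map fun x =>
      codimExp K d (tripleMat (natEntry A.transpose) D.lower x).transpose).sum

/-- Transposing reverses the second product and turns its factors into those of the first kind for
the transpose of `A`. -/
theorem monomialElt_apply (K : Type*) [Field K] (A : Matrix (Fin n) (Fin n) ℕ) (D : DiagData n)
    (q : OddPrimePower) (V W : StepFlag q.field n d) :
    (monomialElt K d A D : ConvFamily n d) q V W = specialize q (uPow (monomialExp K d A D)) *
      (orbitProd ℝ[T;T⁻¹] q.field d (natEntry A) D.upper (tripleList n) *
        (orbitProd ℝ[T;T⁻¹] q.field d (natEntry A.transpose) D.lower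
          (tripleList n)).transpose) V W := by
  have h : (monomialElt K d A D : ConvFamily n d) q = specialize q (uPow (monomialExp K d A D)) •
      (orbitProd ℝ[T;T⁻¹] q.field d (natEntry A) D.upper (tripleList n) *
        (orbitProd ℝ[T;T⁻¹] q.field d (natEntry A.transpose) D.lower
          (tripleList n)).transpose) := by
    rw [monomialElt_eq]
    refine (congrArg₂ (· * ·) (prod_stdElt_apply K _ q) (prod_stdElt_apply K _ q)).trans ?_
    rw [smul_mul_smul_comm, ← map_mul, ← uPow_add, monomialExp, List.map_reverse,
      List.map_reverse, List.sum_reverse, orbitProd, orbitProd, Matrix.transpose_list_prod]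
    simp only [List.map_map, Function.comp_def, orbitMatrix_transpose]
  rw [h, Matrix.smul_apply, smul_eq_mul]

/-- The elements whose left multiplication preserves the invariant functions. -/
noncomputable def stableSubalgebra (n d : ℕ) : Subalgebra CoeffRing (ConvFamily n d) where
  carrier := {x | ∀ g ∈ invariantSubmodule n d, x * g ∈ invariantSubmodule n d}
  mul_mem' := fun {x y} hx hy g hg => by
    rw [mul_assoc]
    exact hx _ (hy g hg)
  add_mem' := fun {x y} hx hy g hg => by
    rw [add_mul]
    exact add_mem (hx g hg) (hy g hg)
  algebraMap_mem' := fun a g hg => by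
    rw [← Algebra.smul_def]
    exact Submodule.smul_mem _ _ hg

theorem mem_invariantSubmodule_of_mem_stableSubalgebra {x : ConvFamily n d}
    (hx : x ∈ stableSubalgebra n d) : x ∈ invariantSubmodule n d := by
  have := hx 1 (one_mem_invariantSubmodule n d)
  rwa [mul_one] at this

theorem stdElt_mem_stableSubalgebra (K : Type*) [Field K] {B : Matrix (Fin n) (Fin n) ℕ}
    (hB : HasPolynomialCounts d B) : (stdElt K d B : ConvFamily n d) ∈ stableSubalgebra n d :=
  (stableSubalgebra n d).smul_mem (x := (orbitFun d B : ConvFamily n d))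
    (fun _ hf => orbitFun_mul_mem hB hf) _

theorem monomialElt_mem_stableSubalgebra (K : Type*) [Field K] (A : Matrix (Fin n) (Fin n) ℕ)
    (D : DiagData n) : (monomialElt K d A D : ConvFamily n d) ∈ stableSubalgebra n d := by
  suffices h : monomialElt K d A D ∈ (stableSubalgebra n d).comap (convAlg n d).val from h
  rw [monomialElt_eq]
  refine mul_mem (list_prod_mem fun x hx => ?_) (list_prod_mem fun x hx => ?_)
  · simp only [List.mem_map, exists_exists_and_eq_and] at hx
    obtain ⟨y, hy, rfl⟩ := hx
    exact stdElt_mem_stableSubalgebra K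
      (hasPolynomialCounts_elemMat (tripleList_bound y hy) _ _)
  · simp only [List.mem_map, List.mem_reverse, exists_exists_and_eq_and] at hx
    obtain ⟨y, hy, rfl⟩ := hx
    exact stdElt_mem_stableSubalgebra K
      (hasPolynomialCounts_elemMat_transpose (tripleList_bound y hy) _ _)

/-- The value of a family at a pair of flags. -/
def ConvFamily.evalHom (q : OddPrimePower) (V W : StepFlag q.field n d) :
    ConvFamily n d →+ ℝ[T;T⁻¹] where
  toFun f := f q V W
  map_zero' := rfl
  map_add' _ _ := rfl

theorem sum_smul_orbitFun_apply (s : Finset (Matrix (Fin n) (Fin n) ℕ))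
    (c : Matrix (Fin n) (Fin n) ℕ → CoeffRing) (q : OddPrimePower) (V W : StepFlag q.field n d) :
    ((∑ A ∈ s, c A • orbitFun d A : convAlg n d) : ConvFamily n d) q V W =
      if relPos V W ∈ s then specialize q (c (relPos V W)) else 0 := by
  have h : ∀ A, ((c A • orbitFun d A : convAlg n d) : ConvFamily n d) q V W =
      if relPos V W = A then specialize q (c A) else 0 := fun A => by
    refine (ConvFamily.smul_apply _ _ q V W).trans ?_
    rw [orbitFun_apply]
    split_ifs with h
    · rw [orbitMatrix_eq_one h, mul_one]
    · rw [orbitMatrix_eq_zero h, mul_zero]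
  change ((ConvFamily.evalHom q V W).comp ((convAlg n d).val : convAlg n d →+ ConvFamily n d))
    (∑ A ∈ s, c A • orbitFun d A) = _
  rw [map_sum]
  refine (Finset.sum_congr rfl fun A _ => h A).trans ?_
  rw [Finset.sum_ite_eq]

theorem eq_sum_smul_orbitFun {x : convAlg n d} {c : Matrix (Fin n) (Fin n) ℕ → CoeffRing}
    (h : invariantFun d c = (x : ConvFamily n d)) :
    x = ∑ A ∈ (finite_Theta n d).toFinset, c A • orbitFun d A := by
  apply Subtype.ext
  rw [← h]
  funext q
  ext V W : 1
  rw [sum_smul_orbitFun_apply, if_pos]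
  · rfl
  · rw [Set.Finite.mem_toFinset]
    exact relPos_mem_Theta V W

theorem apply_eq_zero_of_mem_lowerTerms (K : Type*) [Field K] {x : convAlg n d}
    {q : OddPrimePower} {V W : StepFlag q.field n d} (hx : x ∈ lowerTerms K d (relPos V W)) :
    (x : ConvFamily n d) q V W = 0 := by
  induction hx using Submodule.span_induction with
  | mem x hx =>
    obtain ⟨A', -, h, rfl⟩ := hx
    rw [stdElt_apply, Matrix.smul_apply, orbitMatrix_eq_zero h.ne.symm, smul_zero]
  | zero => rfl
  | add x y _ _ hx hy =>
    change (x : ConvFamily n d) q V W + (y : ConvFamily n d) q V W = 0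
    rw [hx, hy, add_zero]
  | smul a x _ hx =>
    change (a • (x : ConvFamily n d)) q V W = 0
    rw [ConvFamily.smul_apply, hx, mul_zero]

/-- Lower terms vanish on the orbit of `A`, where the leading term is nonzero. So the product of
orbit matrices has a nonzero entry at a pair in this orbit, and any nonzero entry there forces
compatibility. -/
theorem IsTriangular.isCompatiblePair {K : Type*} [Field K] {A : Matrix (Fin n) (Fin n) ℕ}
    (hA : A ∈ Theta n d) {D : DiagData n} (h : IsTriangular K d A D) :
    IsCompatiblePair A D.upper D.lower := by
  obtain ⟨-, -, L, hL, hm⟩ := h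
  obtain ⟨V, W, rfl⟩ := exists_relPos_eq (OddPrimePower.ofThree 0).field hA
  refine isCompatiblePair_of_ne_zero (R := ℝ[T;T⁻¹]) (V := V) (W := W) fun h0 => ?_
  have h1 := monomialElt_apply K (relPos V W) D _ V W
  rw [h0, mul_zero, hm] at h1
  have h2 : (stdElt K d (relPos V W) : ConvFamily n d) _ V W +
    (L : ConvFamily n d) _ V W = 0 := h1
  rw [apply_eq_zero_of_mem_lowerTerms K hL, add_zero, stdElt_apply, Matrix.smul_apply,
    orbitMatrix_eq_one rfl, smul_eq_mul, mul_one] at h2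
  exact specialize_uPow_ne_zero _ _ h2

/-- The polynomial counts provide coefficients in `𝒜`; evaluating them over all finite fields shows
that the one at `A` is the normalizing unit and that those outside `A` and the matrices `≺ A`
vanish. -/
theorem IsCompatiblePair.isTriangular (K : Type*) [Field K] {A : Matrix (Fin n) (Fin n) ℕ}
    (hA : A ∈ Theta n d) {D : DiagData n} (h : IsCompatiblePair A D.upper D.lower) :
    IsTriangular K d A D := by
  classical
  have hexp : monomialExp K d A D = codimExp K d A := by
    obtain ⟨⟨mu, h1⟩, ⟨mu', h2⟩⟩ := h
    exact sum_codimExp K hA h1 h2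
  refine ⟨fun x => ?_, fun x => ?_, ?_⟩
  · obtain ⟨mu, h1⟩ := h.1
    rw [upperFactor_eq]
    exact h1.mem_Theta hA _ x.toNat_mem
  · obtain ⟨mu, h1⟩ := h.2
    rw [lowerFactor_eq]
    exact transpose_mem_Theta (h1.mem_Theta (transpose_mem_Theta hA) _ x.toNat_mem)
  obtain ⟨c, hc⟩ :=
    mem_invariantSubmodule_of_mem_stableSubalgebra (monomialElt_mem_stableSubalgebra (d := d) K A D)
  have hval : ∀ q (V W : StepFlag q.field n d), specialize q (c (relPos V W)) =
      specialize q (uPow (monomialExp K d A D)) *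
      (orbitProd ℝ[T;T⁻¹] q.field d (natEntry A) D.upper (tripleList n) *
        (orbitProd ℝ[T;T⁻¹] q.field d (natEntry A.transpose) D.lower
          (tripleList n)).transpose) V W := fun q V W => by
    rw [← monomialElt_apply, ← hc]
    rfl
  have hcA : c A = uPow (codimExp K d A) := by
    rw [← sub_eq_zero]
    refine eq_zero_of_specialize fun q => ?_
    obtain ⟨V, W, rfl⟩ := exists_relPos_eq q.field hA
    rw [map_sub, hval, orbitProd_mul_relPos V W h, mul_one, hexp, sub_self]
  have hcA' : ∀ A' ∈ Theta n d, A' ≠ A → ¬ MatPrec A' A → c A' = 0 := by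
    intro A' hA' hne hprec
    refine eq_zero_of_specialize fun q => ?_
    obtain ⟨V, W, rfl⟩ := exists_relPos_eq q.field hA'
    rw [hval]
    by_contra h0
    rcases preceq_of_orbitProd_mul_ne_zero hA h (right_ne_zero_of_mul h0) with h1 | h1
    · exact hne h1
    · exact hprec h1
  refine ⟨∑ A' ∈ (finite_Theta n d).toFinset.erase A, c A' • orbitFun d A',
    sum_mem fun A' hA' => ?_, ?_⟩
  · rw [Finset.mem_erase, Set.Finite.mem_toFinset] at hA'
    by_cases hprec : MatPrec A' A
    · rw [orbitFun_eq K]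
      exact Submodule.smul_mem _ _ (Submodule.smul_mem _ _
        (Submodule.subset_span ⟨A', hA'.2, hprec, rfl⟩))
    · rw [hcA' A' hA'.2 hA'.1 hprec, zero_smul]
      exact zero_mem _
  · rw [eq_sum_smul_orbitFun hc, stdElt_eq, ← hcA]
    exact (Finset.add_sum_erase _ (fun A => c A • orbitFun d A)
      ((Set.Finite.mem_toFinset _).2 hA)).symm

theorem existsUnique_isTriangular (K : Type*) [Field K] {A : Matrix (Fin n) (Fin n) ℕ}
    (hA : A ∈ Theta n d) : ∃! D : DiagData n, IsTriangular K d A D := by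
  obtain ⟨D, D', ⟨mu, h⟩, ⟨mu', h'⟩⟩ := exists_isCompatiblePair hA
  refine ⟨(fun x => D x.toNat, fun x => D' x.toNat),
    IsCompatiblePair.isTriangular K hA ⟨⟨mu, h.congr fun y hy => ?_⟩,
      ⟨mu', h'.congr fun y hy => ?_⟩⟩, fun E hE => ?_⟩
  · obtain ⟨x, rfl⟩ := UpperTriple.exists_toNat_eq hy
    rw [DiagData.upper_toNat]
  · obtain ⟨x, rfl⟩ := LowerTriple.exists_toNat_eq hy
    rw [DiagData.lower_toNat]
  · obtain ⟨⟨nu, h1⟩, ⟨nu', h2⟩⟩ := hE.isCompatiblePair hA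
    refine Prod.ext (funext fun x => ?_) (funext fun x => ?_)
    · rw [← E.upper_toNat]
      exact h1.eq tripleList_bound h _ x.toNat_mem
    · rw [← E.lower_toNat]
      exact h2.eq tripleList_bound h' _ x.toNat_mem

end Monomials

/-! ## The monomial basis -/

section Basis

variable {n d : ℕ} {K : Type*} [Field K] {D : Theta n d → DiagData n}

/-- The triangular system is inverted by induction on `cornerWeight`, since every lower term has
smaller weight. -/
theorem stdElt_mem_of_monomialElt_mem (hD : ∀ A : Theta n d, IsTriangular K d A.1 (D A))
    {p : Submodule CoeffRing (convAlg n d)} (hp : ∀ A : Theta n d, monomialElt K d A.1 (D A) ∈ p)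
    {A : Matrix (Fin n) (Fin n) ℕ} (hA : A ∈ Theta n d) : stdElt K d A ∈ p := by
  induction hw : cornerWeight A using Nat.strong_induction_on generalizing A with
  | _ w ih =>
    subst hw
    obtain ⟨-, -, L, hL, hm⟩ := hD ⟨A, hA⟩
    have hLp : L ∈ p := by
      refine Submodule.span_le.2 ?_ hL
      rintro _ ⟨A', hA', h, rfl⟩
      exact ih _ h.cornerWeight_lt hA' rfl
    have h : stdElt K d A = monomialElt K d A (D ⟨A, hA⟩) + (-1 : CoeffRing) • L := by
      rw [hm, add_assoc]
      nth_rewrite 1 [← one_smul CoeffRing L]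
      rw [← add_smul, add_neg_cancel, zero_smul, add_zero]
    rw [h]
    exact p.add_mem (hp _) (p.smul_mem _ hLp)

theorem orbitFun_mem_of_monomialElt_mem (hD : ∀ A : Theta n d, IsTriangular K d A.1 (D A))
    {p : Submodule CoeffRing (convAlg n d)} (hp : ∀ A : Theta n d, monomialElt K d A.1 (D A) ∈ p)
    {A : Matrix (Fin n) (Fin n) ℕ} (hA : A ∈ Theta n d) : orbitFun d A ∈ p := by
  rw [orbitFun_eq K]
  exact Submodule.smul_mem _ _ (stdElt_mem_of_monomialElt_mem hD hp hA)

/-- Monomials are stable and triangularity expresses every `e_A` through them. So all products of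
generic invariant functions are generic again, although polynomial counts were established only for
elementary matrices. -/
theorem convAlg_le_stableSubalgebra (hD : ∀ A : Theta n d, IsTriangular K d A.1 (D A)) :
    convAlg n d ≤ stableSubalgebra n d := by
  refine Algebra.adjoin_le ?_
  rintro _ ⟨c, rfl⟩
  have h := eq_sum_smul_orbitFun (n := n) (d := d) (c := c)
    (x := ⟨invariantFun d c, Algebra.subset_adjoin ⟨c, rfl⟩⟩) rfl
  have h1 : (⟨invariantFun d c, Algebra.subset_adjoin ⟨c, rfl⟩⟩ : convAlg n d) ∈
      Subalgebra.toSubmodule ((stableSubalgebra n d).comap (convAlg n d).val) := by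
    rw [h]
    refine sum_mem fun A hA => Submodule.smul_mem _ _ (orbitFun_mem_of_monomialElt_mem hD
      (fun B => monomialElt_mem_stableSubalgebra K B.1 (D B)) ?_)
    exact (Set.Finite.mem_toFinset _).1 hA
  exact h1

theorem span_monomialElt (hD : ∀ A : Theta n d, IsTriangular K d A.1 (D A)) :
    Submodule.span CoeffRing (Set.range fun A : Theta n d => monomialElt K d A.1 (D A)) = ⊤ := by
  refine eq_top_iff.2 fun x _ => ?_
  obtain ⟨c, hc⟩ :=
    mem_invariantSubmodule_of_mem_stableSubalgebra (convAlg_le_stableSubalgebra hD x.2)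
  rw [eq_sum_smul_orbitFun hc]
  refine sum_mem fun A hA => Submodule.smul_mem _ _ (orbitFun_mem_of_monomialElt_mem hD
    (fun B => Submodule.subset_span (Set.mem_range_self B)) ?_)
  exact (Set.Finite.mem_toFinset _).1 hA

theorem linearIndependent_orbitFun (n d : ℕ) :
    LinearIndependent CoeffRing fun A : Theta n d => orbitFun d A.1 := by
  classical
  have := (finite_Theta n d).fintype
  rw [Fintype.linearIndependent_iffₛ]
  let c (g : Theta n d → CoeffRing) (B : Matrix (Fin n) (Fin n) ℕ) : CoeffRing :=
    if h : B ∈ Theta n d then g ⟨B, h⟩ else 0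
  have hc : ∀ g (B : Theta n d), c g B.1 = g B := fun g B => dif_pos B.2
  have hsum : ∀ g : Theta n d → CoeffRing, ∑ B ∈ (finite_Theta n d).toFinset, c g B • orbitFun d B =
      ∑ B : Theta n d, g B • orbitFun d B.1 := fun g => by
    rw [Set.Finite.toFinset_eq_toFinset, ← Finset.sum_set_coe]
    simp only [hc]
  intro f g hfg A
  rw [← hsum, ← hsum] at hfg
  rw [← hc f, ← hc g, ← sub_eq_zero]
  refine eq_zero_of_specialize fun q => ?_
  obtain ⟨V, W, h⟩ := exists_relPos_eq q.field A.2
  have hA : relPos V W ∈ (finite_Theta n d).toFinset :=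
    (Set.Finite.mem_toFinset _).2 (relPos_mem_Theta V W)
  have h1 := sum_smul_orbitFun_apply (finite_Theta n d).toFinset (c f) q V W
  have h2 := sum_smul_orbitFun_apply (finite_Theta n d).toFinset (c g) q V W
  rw [if_pos hA, h] at h1 h2
  rw [map_sub, ← h1, ← h2, hfg, sub_self]

/-- The monomials and the independent `e_A` are indexed by the same finite set, so the Orzech
property of the commutative ring `𝒜` makes the surjection given by the spanning monomials injective.
-/
theorem linearIndependent_monomialElt (hD : ∀ A : Theta n d, IsTriangular K d A.1 (D A)) :
    LinearIndependent CoeffRing fun A : Theta n d => monomialElt K d A.1 (D A) := by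
  have := (finite_Theta n d).fintype
  have hspan := span_monomialElt hD
  have : Module.Finite CoeffRing (convAlg n d) :=
    Module.finite_def.2 (Submodule.fg_def.2 ⟨_, Set.finite_range _, hspan⟩)
  rw [linearIndependent_iff_injective_fintypeLinearCombination]
  refine OrzechProperty.injective_of_surjective_of_injective _ _
    ((linearIndependent_iff_injective_fintypeLinearCombination).1
      (linearIndependent_orbitFun n d)) ?_
  rw [← LinearMap.range_eq_top, Fintype.range_linearCombination]
  exact hspan

end Basis

theorem mainTheorem6 (n d : ℕ) (hn : 0 < n) (hd : 0 < d) (K : Type*) [Field K] [IsAlgClosed K] :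
    (∀ A ∈ Theta n d, ∃! D : DiagData n, IsTriangular K d A D) ∧
    (∀ D : Theta n d → DiagData n, (∀ A : Theta n d, IsTriangular K d A.1 (D A)) →
      LinearIndependent CoeffRing (fun A : Theta n d => monomialElt K d A.1 (D A)) ∧
      Submodule.span CoeffRing (Set.range fun A : Theta n d => monomialElt K d A.1 (D A)) = ⊤) :=
  ⟨fun _ hA => existsUnique_isTriangular K hA,
    fun _ hD => ⟨linearIndependent_monomialElt hD, span_monomialElt hD⟩⟩
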